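/- Let $X=(X,d,\mu)$ be a metric measure space: $d$ is a metric and $\mu$ is a Borel regular outer measure such that every ball has positive and finite measure. Assume that $\mu$ is doubling, i.e. there is a constant $C_d$ with $\mu(B(x,2r))\le C_d\,\mu(B(x,r))$ for all $x\in X$, $r>0$. Let $L^0(X)$ be the set of $\mu$-measurable functions $u:X\to[-\infty,\infty]$ that are finite almost everywhere. **Medians and bases.** For $0<\gamma<1$, a measurable $f:X\to[-\infty,\infty]$ and a measurable set $A$ with $\mu(A)<\infty$, let $$m_f^\gamma(A)=\inf\{a\in\mathbb R:\ \mu(\{x\in A: f(x)>a\})<\gamma\mu(A)\}\in[-\infty,\infty]\qquad(\inf\emptyset=\infty).$$ A differentiation basis $\mathcal B=\bigcup_{x\in X}\mathcal B(x)$ consists, for each $x\in X$, of a collection $\mathcal B(x)$ of bounded measurable sets containing $x$ such that for every $\varepsilon>0$ there is $B\in\mathcal B(x)$ with $\operatorname{diam}B<\varepsilon$. Put $$\limsup_{\mathcal B\ni B\to x}m_f^\gamma(B)=\lim_{\varepsilon\to0}\sup\{m_f^\gamma(B):B\in\mathcal B(x),\ \operatorname{diam}B<\varepsilon\},$$ define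 $\liminf$ similarly with $\inf$, and let $\lim_{\mathcal B\ni B\to x}m_f^\gamma(B)$ be their common value when they coincide. **Function spaces.** Let $0<s\le1$, $0<p<\infty$, $0<q\le\infty$ and $u\in L^0(X)$. A measurable $g:X\to[0,\infty]$ is an $s$-gradient of $u$ if, for some null set $E$, $|u(x)-u(y)|\le d(x,y)^s(g(x)+g(y))$ for all $x,y\in X\setminus E$. A sequence $(g_k)_{k\in\mathbb Z}$ of nonnegative measurable functions is a fractional $s$-gradient of $u$ if, for some null set $E$, $|u(x)-u(y)|\le d(x,y)^s(g_k(x)+g_k(y))$ for all $k\in\mathbb Z$ and all $x,y\in X\setminus E$ with $2^{-k-1}\le d(x,y)<2^{-k}$. Define $$\|u\|_{M^{s,p}}=\|u\|_{L^p}+\inf_g\|g\|_{L^p},\qquad \|u\|_{M^s_{p,q}}=\|u\|_{L^p}+\inf_{(g_k)}\big\|\,\|(g_k)_k\|_{l^q}\big\|_{L^p},\qquad \|u\|_{N^s_{p,q}}=\|u\|_{L^p}+\inf_{(g_k)}\big\|(\|g_k\|_{L^p})_k\big\|_{l^q},$$ the infima being over all $s$-gradients, respectively fractional $s$-gradients,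 of $u$. The Hajłasz space $M^{s,p}(X)$, the Hajłasz–Triebel–Lizorkin space $M^s_{p,q}(X)$ and the Hajłasz–Besov space $N^s_{p,q}(X)$ consist of the $u\in L^0(X)$ for which the respective (quasi)norm is finite; $M^s_{p,\infty}(X)=M^{s,p}(X)$. **Capacity.** For such a space $\mathcal F$, the capacity of $E\subset X$ is $C_{\mathcal F}(E)=\inf\|u\|_{\mathcal F}^p$, the infimum being over all $u\in\mathcal F$ with $u\ge1$ on a neighbourhood of $E$. A function $u:X\to[-\infty,\infty]$ is quasicontinuous if for every $\varepsilon>0$ there is $E\subset X$ with $C_{\mathcal F}(E)<\varepsilon$ such that $u|_{X\setminus E}$ is continuous. **Theorem.** Let $\mathcal B$ be a differentiation basis on the doubling metric measure space $X$. Let $\mathcal F\in\{N^s_{p,q}(X),M^s_{p,q}(X)\}$ with $0<s<1$ and $0<p,q<\infty$, or $\mathcal F=M^s_{p,\infty}(X)=M^{s,p}(X)$ with $0<s\le1$ and $0<p<\infty$. Then the following are equivalent. 1. For every quasicontinuous $u\in\mathcal F$ there exists a set $E$ with $C_{\mathcal F}(E)=0$ such that $\lim_{\mathcal B\ni B\to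 x}m^\gamma_u(B)=u(x)$ for every $0<\gamma<1$ and every $x\in X\setminus E$. 2. For every $0<\gamma<1$ there exists a constant $C$ such that $$C_{\mathcal F}\big(\{x\in X:\limsup_{\mathcal B\ni B\to x}m^\gamma_{|u|}(B)>\lambda\}\big)\le C\lambda^{-p}\|u\|_{\mathcal F}^p$$ for every $\lambda>0$ and every $u\in\mathcal F$. 3. For every $0<\gamma<1$, every $\lambda>0$ and every sequence $(u_k)$ in $\mathcal F$ with $\|u_k\|_{\mathcal F}\to0$, $$C_{\mathcal F}\big(\{x\in X:\limsup_{\mathcal B\ni B\to x}m^\gamma_{|u_k|}(B)>\lambda\}\big)\to0\qquad\text{as }k\to\infty.$$ -/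

import Mathlib

open MeasureTheory Filter Topology
open scoped ENNReal NNReal

noncomputable section

namespace MedianDiff

variable {X : Type*} [MetricSpace X] [MeasurableSpace X]

/-- A metric measure space whose balls have positive and finite measure and whose measure is
doubling. A Borel regular outer measure corresponds to a Borel measure `μ`; its measurable sets and
functions are then the `NullMeasurableSet`s and the `AEMeasurable` functions of `μ`. -/
structure IsDoublingSpace (μ : Measure X) : Prop where
  ball_pos : ∀ (x : X) (r : ℝ), 0 < r → 0 < μ (Metric.ball x r)
  ball_lt_top : ∀ (x : X) (r : ℝ), 0 < r → μ (Metric.ball x r) < ∞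
  doubling : ∃ Cd : ℝ≥0, ∀ (x : X) (r : ℝ), 0 < r →
    μ (Metric.ball x (2 * r)) ≤ Cd * μ (Metric.ball x r)

/-- The class `L⁰(X)`: measurable extended real functions that are finite almost everywhere. -/
def MemL0 (μ : Measure X) (u : X → EReal) : Prop :=
  AEMeasurable u μ ∧ ∀ᵐ x ∂μ, u x ≠ ⊤ ∧ u x ≠ ⊥

/-! ### Medians and differentiation bases -/

/-- The `γ`-median `inf {a ∈ ℝ : μ {x ∈ A : f x > a} < γ μ(A)}` (equal to `⊤` if there is no such
`a`). -/
def median (μ : Measure X) (γ : ℝ) (f : X → EReal) (A : Set X) : EReal :=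
  ⨅ (a : ℝ) (_ : μ {x ∈ A | (a : EReal) < f x} < ENNReal.ofReal γ * μ A), (a : EReal)

/-- The function `|u|`. -/
def absFun (u : X → EReal) : X → EReal := fun x => ((u x).abs : EReal)

/-- A differentiation basis, given by the collections `𝓑 x` for `x ∈ X`. -/
structure IsDifferentiationBasis (μ : Measure X) (𝓑 : X → Set (Set X)) : Prop where
  mem : ∀ x, ∀ B ∈ 𝓑 x, x ∈ B
  bounded : ∀ x, ∀ B ∈ 𝓑 x, Bornology.IsBounded B
  measurable : ∀ x, ∀ B ∈ 𝓑 x, NullMeasurableSet B μ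
  exists_small : ∀ x, ∀ ε : ℝ, 0 < ε → ∃ B ∈ 𝓑 x, Metric.diam B < ε

/-- `limsup` of the medians of `f` over the sets of `𝓑 x` shrinking to `x`. The supremum is
monotone in `ε`, so its limit as `ε → 0` is the infimum over `ε > 0`. -/
def limsupMedian (μ : Measure X) (𝓑 : X → Set (Set X)) (γ : ℝ) (f : X → EReal) (x : X) : EReal :=
  ⨅ (ε : ℝ) (_ : 0 < ε), ⨆ (B : Set X) (_ : B ∈ 𝓑 x ∧ Metric.diam B < ε), median μ γ f B

/-- `liminf` of the medians of `f` over the sets of `𝓑 x` shrinking to `x`. -/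
def liminfMedian (μ : Measure X) (𝓑 : X → Set (Set X)) (γ : ℝ) (f : X → EReal) (x : X) : EReal :=
  ⨆ (ε : ℝ) (_ : 0 < ε), ⨅ (B : Set X) (_ : B ∈ 𝓑 x ∧ Metric.diam B < ε), median μ γ f B

/-- The limit of the medians of `f` over the sets of `𝓑 x` shrinking to `x` exists and is `l`. -/
def HasMedianLimit (μ : Measure X) (𝓑 : X → Set (Set X)) (γ : ℝ) (f : X → EReal) (x : X)
    (l : EReal) : Prop :=
  limsupMedian μ 𝓑 γ f x = l ∧ liminfMedian μ 𝓑 γ f x = l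

/-! ### Gradients and function spaces -/

/-- `g` is an `s`-gradient of `u`. The null set `E` necessarily contains the points where `u` is
infinite, because there `(u x - u x).abs = ⊤`. -/
def IsGradient (μ : Measure X) (s : ℝ) (u : X → EReal) (g : X → ℝ≥0∞) : Prop :=
  AEMeasurable g μ ∧ ∃ E : Set X, μ E = 0 ∧ ∀ x ∉ E, ∀ y ∉ E,
    (u x - u y).abs ≤ ENNReal.ofReal (dist x y ^ s) * (g x + g y)

/-- `(g k)` is a fractional `s`-gradient of `u`. -/
def IsFracGradient (μ : Measure X) (s : ℝ) (u : X → EReal) (g : ℤ → X → ℝ≥0∞) : Prop :=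
  (∀ k, AEMeasurable (g k) μ) ∧ ∃ E : Set X, μ E = 0 ∧ ∀ k : ℤ, ∀ x ∉ E, ∀ y ∉ E,
    (2 : ℝ) ^ (-k - 1) ≤ dist x y → dist x y < (2 : ℝ) ^ (-k) →
      (u x - u y).abs ≤ ENNReal.ofReal (dist x y ^ s) * (g k x + g k y)

/-- The `l^q` (quasi)norm of a sequence indexed by `ℤ`, for `0 < q ≤ ∞`. -/
def lqNorm (q : ℝ≥0∞) (a : ℤ → ℝ≥0∞) : ℝ≥0∞ :=
  if q = ∞ then ⨆ k, a k else (∑' k, a k ^ q.toReal) ^ (1 / q.toReal)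

/-- The (quasi)norm of `L^p(X)`. -/
def lpNormX (μ : Measure X) (p : ℝ≥0∞) (u : X → EReal) : ℝ≥0∞ :=
  eLpNorm (fun x => (u x).abs) p μ

/-- The norm of the Hajłasz space `M^{s,p}(X)`. -/
def hajlaszNorm (μ : Measure X) (s : ℝ) (p : ℝ≥0∞) (u : X → EReal) : ℝ≥0∞ :=
  lpNormX μ p u + ⨅ (g : X → ℝ≥0∞) (_ : IsGradient μ s u g), eLpNorm g p μ

/-- The norm of the Hajłasz–Triebel–Lizorkin space `M^s_{p,q}(X)`. -/
def triebelLizorkinNorm (μ : Measure X) (s : ℝ) (p q : ℝ≥0∞) (u : X → EReal) : ℝ≥0∞ :=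
  lpNormX μ p u + ⨅ (g : ℤ → X → ℝ≥0∞) (_ : IsFracGradient μ s u g),
    eLpNorm (fun x => lqNorm q (fun k => g k x)) p μ

/-- The norm of the Hajłasz–Besov space `N^s_{p,q}(X)`. -/
def besovNorm (μ : Measure X) (s : ℝ) (p q : ℝ≥0∞) (u : X → EReal) : ℝ≥0∞ :=
  lpNormX μ p u + ⨅ (g : ℤ → X → ℝ≥0∞) (_ : IsFracGradient μ s u g),
    lqNorm q (fun k => eLpNorm (g k) p μ)

/-- `u` belongs to the function space with norm `N`. -/
def MemSpace (μ : Measure X) (N : (X → EReal) → ℝ≥0∞) (u : X → EReal) : Prop :=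
  MemL0 μ u ∧ N u < ∞

/-- The function `N` is the norm of `N^s_{p,q}(X)` or `M^s_{p,q}(X)` with `0 < s < 1` and
`0 < p, q < ∞`, or of `M^s_{p,∞}(X) = M^{s,p}(X)` with `0 < s ≤ 1` and `0 < p < ∞`. -/
def IsAdmissibleNorm (μ : Measure X) (p : ℝ≥0∞) (N : (X → EReal) → ℝ≥0∞) : Prop :=
  0 < p ∧ p < ∞ ∧ ∃ s : ℝ, 0 < s ∧
    ((s < 1 ∧ ∃ q : ℝ≥0∞, 0 < q ∧ q < ∞ ∧
        (N = besovNorm μ s p q ∨ N = triebelLizorkinNorm μ s p q)) ∨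
      (s ≤ 1 ∧ (N = triebelLizorkinNorm μ s p ∞ ∨ N = hajlaszNorm μ s p)))

/-! ### Capacity -/

/-- The capacity of `E` for the space with norm `N` and integrability exponent `p`: the infimum of
`N u ^ p` over all `u` in the space with `u ≥ 1` on a neighbourhood of `E`. -/
def capacity (μ : Measure X) (p : ℝ≥0∞) (N : (X → EReal) → ℝ≥0∞) (E : Set X) : ℝ≥0∞ :=
  ⨅ (u : X → EReal) (_ : MemSpace μ N u ∧ ∃ U : Set X, IsOpen U ∧ E ⊆ U ∧ ∀ x ∈ U, 1 ≤ u x),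
    N u ^ p.toReal

/-- Quasicontinuity with respect to the capacity. -/
def Quasicontinuous (μ : Measure X) (p : ℝ≥0∞) (N : (X → EReal) → ℝ≥0∞) (u : X → EReal) : Prop :=
  ∀ ε : ℝ≥0∞, 0 < ε → ∃ E : Set X, capacity μ p N E < ε ∧ ContinuousOn u Eᶜ

end MedianDiff

end

noncomputable section

namespace MedianDiff

/-! ### The absolute value on `EReal` -/

/-! The proof separates an abstract capacity argument from the spaces themselves. `IsGoodNorm` lists
what the argument needs: a quasi-triangle inequality and homogeneity, domination of the `L^p` norm,
density of continuous functions, and a lattice property: if `K ^ (i + 1) * N (u i) < C` for all `i`,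
then `⨆ |u i|` has norm at most `C`. The last one replaces countable subadditivity and survives for
exponents below one. It makes unions of capacity-null sets null, gives every function a
quasicontinuous representative, and yields the weak type bound cap{|u| > t} ≤ (K t⁻¹ N u)^p for
quasicontinuous `u` (`IsGoodNorm.capacity_quasicontinuous_le`).

(1) ⇒ (2): medians ignore null sets, so `u` may be replaced by a quasicontinuous representative `w`.
Applying (1) to |w|, the limsup of the medians of |u| is |w| quasieverywhere, and the weak type
bound applies. (2) ⇒ (3) is immediate. (3) ⇒ (1): take continuous `v n` with `N (u - v n) → 0`.
Where |u - v n| ≤ τ and the τ-medians of |u - v n| are asymptotically at most τ, continuity of `v n`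
puts the γ-medians of `u` asymptotically within 4τ of `u x`, provided τ ≤ min(γ, 1 - γ)
(`medians_near`). The exceptional sets have small capacity.

Density is the analytic part. For s < 1 and q < ∞, `exists_scale_approx` averages point samples of
`f` over a net at scale 2^(-n); the error has a fractional gradient made of a tail of the given one
and a geometric profile centred at that scale (`dense_of_isTailFunctional`). For q = ∞, `f` is
Hölder where its gradient and size are at most `n`; it is extended from there by McShane's formula
(`dense_tlFunctional_top`). -/

lemma abs_eq_max_toENNReal (x : EReal) : x.abs = max x.toENNReal (-x).toENNReal := by
  induction x with
  | bot => simp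
  | top => simp
  | coe x =>
    rw [EReal.abs_def, ← EReal.coe_neg, EReal.toENNReal_of_ne_top (EReal.coe_ne_top _),
      EReal.toENNReal_of_ne_top (EReal.coe_ne_top _), EReal.toReal_coe, EReal.toReal_coe,
      ← ENNReal.ofReal_max]
    rfl

lemma continuous_abs_ereal : Continuous EReal.abs := by
  have : EReal.abs = fun x => max x.toENNReal (-x).toENNReal := funext abs_eq_max_toENNReal
  rw [this]
  exact EReal.continuous_toENNReal.max (EReal.continuous_toENNReal.comp continuous_neg)

lemma abs_coe_ennreal (a : ℝ≥0∞) : ((a : EReal)).abs = a := by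
  rw [abs_eq_max_toENNReal, EReal.toENNReal_coe, EReal.toENNReal_of_nonpos, max_eq_left zero_le]
  exact EReal.neg_le_of_neg_le (by simpa using EReal.coe_ennreal_nonneg a)

lemma abs_coe_sub (a b : ℝ) : ((a : EReal) - (b : EReal)).abs = ‖a - b‖ₑ := by
  rw [← EReal.coe_sub, EReal.abs_def, ← Real.norm_eq_abs, ofReal_norm]

lemma abs_coe_real (a : ℝ) : ((a : EReal)).abs = ‖a‖ₑ := by
  rw [EReal.abs_def, ← Real.norm_eq_abs, ofReal_norm]

lemma abs_coe_ennreal_sub_le {A B D : ℝ≥0∞} (hA : A ≠ ∞) (hB : B ≠ ∞) (h1 : A ≤ B + D)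
    (h2 : B ≤ A + D) : ((A : EReal) - (B : EReal)).abs ≤ D := by
  by_cases hD : D = ∞
  · simp [hD]
  lift A to ℝ≥0 using hA
  lift B to ℝ≥0 using hB
  lift D to ℝ≥0 using hD
  have e1 : (A : ℝ) ≤ B + D := by exact_mod_cast h1
  have e2 : (B : ℝ) ≤ A + D := by exact_mod_cast h2
  have : (((A : ℝ≥0∞) : EReal) - ((B : ℝ≥0∞) : EReal)) = (((A : ℝ) : EReal) - ((B : ℝ) : EReal)) := rfl
  rw [this, ← EReal.coe_sub, EReal.abs_def]
  refine ENNReal.ofReal_le_of_le_toReal ?_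
  rw [ENNReal.coe_toReal, abs_le]
  constructor <;> linarith

lemma abs_le_abs_add_abs_sub {x y : EReal} (hx : x ≠ ⊤ ∧ x ≠ ⊥) (hy : y ≠ ⊤ ∧ y ≠ ⊥) :
    x.abs ≤ y.abs + (x - y).abs ∧ y.abs ≤ x.abs + (x - y).abs := by
  lift x to ℝ using hx
  lift y to ℝ using hy
  rw [abs_coe_sub, abs_coe_real, abs_coe_real]
  constructor
  · calc ‖x‖ₑ = ‖y + (x - y)‖ₑ := by rw [add_sub_cancel]
      _ ≤ _ := enorm_add_le _ _
  · calc ‖y‖ₑ = ‖x - (x - y)‖ₑ := by rw [sub_sub_cancel]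
      _ ≤ _ := enorm_sub_le

/-! ### The functional `(∫ f ^ p) ^ (1 / p)` -/

/-- The `L^p` (quasi)norm of an `ℝ≥0∞`-valued function, for `0 < p < ∞`. -/
def rNorm {α : Type*} [MeasurableSpace α] (μ : Measure α) (p : ℝ) (f : α → ℝ≥0∞) : ℝ≥0∞ :=
  (∫⁻ x, f x ^ p ∂μ) ^ (1 / p)

section rNorm

variable {α : Type*} [MeasurableSpace α] {μ : Measure α} {p : ℝ}

lemma eLpNorm_eq_rNorm {p : ℝ≥0∞} (h0 : p ≠ 0) (h1 : p ≠ ∞) (f : α → ℝ≥0∞) :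
    eLpNorm f p μ = rNorm μ p.toReal f := by
  rw [eLpNorm_eq_lintegral_rpow_enorm_toReal h0 h1]; rfl

/-- With counting measure, every estimate for `rNorm` also serves sequences. -/
lemma lqNorm_eq_rNorm {q : ℝ≥0∞} (h1 : q ≠ ∞) (a : ℤ → ℝ≥0∞) :
    lqNorm q a = rNorm Measure.count q.toReal a := by
  rw [lqNorm, if_neg h1, rNorm, lintegral_count]

lemma rNorm_rpow (hp : 0 < p) (f : α → ℝ≥0∞) : rNorm μ p f ^ p = ∫⁻ x, f x ^ p ∂μ := by
  rw [rNorm, ← ENNReal.rpow_mul, one_div, inv_mul_cancel₀ hp.ne', ENNReal.rpow_one]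

lemma rNorm_le_iff (hp : 0 < p) {f : α → ℝ≥0∞} {C : ℝ≥0∞} :
    rNorm μ p f ≤ C ↔ ∫⁻ x, f x ^ p ∂μ ≤ C ^ p := by
  rw [← rNorm_rpow hp, ENNReal.rpow_le_rpow_iff hp]

lemma rNorm_mono (hp : 0 < p) {f g : α → ℝ≥0∞} (h : f ≤ᵐ[μ] g) : rNorm μ p f ≤ rNorm μ p g := by
  rw [rNorm_le_iff hp, rNorm_rpow hp]
  exact lintegral_mono_ae (h.mono fun x hx => ENNReal.rpow_le_rpow hx hp.le)

lemma rNorm_const_mul (hp : 0 < p) {c : ℝ≥0∞} (hc : c ≠ ∞) (f : α → ℝ≥0∞) :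
    rNorm μ p (fun x => c * f x) = c * rNorm μ p f := by
  simp only [rNorm, ENNReal.mul_rpow_of_nonneg _ _ hp.le]
  rw [lintegral_const_mul' _ _ (ENNReal.rpow_ne_top_of_nonneg hp.le hc),
    ENNReal.mul_rpow_of_nonneg _ _ (by positivity), ← ENNReal.rpow_mul, mul_one_div,
    div_self hp.ne', ENNReal.rpow_one]

lemma rNorm_zero (hp : 0 < p) : rNorm μ p (fun _ => 0) = 0 := by
  simp [rNorm, ENNReal.zero_rpow_of_pos hp, hp]

lemma rpow_iSup {ι : Sort*} (hp : 0 < p) (f : ι → ℝ≥0∞) : (⨆ i, f i) ^ p = ⨆ i, f i ^ p :=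
  (ENNReal.orderIsoRpow p hp).map_iSup f

lemma tsum_half_pow_succ : ∑' i : ℕ, ((2 : ℝ≥0∞)⁻¹) ^ (i + 1) = 1 := by
  simp only [pow_succ]
  rw [ENNReal.tsum_mul_right, ENNReal.tsum_geometric, ENNReal.one_sub_inv_two, inv_inv]
  exact ENNReal.mul_inv_cancel (by simp) (by simp)

/-- The `p`-th power of a supremum is at most the sum of the `p`-th powers, and `2 ≤ K ^ p` turns
the weights into 2^(-i-1), which sum to one. No triangle inequality is used, so p < 1 is allowed. -/
lemma rNorm_iSup_le (hp : 0 < p) {K C : ℝ≥0∞} (hK : 2 ≤ K ^ p) {f : ℕ → α → ℝ≥0∞}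
    (hf : ∀ i, AEMeasurable (f i) μ) (h : ∀ i, K ^ (i + 1) * rNorm μ p (f i) ≤ C) :
    rNorm μ p (fun x => ⨆ i, f i x) ≤ C := by
  rw [rNorm_le_iff hp]
  have key : ∀ i, ∫⁻ x, f i x ^ p ∂μ ≤ (2 : ℝ≥0∞)⁻¹ ^ (i + 1) * C ^ p := by
    intro i
    have h1 := ENNReal.rpow_le_rpow (h i) hp.le
    rw [ENNReal.mul_rpow_of_nonneg _ _ hp.le, rNorm_rpow hp, ← ENNReal.rpow_natCast_mul,
      mul_comm _ p, ENNReal.rpow_mul, ENNReal.rpow_natCast] at h1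
    have h2 : (2 : ℝ≥0∞) ^ (i + 1) * ∫⁻ x, f i x ^ p ∂μ ≤ C ^ p :=
      le_trans (by gcongr) h1
    rw [← ENNReal.inv_pow, mul_comm, ← div_eq_mul_inv]
    rwa [ENNReal.le_div_iff_mul_le (by simp) (by simp), mul_comm]
  calc ∫⁻ x, (⨆ i, f i x) ^ p ∂μ ≤ ∫⁻ x, ∑' i, f i x ^ p ∂μ := by
        refine lintegral_mono fun x => ?_
        rw [rpow_iSup hp]
        exact iSup_le fun i => ENNReal.le_tsum i
    _ = ∑' i, ∫⁻ x, f i x ^ p ∂μ := lintegral_tsum fun i => (hf i).pow_const p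
    _ ≤ ∑' i, (2 : ℝ≥0∞)⁻¹ ^ (i + 1) * C ^ p := ENNReal.tsum_le_tsum key
    _ = C ^ p := by rw [ENNReal.tsum_mul_right, tsum_half_pow_succ, one_mul]

lemma ae_lt_top_of_rNorm (hp : 0 < p) {f : α → ℝ≥0∞} (hf : AEMeasurable f μ)
    (h : rNorm μ p f ≠ ∞) : ∀ᵐ x ∂μ, f x < ∞ := by
  have h1 : ∫⁻ x, f x ^ p ∂μ ≠ ∞ := by
    rw [← rNorm_rpow hp]; exact ENNReal.rpow_ne_top_of_nonneg hp.le h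
  filter_upwards [ae_lt_top' (hf.pow_const p) h1] with x hx
  exact (ENNReal.rpow_lt_top_iff_of_pos hp).1 hx

end rNorm

/-! ### Functionals on sequences of gradients -/

/-- The common properties of the functionals `‖ ‖(g_k)‖_{l^q} ‖_{L^p}` and
`‖ (‖g_k‖_{L^p}) ‖_{l^q}`. -/
structure IsGradFunctional {X : Type*} [MeasurableSpace X] (μ : Measure X)
    (Φ : (ℤ → X → ℝ≥0∞) → ℝ≥0∞) (K : ℝ≥0∞) : Prop where
  mono : ∀ g h : ℤ → X → ℝ≥0∞, (∀ k, g k ≤ᵐ[μ] h k) → Φ g ≤ Φ h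
  smul : ∀ (c : ℝ≥0∞) (g : ℤ → X → ℝ≥0∞), c ≠ ∞ → Φ (fun k x => c * g k x) ≤ c * Φ g
  iSup : ∀ (g : ℕ → ℤ → X → ℝ≥0∞) (C : ℝ≥0∞), (∀ i k, AEMeasurable (g i k) μ) →
    (∀ i, K ^ (i + 1) * Φ (g i) ≤ C) → Φ (fun k x => ⨆ i, g i k x) ≤ C

/-- The functional of the Hajłasz–Triebel–Lizorkin spaces. -/
def tlFunctional {X : Type*} [MeasurableSpace X] (μ : Measure X) (p q : ℝ≥0∞)
    (g : ℤ → X → ℝ≥0∞) : ℝ≥0∞ :=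
  eLpNorm (fun x => lqNorm q (fun k => g k x)) p μ

/-- The functional of the Hajłasz–Besov spaces. -/
def besovFunctional {X : Type*} [MeasurableSpace X] (μ : Measure X) (p q : ℝ≥0∞)
    (g : ℤ → X → ℝ≥0∞) : ℝ≥0∞ :=
  lqNorm q (fun k => eLpNorm (g k) p μ)

/-! ### Sequence norms, and the two mixed norms as gradient functionals. -/

section lqNorm

variable {q : ℝ≥0∞}

lemma lqNorm_mono (hq : 0 < q) {a b : ℤ → ℝ≥0∞} (h : ∀ k, a k ≤ b k) :
    lqNorm q a ≤ lqNorm q b := by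
  by_cases hq' : q = ∞
  · simp only [lqNorm, if_pos hq']; exact iSup_mono h
  · rw [lqNorm_eq_rNorm hq', lqNorm_eq_rNorm hq']
    exact rNorm_mono (ENNReal.toReal_pos hq.ne' hq') (Eventually.of_forall h)

lemma lqNorm_const_mul (hq : 0 < q) {c : ℝ≥0∞} (hc : c ≠ ∞) (a : ℤ → ℝ≥0∞) :
    lqNorm q (fun k => c * a k) = c * lqNorm q a := by
  by_cases hq' : q = ∞
  · simp only [lqNorm, if_pos hq']; rw [ENNReal.mul_iSup]
  · rw [lqNorm_eq_rNorm hq', lqNorm_eq_rNorm hq']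
    exact rNorm_const_mul (ENNReal.toReal_pos hq.ne' hq') hc a

lemma lqNorm_iSup_le (hq : 0 < q) {K C : ℝ≥0∞} (hK1 : 1 ≤ K) (hK : 2 ≤ K ^ q.toReal ∨ q = ∞)
    {a : ℕ → ℤ → ℝ≥0∞} (h : ∀ i, K ^ (i + 1) * lqNorm q (a i) ≤ C) :
    lqNorm q (fun k => ⨆ i, a i k) ≤ C := by
  by_cases hq' : q = ∞
  · simp only [lqNorm, if_pos hq'] at h ⊢
    refine iSup_le fun k => iSup_le fun i => le_trans ?_ (h i)
    calc a i k ≤ ⨆ k, a i k := le_iSup (fun k => a i k) k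
      _ ≤ _ := le_mul_of_one_le_left' (one_le_pow₀ hK1)
  · rw [lqNorm_eq_rNorm hq']
    refine rNorm_iSup_le (ENNReal.toReal_pos hq.ne' hq') (hK.resolve_right hq')
      (fun i => (measurable_of_countable _).aemeasurable) fun i => ?_
    rw [← lqNorm_eq_rNorm hq']; exact h i

lemma le_lqNorm (hq : 0 < q) (a : ℤ → ℝ≥0∞) (k : ℤ) : a k ≤ lqNorm q a := by
  by_cases hq' : q = ∞
  · simp only [lqNorm, if_pos hq']; exact le_iSup a k
  · have := ENNReal.toReal_pos hq.ne' hq'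
    rw [lqNorm, if_neg hq', one_div, ENNReal.le_rpow_inv_iff this]
    exact ENNReal.le_tsum (f := fun k => a k ^ q.toReal) k

lemma aemeasurable_lqNorm {X : Type*} [MeasurableSpace X] {μ : Measure X} {g : ℤ → X → ℝ≥0∞}
    (hg : ∀ k, AEMeasurable (g k) μ) : AEMeasurable (fun x => lqNorm q (fun k => g k x)) μ := by
  by_cases hq' : q = ∞
  · simp only [lqNorm, if_pos hq']; exact AEMeasurable.iSup hg
  · simp only [lqNorm, if_neg hq']
    exact (AEMeasurable.tsum fun k => (hg k).pow_const _).pow_const _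

end lqNorm

lemma exists_rpow_ge_two (p : ℝ) (hp : 0 < p) : ∃ K : ℝ≥0∞, 1 ≤ K ∧ K ≠ ∞ ∧ 2 ≤ K ^ p := by
  refine ⟨2 ^ (1 / p), ENNReal.one_le_rpow (by norm_num) (by positivity),
    ENNReal.rpow_ne_top_of_nonneg (by positivity) (by simp), ?_⟩
  rw [← ENNReal.rpow_mul, one_div, inv_mul_cancel₀ hp.ne', ENNReal.rpow_one]

lemma exists_rpow_ge_two' (q : ℝ≥0∞) (hq : 0 < q) :
    ∃ K : ℝ≥0∞, 1 ≤ K ∧ K ≠ ∞ ∧ (2 ≤ K ^ q.toReal ∨ q = ∞) := by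
  by_cases hq' : q = ∞
  · exact ⟨1, le_rfl, by simp, Or.inr hq'⟩
  · obtain ⟨K, h1, h2, h3⟩ := exists_rpow_ge_two q.toReal (ENNReal.toReal_pos hq.ne' hq')
    exact ⟨K, h1, h2, Or.inl h3⟩

section functionals

variable {X : Type*} [MeasurableSpace X] {μ : Measure X} {p q : ℝ≥0∞}

/-- The constant is a product: one factor pays for the supremum inside `l^q`, the other for the
supremum inside `L^p`. -/
lemma isGradFunctional_tl (hp : 0 < p) (hp' : p ≠ ∞) (hq : 0 < q) :
    ∃ K : ℝ≥0∞, 1 ≤ K ∧ K ≠ ∞ ∧ 2 ≤ K ^ p.toReal ∧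
      IsGradFunctional μ (tlFunctional μ p q) K := by
  have hpr := ENNReal.toReal_pos hp.ne' hp'
  obtain ⟨K, h1, h2, h3⟩ := exists_rpow_ge_two p.toReal hpr
  obtain ⟨L, l1, l2, l3⟩ := exists_rpow_ge_two' q hq
  refine ⟨K * L, one_le_mul h1 l1, ENNReal.mul_ne_top h2 l2,
    h3.trans (ENNReal.rpow_le_rpow (le_mul_of_one_le_right' l1) hpr.le), ?_, ?_, ?_⟩
  · intro g h hgh
    simp only [tlFunctional, eLpNorm_eq_rNorm hp.ne' hp']
    refine rNorm_mono hpr ?_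
    filter_upwards [ae_all_iff.2 hgh] with x hx
    exact lqNorm_mono hq hx
  · intro c g hc
    simp only [tlFunctional, eLpNorm_eq_rNorm hp.ne' hp', lqNorm_const_mul hq hc,
      rNorm_const_mul hpr hc, le_refl]
  · intro g C hg h
    simp only [tlFunctional, eLpNorm_eq_rNorm hp.ne' hp'] at h ⊢
    -- At each point the `l^q` bound is used with its least admissible constant, the supremum over
    -- `i` of `L ^ (i + 1)` times the norm of the `i`-th sequence; the `L^p` bound then treats this
    -- supremum.
    refine (rNorm_mono hpr (Eventually.of_forall fun x => ?_)).trans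
      (rNorm_iSup_le hpr h3 (f := fun i x => L ^ (i + 1) * lqNorm q (fun k => g i k x))
        (fun i => (aemeasurable_lqNorm (hg i)).const_mul _) fun i => ?_)
    · exact lqNorm_iSup_le hq l1 l3 fun i =>
        le_iSup (fun i => L ^ (i + 1) * lqNorm q (fun k => g i k x)) i
    · rw [rNorm_const_mul hpr (ENNReal.pow_ne_top l2), ← mul_assoc, ← mul_pow]; exact h i

lemma isGradFunctional_besov (hp : 0 < p) (hp' : p ≠ ∞) (hq : 0 < q) :
    ∃ K : ℝ≥0∞, 1 ≤ K ∧ K ≠ ∞ ∧ 2 ≤ K ^ p.toReal ∧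
      IsGradFunctional μ (besovFunctional μ p q) K := by
  have hpr := ENNReal.toReal_pos hp.ne' hp'
  obtain ⟨K, h1, h2, h3⟩ := exists_rpow_ge_two p.toReal hpr
  obtain ⟨L, l1, l2, l3⟩ := exists_rpow_ge_two' q hq
  refine ⟨K * L, one_le_mul h1 l1, ENNReal.mul_ne_top h2 l2,
    h3.trans (ENNReal.rpow_le_rpow (le_mul_of_one_le_right' l1) hpr.le), ?_, ?_, ?_⟩
  · intro g h hgh
    simp only [besovFunctional, eLpNorm_eq_rNorm hp.ne' hp']
    exact lqNorm_mono hq fun k => rNorm_mono hpr (hgh k)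
  · intro c g hc
    simp only [besovFunctional, eLpNorm_eq_rNorm hp.ne' hp', rNorm_const_mul hpr hc,
      lqNorm_const_mul hq hc, le_refl]
  · intro g C hg h
    simp only [besovFunctional, eLpNorm_eq_rNorm hp.ne' hp'] at h ⊢
    refine (lqNorm_mono hq fun k => ?_).trans (lqNorm_iSup_le hq l1 l3
        (a := fun i k => K ^ (i + 1) * rNorm μ p.toReal (g i k)) fun i => ?_)
    · exact rNorm_iSup_le hpr h3 (fun i => hg i k) fun i =>
        le_iSup (fun i => K ^ (i + 1) * rNorm μ p.toReal (g i k)) i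
    · rw [lqNorm_const_mul hq (ENNReal.pow_ne_top h2), ← mul_assoc, ← mul_pow, mul_comm L]
      exact h i

end functionals

/-! ### Axioms for the norms, and their verification for norms defined by fractional gradients. -/

section GoodNorm

variable {X : Type*} [MeasurableSpace X]

/-- The function `⨆ i, |u i|`. -/
def supAbs (u : ℕ → X → EReal) : X → EReal := fun x => ((⨆ i, (u i x).abs : ℝ≥0∞) : EReal)

/-- The properties of the (quasi)norms of the Hajłasz-type spaces on which the capacity theory
rests. -/
structure IsGoodNorm [MetricSpace X] (μ : Measure X) (p : ℝ≥0∞) (N : (X → EReal) → ℝ≥0∞) (K : ℝ≥0∞) : Prop where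
  p_pos : 0 < p
  p_ne_top : p ≠ ∞
  one_le : 1 ≤ K
  ne_top : K ≠ ∞
  congr : ∀ u v, MemL0 μ u → u =ᵐ[μ] v → N u = N v
  zero : N (fun _ => 0) = 0
  smul : ∀ (c : ℝ) (f : X → ℝ) (C : ℝ≥0∞), AEMeasurable f μ → N (fun x => (f x : EReal)) < C →
    N (fun x => ((c * f x : ℝ) : EReal)) ≤ ‖c‖ₑ * C
  sub : ∀ (f g : X → ℝ) (C : ℝ≥0∞), AEMeasurable f μ → AEMeasurable g μ →
    N (fun x => (f x : EReal)) < C → N (fun x => (g x : EReal)) < C →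
      N (fun x => ((f x - g x : ℝ) : EReal)) ≤ K * C
  iSup_abs : ∀ (u : ℕ → X → EReal) (C : ℝ≥0∞), (∀ i, MemL0 μ (u i)) → C ≠ ∞ →
    (∀ i, K ^ (i + 1) * N (u i) < C) → MemL0 μ (supAbs u) ∧ N (supAbs u) ≤ C
  dense : ∀ (f : X → ℝ) (ε : ℝ≥0∞), AEMeasurable f μ → N (fun x => (f x : EReal)) < ∞ → 0 < ε →
    ∃ v : X → ℝ, Continuous v ∧ N (fun x => ((f x - v x : ℝ) : EReal)) ≤ ε
  lp : ∀ u, MemL0 μ u → lpNormX μ p u ≤ N u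

lemma memL0_coe {μ : Measure X} {f : X → ℝ} (hf : AEMeasurable f μ) :
    MemL0 μ (fun x => (f x : EReal)) :=
  ⟨hf.coe_real_ereal, Eventually.of_forall fun _ => ⟨EReal.coe_ne_top _, EReal.coe_ne_bot _⟩⟩

lemma MemL0.congr {μ : Measure X} {u v : X → EReal} (hu : MemL0 μ u) (h : u =ᵐ[μ] v) :
    MemL0 μ v :=
  ⟨hu.1.congr h, by filter_upwards [hu.2, h] with x h1 h2; rwa [← h2]⟩

lemma MemL0.ae_eq_toReal {μ : Measure X} {u : X → EReal} (hu : MemL0 μ u) :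
    u =ᵐ[μ] fun x => ((u x).toReal : EReal) := by
  filter_upwards [hu.2] with x hx
  rw [EReal.coe_toReal hx.1 hx.2]

lemma MemL0.aemeasurable_toReal {μ : Measure X} {u : X → EReal} (hu : MemL0 μ u) :
    AEMeasurable (fun x => (u x).toReal) μ :=
  measurable_ereal_toReal.comp_aemeasurable hu.1

/-- Equality is required only on `L⁰`, because the Hajłasz norm is identified with its fractional
counterpart only for almost everywhere finite functions. -/
lemma IsGoodNorm.of_eq [MetricSpace X] [BorelSpace X] {μ : Measure X} {p K : ℝ≥0∞} {N N' : (X → EReal) → ℝ≥0∞}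
    (h : IsGoodNorm μ p N K) (hN : ∀ u, MemL0 μ u → N' u = N u) : IsGoodNorm μ p N' K where
  p_pos := h.p_pos
  p_ne_top := h.p_ne_top
  one_le := h.one_le
  ne_top := h.ne_top
  congr u v hu huv := by rw [hN u hu, hN v (hu.congr huv), h.congr u v hu huv]
  zero := by
    rw [← h.zero]; exact hN _ (memL0_coe (f := fun _ => 0) aemeasurable_const)
  smul c f C hf hC := by
    rw [hN _ (memL0_coe hf)] at hC
    rw [hN _ (memL0_coe (hf.const_mul c))]
    exact h.smul c f C hf hC
  sub f g C hf hg hfC hgC := by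
    rw [hN _ (memL0_coe hf)] at hfC
    rw [hN _ (memL0_coe hg)] at hgC
    exact (hN _ (memL0_coe (hf.sub hg))).trans_le (h.sub f g C hf hg hfC hgC)
  iSup_abs u C hu hC hi := by
    obtain ⟨h1, h2⟩ := h.iSup_abs u C hu hC fun i => by rw [← hN _ (hu i)]; exact hi i
    exact ⟨h1, by rwa [hN _ h1]⟩
  dense f ε hf hfin hε := by
    rw [hN _ (memL0_coe hf)] at hfin
    obtain ⟨v, hv, h1⟩ := h.dense f ε hf hfin hε
    exact ⟨v, hv, (hN _ (memL0_coe (hf.sub hv.measurable.aemeasurable))).trans_le h1⟩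
  lp u hu := by rw [hN u hu]; exact h.lp u hu

/-- The norm built from a functional on fractional gradients. -/
def gradNorm [MetricSpace X] (μ : Measure X) (s : ℝ) (p : ℝ≥0∞) (Φ : (ℤ → X → ℝ≥0∞) → ℝ≥0∞)
    (u : X → EReal) : ℝ≥0∞ :=
  lpNormX μ p u + ⨅ (g : ℤ → X → ℝ≥0∞) (_ : IsFracGradient μ s u g), Φ g

section gradNorm

variable [MetricSpace X] {μ : Measure X} {s : ℝ} {p K : ℝ≥0∞} {Φ : (ℤ → X → ℝ≥0∞) → ℝ≥0∞}

/-- A strict bound produces an actual gradient; this is why the axioms have strict bounds as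
premises. -/
lemma gradNorm_lt_iff {u : X → EReal} {C : ℝ≥0∞} :
    gradNorm μ s p Φ u < C ↔ ∃ g, IsFracGradient μ s u g ∧ lpNormX μ p u + Φ g < C := by
  simp only [gradNorm, ENNReal.add_iInf, iInf_lt_iff, exists_prop]

lemma gradNorm_le {u : X → EReal} {g : ℤ → X → ℝ≥0∞} (hg : IsFracGradient μ s u g) :
    gradNorm μ s p Φ u ≤ lpNormX μ p u + Φ g :=
  add_le_add le_rfl (iInf₂_le g hg)

lemma IsFracGradient.congr {u v : X → EReal} {g : ℤ → X → ℝ≥0∞} (h : u =ᵐ[μ] v)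
    (hg : IsFracGradient μ s u g) : IsFracGradient μ s v g := by
  obtain ⟨h1, E, hE, h2⟩ := hg
  refine ⟨h1, E ∪ {x | u x ≠ v x}, measure_union_null hE h, ?_⟩
  intro k x hx y hy hk1 hk2
  simp only [Set.mem_union, Set.mem_ofPred_eq, not_or, not_not] at hx hy
  rw [← hx.2, ← hy.2]
  exact h2 k x hx.1 y hy.1 hk1 hk2

lemma gradNorm_congr {u v : X → EReal} (h : u =ᵐ[μ] v) :
    gradNorm μ s p Φ u = gradNorm μ s p Φ v := by
  have e1 : lpNormX μ p u = lpNormX μ p v :=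
    eLpNorm_congr_ae (h.mono fun x hx => by simp only [hx])
  have e2 : ∀ g, IsFracGradient μ s u g ↔ IsFracGradient μ s v g := fun g =>
    ⟨fun hg => hg.congr h, fun hg => hg.congr h.symm⟩
  simp only [gradNorm, e1, e2]


/-- The sequence `a, b, 0, 0, …`. -/
def pairSeq {β : Type*} [Zero β] (a b : β) : ℕ → β
  | 0 => a
  | 1 => b
  | _ + 2 => 0

lemma add_le_two_mul_iSup_pairSeq (a b : ℝ≥0∞) : a + b ≤ 2 * ⨆ i, pairSeq a b i := by
  rw [two_mul]
  exact add_le_add (le_iSup (pairSeq a b) 0) (le_iSup (pairSeq a b) 1)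

/-- A sum is at most twice the supremum of `f, g, 0, 0, …`, so the supremum bound stands in for the
triangle inequality. The power `K ^ 2` comes from `g` having index 1. -/
lemma rNorm_add_le {α : Type*} [MeasurableSpace α] {ν : Measure α} {r : ℝ} (hr : 0 < r)
    (hK1 : 1 ≤ K) (hK : 2 ≤ K ^ r) {f g : α → ℝ≥0∞} {C : ℝ≥0∞} (hf : AEMeasurable f ν)
    (hg : AEMeasurable g ν) (hfC : rNorm ν r f ≤ C) (hgC : rNorm ν r g ≤ C) :
    rNorm ν r (fun x => f x + g x) ≤ 2 * (K ^ 2 * C) := by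
  calc rNorm ν r (fun x => f x + g x)
      ≤ rNorm ν r (fun x => 2 * ⨆ i, pairSeq (f x) (g x) i) :=
        rNorm_mono hr (Eventually.of_forall fun x => add_le_two_mul_iSup_pairSeq _ _)
    _ = 2 * rNorm ν r (fun x => ⨆ i, pairSeq (f x) (g x) i) := rNorm_const_mul hr (by simp) _
    _ ≤ 2 * (K ^ 2 * C) := by
        gcongr
        refine rNorm_iSup_le hr hK (f := fun i x => pairSeq (f x) (g x) i) ?_ ?_
        · rintro (_ | _ | i)
          exacts [hf, hg, aemeasurable_const]
        · rintro (_ | _ | i)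
          · exact mul_le_mul' (pow_le_pow_right₀ hK1 (by norm_num)) hfC
          · exact mul_le_mul' le_rfl hgC
          · simp only [pairSeq, rNorm_zero hr, mul_zero, zero_le]

omit [MetricSpace X] in
lemma IsGradFunctional.zero (hΦ : IsGradFunctional μ Φ K) : Φ (fun _ _ => 0) = 0 := by
  have := hΦ.smul 0 (fun _ _ => 0) (by simp)
  simpa using this

omit [MetricSpace X] in
lemma IsGradFunctional.add_le (hΦ : IsGradFunctional μ Φ K) (hK1 : 1 ≤ K)
    {f g : ℤ → X → ℝ≥0∞} {C : ℝ≥0∞} (hf : ∀ k, AEMeasurable (f k) μ)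
    (hg : ∀ k, AEMeasurable (g k) μ) (hfC : Φ f ≤ C) (hgC : Φ g ≤ C) :
    Φ (fun k x => f k x + g k x) ≤ 2 * (K ^ 2 * C) := by
  calc Φ (fun k x => f k x + g k x)
      ≤ Φ (fun k x => 2 * ⨆ i, pairSeq (f k x) (g k x) i) :=
        hΦ.mono _ _ fun k => Eventually.of_forall fun x => add_le_two_mul_iSup_pairSeq _ _
    _ ≤ 2 * Φ (fun k x => ⨆ i, pairSeq (f k x) (g k x) i) := hΦ.smul 2 _ (by simp)
    _ ≤ 2 * (K ^ 2 * C) := by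
        gcongr
        refine hΦ.iSup (fun i k x => pairSeq (f k x) (g k x) i) _ ?_ ?_
        · rintro (_ | _ | i) k
          exacts [hf k, hg k, aemeasurable_const]
        · rintro (_ | _ | i)
          · exact mul_le_mul' (pow_le_pow_right₀ hK1 (by norm_num)) hfC
          · exact mul_le_mul' le_rfl hgC
          · simp only [pairSeq, hΦ.zero, mul_zero, zero_le]

lemma IsFracGradient.smul {f : X → ℝ} {g : ℤ → X → ℝ≥0∞} (c : ℝ)
    (hg : IsFracGradient μ s (fun x => (f x : EReal)) g) :
    IsFracGradient μ s (fun x => ((c * f x : ℝ) : EReal)) (fun k x => ‖c‖ₑ * g k x) := by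
  obtain ⟨h1, E, hE, h2⟩ := hg
  refine ⟨fun k => (h1 k).const_mul _, E, hE, fun k x hx y hy hk1 hk2 => ?_⟩
  have := h2 k x hx y hy hk1 hk2
  rw [abs_coe_sub] at this ⊢
  rw [← mul_sub, enorm_mul, ← mul_add, mul_left_comm]
  gcongr

lemma IsFracGradient.sub {f f' : X → ℝ} {g g' : ℤ → X → ℝ≥0∞}
    (hg : IsFracGradient μ s (fun x => (f x : EReal)) g)
    (hg' : IsFracGradient μ s (fun x => (f' x : EReal)) g') :
    IsFracGradient μ s (fun x => ((f x - f' x : ℝ) : EReal)) (fun k x => g k x + g' k x) := by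
  obtain ⟨h1, E, hE, h2⟩ := hg
  obtain ⟨h1', E', hE', h2'⟩ := hg'
  refine ⟨fun k => (h1 k).add (h1' k), E ∪ E', measure_union_null hE hE',
    fun k x hx y hy hk1 hk2 => ?_⟩
  simp only [Set.mem_union, not_or] at hx hy
  have e := h2 k x hx.1 y hy.1 hk1 hk2
  have e' := h2' k x hx.2 y hy.2 hk1 hk2
  rw [abs_coe_sub] at e e' ⊢
  calc ‖f x - f' x - (f y - f' y)‖ₑ = ‖(f x - f y) - (f' x - f' y)‖ₑ := by congr 1; ring
    _ ≤ ‖f x - f y‖ₑ + ‖f' x - f' y‖ₑ := enorm_sub_le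
    _ ≤ _ := add_le_add e e'
    _ = _ := by ring

/-- Each |u i x| exceeds |u i y| by at most the common increment bound, and this passes to suprema.
Finiteness of the supremum makes the final difference in `EReal` genuine. -/
lemma IsFracGradient.supAbs {u : ℕ → X → EReal} {g : ℕ → ℤ → X → ℝ≥0∞}
    (hu : ∀ i, MemL0 μ (u i)) (hg : ∀ i, IsFracGradient μ s (u i) (g i))
    (hfin : ∀ᵐ x ∂μ, ⨆ i, (u i x).abs < ∞) :
    IsFracGradient μ s (supAbs u) (fun k x => ⨆ i, g i k x) := by
  choose h1 E hE h2 using hg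
  refine ⟨fun k => AEMeasurable.iSup fun i => h1 i k,
    (⋃ i, E i) ∪ {x | ¬ ((∀ i, u i x ≠ ⊤ ∧ u i x ≠ ⊥) ∧ ⨆ i, (u i x).abs < ∞)},
    measure_union_null (measure_iUnion_null hE) ((ae_all_iff.2 fun i => (hu i).2).and hfin),
    fun k x hx y hy hk1 hk2 => ?_⟩
  simp only [Set.mem_union, Set.mem_iUnion, Set.mem_ofPred_eq, not_or, not_exists, not_not] at hx hy
  obtain ⟨hx1, hx2, hx3⟩ := hx
  obtain ⟨hy1, hy2, hy3⟩ := hy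
  have key : ∀ i, (u i x - u i y).abs ≤
      ENNReal.ofReal (dist x y ^ s) * ((⨆ i, g i k x) + ⨆ i, g i k y) := fun i =>
    (h2 i k x (hx1 i) y (hy1 i) hk1 hk2).trans (by
      gcongr
      · exact le_iSup (fun i => g i k x) i
      · exact le_iSup (fun i => g i k y) i)
  refine abs_coe_ennreal_sub_le hx3.ne hy3.ne (iSup_le fun i => ?_) (iSup_le fun i => ?_)
  · exact (abs_le_abs_add_abs_sub (hx2 i) (hy2 i)).1.trans
      (add_le_add (le_iSup (fun i => (u i y).abs) i) (key i))
  · exact (abs_le_abs_add_abs_sub (hx2 i) (hy2 i)).2.trans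
      (add_le_add (le_iSup (fun i => (u i x).abs) i) (key i))

omit [MetricSpace X] in
lemma lpNormX_coe (hp : 0 < p) (hp' : p ≠ ∞) (f : X → ℝ) :
    lpNormX μ p (fun x => (f x : EReal)) = rNorm μ p.toReal (fun x => ‖f x‖ₑ) := by
  simp only [lpNormX, eLpNorm_eq_rNorm hp.ne' hp', abs_coe_real]

/-- A norm built from a functional on fractional gradients is a good norm as soon as continuous
functions are dense. -/
theorem isGoodNorm_gradNorm (hp : 0 < p) (hp' : p ≠ ∞) (hK1 : 1 ≤ K) (hK' : K ≠ ∞)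
    (hK : 2 ≤ K ^ p.toReal) (hΦ : IsGradFunctional μ Φ K)
    (hdense : ∀ (f : X → ℝ) (ε : ℝ≥0∞), AEMeasurable f μ →
      gradNorm μ s p Φ (fun x => (f x : EReal)) < ∞ → 0 < ε →
      ∃ v : X → ℝ, Continuous v ∧ gradNorm μ s p Φ (fun x => ((f x - v x : ℝ) : EReal)) ≤ ε) :
    IsGoodNorm μ p (gradNorm μ s p Φ) (4 * K ^ 2) where
  p_pos := hp
  p_ne_top := hp'
  one_le := one_le_mul (by norm_num) (one_le_pow₀ hK1)
  ne_top := ENNReal.mul_ne_top (by simp) (ENNReal.pow_ne_top hK')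
  congr u v _ h := gradNorm_congr h
  zero := by
    have h : IsFracGradient μ s (fun _ : X => (0 : EReal)) (fun _ _ => 0) :=
      ⟨fun _ => aemeasurable_const, ∅, by simp, by simp⟩
    refine le_antisymm ((gradNorm_le h).trans ?_) zero_le
    rw [hΦ.zero, lpNormX, eLpNorm_eq_rNorm hp.ne' hp']
    simp [rNorm_zero (ENNReal.toReal_pos hp.ne' hp')]
  smul c f C hf hC := by
    obtain ⟨g, hg, h⟩ := gradNorm_lt_iff.1 hC
    refine (gradNorm_le (hg.smul c)).trans ?_
    rw [lpNormX_coe hp hp'] at h ⊢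
    simp only [enorm_mul]
    rw [rNorm_const_mul (ENNReal.toReal_pos hp.ne' hp') (by simp)]
    refine (add_le_add le_rfl (hΦ.smul _ g (by simp))).trans ?_
    rw [← mul_add]
    gcongr
  sub f f' C hf hf' hC hC' := by
    obtain ⟨g, hg, h⟩ := gradNorm_lt_iff.1 hC
    obtain ⟨g', hg', h'⟩ := gradNorm_lt_iff.1 hC'
    have hpr := ENNReal.toReal_pos hp.ne' hp'
    refine (gradNorm_le (hg.sub hg')).trans ?_
    rw [lpNormX_coe hp hp'] at h h' ⊢
    have e1 : rNorm μ p.toReal (fun x => ‖f x - f' x‖ₑ) ≤ 2 * (K ^ 2 * C) :=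
      (rNorm_mono hpr (Eventually.of_forall fun x => enorm_sub_le)).trans
        (rNorm_add_le hpr hK1 hK hf.enorm hf'.enorm (le_self_add.trans h.le)
          (le_self_add.trans h'.le))
    have e2 := hΦ.add_le hK1 hg.1 hg'.1 (le_add_self.trans h.le) (le_add_self.trans h'.le)
    exact (add_le_add e1 e2).trans (le_of_eq (by ring))
  iSup_abs u C hu hC h := by
    have hpr := ENNReal.toReal_pos hp.ne' hp'
    have key : ∀ i, ∃ g, IsFracGradient μ s (u i) g ∧
        K ^ (i + 1) * (lpNormX μ p (u i) + Φ g) ≤ C / 2 := by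
      intro i
      have h0 : K ^ (i + 1) ≠ 0 := pow_ne_zero _ (one_pos.trans_le hK1).ne'
      have h1 : K ^ (i + 1) ≠ ∞ := ENNReal.pow_ne_top hK'
      -- The `L^p` part and the gradient part each receive half of `C`. The factor 2 is paid for by
      -- the constant `4 * K ^ 2`, since 2 K^(i+1) ≤ (4 K^2)^(i+1).
      have h2 : gradNorm μ s p Φ (u i) < C / 2 / K ^ (i + 1) := by
        rw [ENNReal.lt_div_iff_mul_lt (Or.inl h0) (Or.inl h1),
          ENNReal.lt_div_iff_mul_lt (by simp) (by simp)]
        refine lt_of_le_of_lt ?_ (h i)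
        calc gradNorm μ s p Φ (u i) * K ^ (i + 1) * 2
            = (2 * K ^ (i + 1)) * gradNorm μ s p Φ (u i) := by ring
          _ ≤ _ := by
            gcongr
            calc 2 * K ^ (i + 1) ≤ 4 ^ (i + 1) * (K ^ 2) ^ (i + 1) := by
                  gcongr
                  · calc (2 : ℝ≥0∞) ≤ 4 := by norm_num
                      _ ≤ 4 ^ (i + 1) := le_self_pow₀ (by norm_num) (by simp)
                  · exact le_self_pow₀ hK1 (by simp)
              _ = _ := by rw [mul_pow]
      obtain ⟨g, hg, h3⟩ := gradNorm_lt_iff.1 h2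
      refine ⟨g, hg, ?_⟩
      rw [mul_comm]
      exact ENNReal.mul_le_of_le_div h3.le
    choose g hg hgC using key
    have hC2 : C / 2 ≠ ∞ := (ENNReal.div_lt_top hC (by simp)).ne
    have ham : ∀ i, AEMeasurable (fun x => (u i x).abs) μ := fun i =>
      continuous_abs_ereal.measurable.comp_aemeasurable (hu i).1
    have e1 : rNorm μ p.toReal (fun x => ⨆ i, (u i x).abs) ≤ C / 2 := by
      refine rNorm_iSup_le hpr hK ham fun i => ?_
      refine le_trans ?_ (hgC i)
      rw [← eLpNorm_eq_rNorm hp.ne' hp']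
      gcongr
      exact le_self_add
    have e2 : Φ (fun k x => ⨆ i, g i k x) ≤ C / 2 :=
      hΦ.iSup g _ (fun i => (hg i).1) fun i => le_trans (by gcongr; exact le_add_self) (hgC i)
    have hfin := ae_lt_top_of_rNorm hpr (AEMeasurable.iSup ham) (e1.trans_lt hC2.lt_top).ne
    refine ⟨⟨(measurable_coe_ennreal_ereal.comp_aemeasurable (AEMeasurable.iSup ham)), ?_⟩, ?_⟩
    · filter_upwards [hfin] with x hx
      refine ⟨?_, EReal.coe_ennreal_ne_bot _⟩
      simpa [supAbs] using hx.ne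
    · refine (gradNorm_le (IsFracGradient.supAbs hu hg hfin)).trans ?_
      rw [lpNormX, eLpNorm_eq_rNorm hp.ne' hp']
      simp only [supAbs, abs_coe_ennreal]
      exact (add_le_add e1 e2).trans (ENNReal.add_halves C).le
  dense := hdense
  lp u _ := le_self_add

end gradNorm

end GoodNorm

lemma le_rpow_of_forall_lt {a b : ℝ≥0∞} {r : ℝ} (hr : 0 < r)
    (h : ∀ C, b < C → C ≠ ∞ → a ≤ C ^ r) : a ≤ b ^ r := by
  by_contra! hlt
  have h1 : b < a ^ (1 / r) := by
    rw [one_div, ENNReal.lt_rpow_inv_iff hr]; exact hlt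
  obtain ⟨C, hC1, hC2⟩ := exists_between h1
  rw [one_div, ENNReal.lt_rpow_inv_iff hr] at hC2
  have hC : C ≠ ∞ := by
    rintro rfl
    rw [ENNReal.top_rpow_of_pos hr] at hC2
    exact not_top_lt hC2
  exact absurd (h C hC1 hC) (not_le.2 hC2)

lemma eq_zero_of_forall_le_rpow {a : ℝ≥0∞} {r : ℝ} (hr : 0 < r)
    (h : ∀ C, 0 < C → C ≠ ∞ → a ≤ C ^ r) : a = 0 := by
  have := le_rpow_of_forall_lt hr h
  rwa [ENNReal.zero_rpow_of_pos hr, nonpos_iff_eq_zero] at this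

lemma one_le_abs_of_one_le {x : EReal} (h : 1 ≤ x) : 1 ≤ x.abs := by
  rw [abs_eq_max_toENNReal]
  refine le_max_of_le_left ?_
  have h1 : (1 : EReal).toENNReal = 1 := EReal.toENNReal_coe (x := 1)
  exact h1.symm.le.trans (EReal.toENNReal_le_toENNReal h)

/-! ### Capacity: quasi-subadditivity, null sets and the weak type estimate. -/

section Capacity

variable {X : Type*} [MetricSpace X] [MeasurableSpace X] {μ : Measure X} {p K : ℝ≥0∞}
  {N : (X → EReal) → ℝ≥0∞}

lemma capacity_mono {A B : Set X} (h : A ⊆ B) : capacity μ p N A ≤ capacity μ p N B :=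
  le_iInf₂ fun u hu => iInf₂_le u
    ⟨hu.1, hu.2.choose, hu.2.choose_spec.1, h.trans hu.2.choose_spec.2.1,
      hu.2.choose_spec.2.2⟩

lemma IsGoodNorm.exp_pos (hN : IsGoodNorm μ p N K) : 0 < p.toReal :=
  ENNReal.toReal_pos hN.p_pos.ne' hN.p_ne_top

lemma IsGoodNorm.exists_test (hN : IsGoodNorm μ p N K) {E : Set X} {η : ℝ≥0∞}
    (h : capacity μ p N E < η ^ p.toReal) :
    ∃ v, MemSpace μ N v ∧ N v < η ∧ ∃ U, IsOpen U ∧ E ⊆ U ∧ ∀ x ∈ U, 1 ≤ (v x).abs := by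
  simp only [capacity, iInf_lt_iff] at h
  obtain ⟨v, ⟨hv, U, hU, hEU, h1⟩, h2⟩ := h
  exact ⟨v, hv, (ENNReal.rpow_lt_rpow_iff hN.exp_pos).1 h2, U, hU, hEU,
    fun x hx => one_le_abs_of_one_le (h1 x hx)⟩

/-- The function `supAbs u` is admissible for `E`, and the lattice axiom bounds its norm. -/
lemma IsGoodNorm.capacity_le (hN : IsGoodNorm μ p N K) {u : ℕ → X → EReal} {C : ℝ≥0∞}
    (hu : ∀ i, MemL0 μ (u i)) (hC : C ≠ ∞) (h : ∀ i, K ^ (i + 1) * N (u i) < C) {E U : Set X}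
    (hU : IsOpen U) (hEU : E ⊆ U) (h1 : ∀ x ∈ U, ∃ i, 1 ≤ (u i x).abs) :
    capacity μ p N E ≤ C ^ p.toReal := by
  obtain ⟨h2, h3⟩ := hN.iSup_abs u C hu hC h
  refine (iInf₂_le (supAbs u) ⟨⟨h2, h3.trans_lt hC.lt_top⟩, U, hU, hEU, fun x hx => ?_⟩).trans
    (ENNReal.rpow_le_rpow h3 hN.exp_pos.le)
  obtain ⟨i, hi⟩ := h1 x hx
  have : (1 : ℝ≥0∞) ≤ ⨆ i, (u i x).abs := hi.trans (le_iSup (fun i => (u i x).abs) i)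
  exact EReal.coe_ennreal_le_coe_ennreal_iff.2 this

omit [MetricSpace X] in
lemma memL0_zero : MemL0 μ (0 : X → EReal) :=
  memL0_coe (f := fun _ : X => (0 : ℝ)) aemeasurable_const

lemma IsGoodNorm.capacity_le_pair (hN : IsGoodNorm μ p N K) {u v : X → EReal} {C : ℝ≥0∞}
    (hu : MemL0 μ u) (hv : MemL0 μ v) (hC : C ≠ ∞) (hu1 : K * N u < C) (hv1 : K ^ 2 * N v < C)
    {E U : Set X} (hU : IsOpen U) (hEU : E ⊆ U)
    (h1 : ∀ x ∈ U, 1 ≤ (u x).abs ∨ 1 ≤ (v x).abs) :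
    capacity μ p N E ≤ C ^ p.toReal := by
  refine hN.capacity_le (u := pairSeq u v) ?_ hC ?_ hU hEU ?_
  · rintro (_ | _ | i)
    exacts [hu, hv, memL0_zero]
  · rintro (_ | _ | i)
    · simpa [pairSeq] using hu1
    · simpa [pairSeq] using hv1
    · have : N (pairSeq u v (i + 1 + 1)) = 0 := hN.zero
      rw [this, mul_zero]
      exact bot_le.trans_lt hu1
  · intro x hx
    rcases h1 x hx with h | h
    exacts [⟨0, h⟩, ⟨1, h⟩]

lemma IsGoodNorm.K_ne_zero (hN : IsGoodNorm μ p N K) : K ≠ 0 :=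
  (one_pos.trans_le hN.one_le).ne'

lemma IsGoodNorm.capacity_union_le (hN : IsGoodNorm μ p N K) {A B : Set X} {C : ℝ≥0∞}
    (hC : C ≠ ∞) (hA : capacity μ p N A < (C / K ^ 2) ^ p.toReal)
    (hB : capacity μ p N B < (C / K ^ 2) ^ p.toReal) :
    capacity μ p N (A ∪ B) ≤ C ^ p.toReal := by
  obtain ⟨u, hu, hu1, U, hU, hAU, hUu⟩ := hN.exists_test hA
  obtain ⟨v, hv, hv1, V, hV, hBV, hVv⟩ := hN.exists_test hB
  have e : ∀ w, N w < C / K ^ 2 → K ^ 2 * N w < C := fun w hw => by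
    rw [mul_comm]; exact ENNReal.mul_lt_of_lt_div hw
  refine hN.capacity_le_pair hu.1 hv.1 hC (lt_of_le_of_lt ?_ (e u hu1)) (e v hv1)
    (hU.union hV) (Set.union_subset_union hAU hBV) ?_
  · gcongr
    exact le_self_pow₀ hN.one_le (by norm_num)
  · rintro x (hx | hx)
    exacts [Or.inl (hUu x hx), Or.inr (hVv x hx)]

/-- Nullity lets the test function of `A i` have norm below `C / K ^ (i + 1)`, exactly what the
lattice axiom demands. -/
lemma IsGoodNorm.capacity_iUnion_eq_zero (hN : IsGoodNorm μ p N K) {A : ℕ → Set X}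
    (hA : ∀ i, capacity μ p N (A i) = 0) : capacity μ p N (⋃ i, A i) = 0 := by
  refine eq_zero_of_forall_le_rpow hN.exp_pos fun C hC hC' => ?_
  have key : ∀ i, capacity μ p N (A i) < (C / K ^ (i + 1)) ^ p.toReal := fun i => by
    rw [hA i]
    exact ENNReal.rpow_pos_of_nonneg
      (ENNReal.div_pos hC.ne' (ENNReal.pow_ne_top hN.ne_top)) hN.exp_pos.le
  choose u hu hu1 U hU hAU hUu using fun i => hN.exists_test (key i)
  refine hN.capacity_le (u := u) (fun i => (hu i).1) hC' (fun i => ?_) (isOpen_iUnion hU)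
    (Set.iUnion_mono hAU) fun x hx => ?_
  · rw [mul_comm]; exact ENNReal.mul_lt_of_lt_div (hu1 i)
  · obtain ⟨i, hi⟩ := Set.mem_iUnion.1 hx
    exact ⟨i, hUu i x hi⟩

lemma MemSpace.congr (hN : IsGoodNorm μ p N K) {u v : X → EReal} (hu : MemSpace μ N u)
    (h : u =ᵐ[μ] v) : MemSpace μ N v :=
  ⟨hu.1.congr h, by rw [← hN.congr u v hu.1 h]; exact hu.2⟩

lemma IsGoodNorm.memSpace_absFun (hN : IsGoodNorm μ p N K) {u : X → EReal}
    (hu : MemSpace μ N u) : MemSpace μ N (absFun u) := by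
  have e : supAbs (pairSeq u 0) = absFun u := by
    funext x
    simp only [supAbs, absFun]
    congr 1
    refine le_antisymm (iSup_le ?_) (le_iSup (fun i => (pairSeq u 0 i x).abs) 0)
    rintro (_ | _ | i)
    exacts [le_rfl, by simp [pairSeq], by simp [pairSeq]]
  have hfin : K * N u ≠ ∞ := ENNReal.mul_ne_top hN.ne_top hu.2.ne
  have h := hN.iSup_abs (pairSeq u 0) (K * N u + 1) (by
    rintro (_ | _ | i)
    exacts [hu.1, memL0_zero, memL0_zero]) (by simp [hfin]) (by
    have h0 : N 0 = 0 := hN.zero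
    rintro (_ | _ | i)
    · simpa [pairSeq] using ENNReal.lt_add_right hfin one_ne_zero
    · simp [pairSeq, h0]
    · simp [pairSeq, h0])
  rw [e] at h
  exact ⟨h.1, h.2.trans_lt (by simp [hfin.lt_top])⟩

lemma Quasicontinuous.absFun {u : X → EReal} (hu : Quasicontinuous μ p N u) :
    Quasicontinuous μ p N (absFun u) := fun ε hε => by
  obtain ⟨E, hE, hc⟩ := hu ε hε
  exact ⟨E, hE, (continuous_coe_ennreal_ereal.comp continuous_abs_ereal).comp_continuousOn hc⟩

omit [MetricSpace X] in
lemma MemL0.coe_mul {u : X → EReal} (hu : MemL0 μ u) (c : ℝ) :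
    (fun x => (c : EReal) * u x) =ᵐ[μ] fun x => ((c * (u x).toReal : ℝ) : EReal) := by
  filter_upwards [hu.ae_eq_toReal] with x hx
  rw [EReal.coe_mul, ← hx]

/-- The product is kept in `EReal` and not replaced by its real representative, because test
functions for the capacity are judged pointwise. -/
lemma IsGoodNorm.smul_le (hN : IsGoodNorm μ p N K) {u : X → EReal} (hu : MemL0 μ u) (c : ℝ)
    {C : ℝ≥0∞} (h : N u < C) : MemL0 μ (fun x => (c : EReal) * u x) ∧
      N (fun x => (c : EReal) * u x) ≤ ‖c‖ₑ * C := by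
  have h1 : MemL0 μ (fun x => ((c * (u x).toReal : ℝ) : EReal)) :=
    memL0_coe (hu.aemeasurable_toReal.const_mul c)
  have h2 := h1.congr (hu.coe_mul c).symm
  refine ⟨h2, ?_⟩
  rw [hN.congr _ _ h2 (hu.coe_mul c)]
  rw [hN.congr _ _ hu hu.ae_eq_toReal] at h
  exact hN.smul c _ C hu.aemeasurable_toReal h

/-- The capacitary weak type estimate for quasicontinuous functions. -/
theorem IsGoodNorm.capacity_quasicontinuous_le (hN : IsGoodNorm μ p N K) {u : X → EReal}
    (hu : MemSpace μ N u) (hq : Quasicontinuous μ p N u) {E : Set X}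
    (hE : capacity μ p N E = 0) {t : ℝ} (ht : 0 < t) :
    capacity μ p N ({x | ENNReal.ofReal t < (u x).abs} ∪ E) ≤
      (K * (ENNReal.ofReal t⁻¹ * N u)) ^ p.toReal := by
  refine le_rpow_of_forall_lt hN.exp_pos fun C hC hC' => ?_
  have hC0 : 0 < C := bot_le.trans_lt hC
  have hK2 : K ^ 2 ≠ ∞ := ENNReal.pow_ne_top hN.ne_top
  have hpos : ∀ D : ℝ≥0∞, 0 < D → 0 < (D / K ^ 2) ^ p.toReal := fun D hD =>
    ENNReal.rpow_pos_of_nonneg (ENNReal.div_pos hD.ne' hK2) hN.exp_pos.le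
  -- An intermediate `D` is needed because quasi-subadditivity only gives a non-strict bound for `E₁
  -- ∪ E`.
  obtain ⟨D, hD0, hD⟩ := exists_between (ENNReal.div_pos hC0.ne' hK2)
  obtain ⟨E₁, hE₁, hc⟩ := hq _ (hpos D hD0)
  have hcap : capacity μ p N (E₁ ∪ E) < (C / K ^ 2) ^ p.toReal :=
    (hN.capacity_union_le hD.ne_top hE₁ (by rw [hE]; exact hpos D hD0)).trans_lt
      ((ENNReal.rpow_lt_rpow_iff hN.exp_pos).2 hD)
  obtain ⟨v, hv, hv1, U, hU, hEU, hUv⟩ := hN.exists_test hcap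
  -- The superlevel set is relatively open off `E₁`, so it agrees there with an open `V`. On `V ∪ U`
  -- either `t⁻¹ u` or `v` is at least one in absolute value.
  obtain ⟨V, hV, hVeq⟩ := continuousOn_iff'.1 (continuous_abs_ereal.comp_continuousOn hc)
    (Set.Ioi (ENNReal.ofReal t)) isOpen_Ioi
  have hmem : ∀ x, x ∉ E₁ → (x ∈ V ↔ ENNReal.ofReal t < (u x).abs) := fun x hx => by
    have := Set.ext_iff.1 hVeq x
    simp only [Set.mem_inter_iff, Set.mem_preimage, Set.mem_compl_iff, hx, not_false_eq_true,
      and_true] at this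
    exact this.symm
  have ht1 : ENNReal.ofReal t⁻¹ ≠ ∞ := ENNReal.ofReal_ne_top
  have hen : ‖t⁻¹‖ₑ = ENNReal.ofReal t⁻¹ := Real.enorm_of_nonneg (by positivity)
  obtain ⟨M, hM1, hM2⟩ : ∃ M, N u < M ∧ K * (ENNReal.ofReal t⁻¹ * M) < C := by
    have h0 : K * ENNReal.ofReal t⁻¹ ≠ 0 :=
      mul_ne_zero hN.K_ne_zero (by simpa using ht)
    have h1 : K * ENNReal.ofReal t⁻¹ ≠ ∞ := ENNReal.mul_ne_top hN.ne_top ht1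
    have : N u < C / (K * ENNReal.ofReal t⁻¹) := by
      rw [ENNReal.lt_div_iff_mul_lt (Or.inl h0) (Or.inl h1), mul_comm, mul_assoc]; exact hC
    obtain ⟨M, hM1, hM2⟩ := exists_between this
    refine ⟨M, hM1, ?_⟩
    rw [← mul_assoc, mul_comm]
    exact ENNReal.mul_lt_of_lt_div hM2
  obtain ⟨hw, hw1⟩ := hN.smul_le hu.1 t⁻¹ hM1
  rw [hen] at hw1
  refine hN.capacity_le_pair hw hv.1 hC' (lt_of_le_of_lt ?_ hM2) ?_ (hV.union hU) ?_ ?_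
  · gcongr
  · rw [mul_comm]; exact ENNReal.mul_lt_of_lt_div hv1
  · rintro x (hx | hx)
    · by_cases hxE : x ∈ E₁
      · exact Or.inr (hEU (Or.inl hxE))
      · exact Or.inl ((hmem x hxE).2 hx)
    · exact Or.inr (hEU (Or.inr hx))
  · rintro x (hx | hx)
    · by_cases hxE : x ∈ E₁
      · exact Or.inr (hUv x (hEU (Or.inl hxE)))
      · left
        have h1 := ((hmem x hxE).1 hx).le
        rw [EReal.abs_mul, abs_coe_real, hen]
        calc (1 : ℝ≥0∞) = ENNReal.ofReal t⁻¹ * ENNReal.ofReal t := by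
              rw [← ENNReal.ofReal_mul (by positivity), inv_mul_cancel₀ ht.ne', ENNReal.ofReal_one]
          _ ≤ _ := by gcongr
    · exact Or.inr (hUv x hx)

end Capacity

/-! ### Quasicontinuous representatives. -/

section Representative

variable {X : Type*} [MetricSpace X] [MeasurableSpace X] [BorelSpace X] {μ : Measure X}
  {p K : ℝ≥0∞} {N : (X → EReal) → ℝ≥0∞}

/-- Fast approximation by continuous functions that also converge almost everywhere. -/
lemma IsGoodNorm.exists_approx (hN : IsGoodNorm μ p N K) {f : X → ℝ} (hf : AEMeasurable f μ)
    (hfin : N (fun x => (f x : EReal)) < ∞) {ε : ℕ → ℝ≥0∞} (hε : ∀ k, 0 < ε k)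
    (hanti : Antitone ε) (hlim : Tendsto ε atTop (𝓝 0)) :
    ∃ v : ℕ → X → ℝ, (∀ k, Continuous (v k)) ∧
      (∀ k, N (fun x => ((f x - v k x : ℝ) : EReal)) ≤ ε k) ∧
      ∀ᵐ x ∂μ, Tendsto (fun k => v k x) atTop (𝓝 (f x)) := by
  choose v hv hvN using fun k => hN.dense f (ε k) hf hfin (hε k)
  have hm : TendstoInMeasure μ v atTop f := by
    refine tendstoInMeasure_of_tendsto_eLpNorm hN.p_pos.ne'
      (fun n => (hv n).measurable.aemeasurable.aestronglyMeasurable) hf.aestronglyMeasurable ?_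
    refine tendsto_of_tendsto_of_tendsto_of_le_of_le tendsto_const_nhds hlim
      (fun _ => zero_le) fun k => ?_
    refine le_trans (le_of_eq ?_)
      ((hN.lp _ (memL0_coe (hf.sub (hv k).measurable.aemeasurable))).trans (hvN k))
    rw [lpNormX, ← eLpNorm_neg]
    refine eLpNorm_congr_enorm_ae (Eventually.of_forall fun x => ?_)
    simp [abs_coe_sub]
  obtain ⟨φ, hφ, hlim'⟩ := hm.exists_seq_tendsto_ae
  -- Passing to the subsequence keeps the rate, since `k ≤ φ k` and `ε` is antitone.
  exact ⟨fun k => v (φ k), fun k => hv _, fun k => (hvN _).trans (hanti (hφ.id_le k)), hlim'⟩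

/-- Every function of the space has a quasicontinuous representative. -/
theorem IsGoodNorm.exists_quasicontinuous (hN : IsGoodNorm μ p N K) {u : X → EReal}
    (hu : MemSpace μ N u) :
    ∃ w, u =ᵐ[μ] w ∧ MemSpace μ N w ∧ Quasicontinuous μ p N w := by
  set f : X → ℝ := fun x => (u x).toReal with hfdef
  have hf : AEMeasurable f μ := hu.1.aemeasurable_toReal
  have hfu : u =ᵐ[μ] fun x => (f x : EReal) := hu.1.ae_eq_toReal
  have hfin : N (fun x => (f x : EReal)) < ∞ := (MemSpace.congr hN hu hfu).2
  have hK0 := hN.K_ne_zero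
  have hKt := hN.ne_top
  -- The rate must beat both the factor 2^k in `z` and the weight `K ^ (i + 1)` of the lattice
  -- axiom; with this choice 2 K b = 1/2.
  set b : ℝ≥0∞ := (4 * K)⁻¹ with hb
  have hb0 : b ≠ 0 := ENNReal.inv_ne_zero.2 (ENNReal.mul_ne_top (by simp) hKt)
  have hKb : K * b = 4⁻¹ := by
    rw [hb, ENNReal.mul_inv (Or.inl (by simp)) (Or.inl (by simp)), mul_left_comm,
      ENNReal.mul_inv_cancel hK0 hKt, mul_one]
  have hb1 : b < 1 := by
    rw [hb, ENNReal.inv_lt_one]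
    calc (1 : ℝ≥0∞) < 4 := by norm_num
      _ ≤ 4 * K := le_mul_of_one_le_right' hN.one_le
  have hbt : b ≠ ∞ := hb1.ne_top
  obtain ⟨v, hv, hvN, hvlim⟩ := hN.exists_approx hf hfin (ε := fun k => b ^ k)
    (fun k => by positivity) (pow_right_anti₀ zero_le hb1.le)
    (ENNReal.tendsto_pow_atTop_nhds_zero_of_lt_one hb1)
  -- Scaled so that |z k| ≤ 1 means that consecutive approximants differ by at most 2^(-k).
  set z : ℕ → X → ℝ := fun k x => 2 ^ k * (v k x - v (k + 1) x) with hz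
  have hzc : ∀ k, Continuous (z k) := fun k =>
    continuous_const.mul ((hv k).sub (hv (k + 1)))
  have hzN : ∀ k, N (fun x => (z k x : EReal)) ≤ 2 ^ k * (4 * K * b ^ k) := by
    intro k
    have hbk : b ^ k ≠ 0 := pow_ne_zero _ hb0
    have hbk' : b ^ k ≠ ∞ := ENNReal.pow_ne_top hbt
    have h2 : b ^ k < 2 * b ^ k := by
      rw [two_mul]; exact ENNReal.lt_add_right hbk' hbk
    have hm : ∀ k, AEMeasurable (fun x => f x - v k x) μ := fun k =>
      hf.sub (hv k).measurable.aemeasurable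
    have h3 := hN.sub (fun x => f x - v (k + 1) x) (fun x => f x - v k x) (2 * b ^ k) (hm _) (hm _)
      (((hvN (k + 1)).trans (pow_right_anti₀ zero_le hb1.le (Nat.le_succ k))).trans_lt h2)
      ((hvN k).trans_lt h2)
    have h4 : K * (2 * b ^ k) < 4 * K * b ^ k := by
      have : 4 * K * b ^ k = K * (2 * b ^ k) + K * (2 * b ^ k) := by ring
      rw [this]
      exact ENNReal.lt_add_right (ENNReal.mul_ne_top hKt (ENNReal.mul_ne_top (by simp) hbk'))
        (mul_ne_zero hK0 (mul_ne_zero (by simp) hbk))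
    have h5 := hN.smul (2 ^ k) (fun x => f x - v (k + 1) x - (f x - v k x)) _ ((hm _).sub (hm _))
      (h3.trans_lt h4)
    have e : ‖(2 : ℝ) ^ k‖ₑ = 2 ^ k := by
      rw [enorm_pow, Real.enorm_of_nonneg (by norm_num)]; simp
    rw [e] at h5
    convert h5 using 3
    rw [hz]
    congr 1
    ring
  set F : ℕ → Set X := fun j => {x | ∃ i, 1 < |z (j + i) x|} with hF
  have hFopen : ∀ j, IsOpen (F j) := fun j => by
    rw [hF]
    simp only [Set.ofPred_exists]
    exact isOpen_iUnion fun i => isOpen_lt continuous_const (hzc _).abs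
  have hcap : ∀ j, capacity μ p N (F j) ≤ (8 * K ^ 2 * 2⁻¹ ^ j) ^ p.toReal := by
    intro j
    have hfinC : 4 * K ^ 2 * 2⁻¹ ^ j ≠ (∞ : ℝ≥0∞) :=
      ENNReal.mul_ne_top (ENNReal.mul_ne_top (by simp) (ENNReal.pow_ne_top hKt))
        (ENNReal.pow_ne_top (by simp))
    have h8 : 8 * K ^ 2 * (2⁻¹ : ℝ≥0∞) ^ j = 4 * K ^ 2 * 2⁻¹ ^ j + 4 * K ^ 2 * 2⁻¹ ^ j := by ring
    refine hN.capacity_le (u := fun i x => (z (j + i) x : EReal)) (U := F j)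
      (fun i => memL0_coe (hzc _).measurable.aemeasurable) ?_ (fun i => ?_) (hFopen j) le_rfl ?_
    · rw [h8]; exact ENNReal.add_ne_top.2 ⟨hfinC, hfinC⟩
    · have h24 : (2 : ℝ≥0∞) * 4⁻¹ = 2⁻¹ := by
        have : (4 : ℝ≥0∞) = 2 * 2 := by norm_num
        rw [this, ENNReal.mul_inv (by simp) (by simp), ← mul_assoc,
          ENNReal.mul_inv_cancel (by simp) (by simp), one_mul]
      have hKb1 : K * b ≤ 1 := by rw [hKb]; simp
      have h2b : 2 * b ≤ 2⁻¹ := by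
        rw [← h24, ← hKb]
        gcongr
        exact le_mul_of_one_le_left' hN.one_le
      calc K ^ (i + 1) * N (fun x => (z (j + i) x : EReal))
          ≤ K ^ (i + 1) * (2 ^ (j + i) * (4 * K * b ^ (j + i))) := by gcongr; exact hzN _
        _ = 4 * K ^ 2 * (2 * b) ^ j * (2 * (K * b)) ^ i := by ring
        _ ≤ 4 * K ^ 2 * 2⁻¹ ^ j * 1 ^ i := by
            gcongr
            rw [hKb, h24]; simp
        _ = 4 * K ^ 2 * 2⁻¹ ^ j := by simp
        _ < _ := by
            rw [h8]
            refine ENNReal.lt_add_right hfinC ?_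
            exact mul_ne_zero (mul_ne_zero (by simp) (pow_ne_zero _ hK0))
              (pow_ne_zero _ (by simp))
    · rintro x ⟨i, hi⟩
      refine ⟨i, ?_⟩
      rw [EReal.abs_def, ← ENNReal.ofReal_one]
      exact ENNReal.ofReal_le_ofReal hi.le
  -- Where the limit fails to exist the value is arbitrary; such points lie in every `F j`.
  set g : X → ℝ := fun x => limUnder atTop (fun k => v k x) with hg
  have hug : u =ᵐ[μ] fun x => (g x : EReal) := by
    filter_upwards [hfu, hvlim] with x h1 h2
    have h3 : g x = f x := h2.limUnder_eq
    rw [h1, h3]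
  refine ⟨_, hug, MemSpace.congr hN hu hug, fun ε hε => ?_⟩
  have hlim : Tendsto (fun j : ℕ => (8 * K ^ 2 * 2⁻¹ ^ j : ℝ≥0∞) ^ p.toReal) atTop (𝓝 0) := by
    have h1 : Tendsto (fun j : ℕ => (8 * K ^ 2 * 2⁻¹ ^ j : ℝ≥0∞)) atTop (𝓝 0) := by
      have := ENNReal.Tendsto.const_mul (a := 8 * K ^ 2)
        (ENNReal.tendsto_pow_atTop_nhds_zero_of_lt_one (r := 2⁻¹) (by simp))
        (Or.inr (ENNReal.mul_ne_top (by simp) (ENNReal.pow_ne_top hKt)))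
      simpa using this
    have := (ENNReal.continuous_rpow_const (y := p.toReal)).tendsto 0 |>.comp h1
    simpa [ENNReal.zero_rpow_of_pos hN.exp_pos, Function.comp_def] using this
  obtain ⟨j, hj⟩ := ((tendsto_order.1 hlim).2 ε hε).exists
  refine ⟨F j, (hcap j).trans_lt hj, continuous_coe_real_ereal.comp_continuousOn ?_⟩
  have hdist : ∀ x ∈ (F j)ᶜ, ∀ i, dist (v (j + i) x) (v (j + (i + 1)) x) ≤ 2 / 2 / 2 ^ i := by
    intro x hx i
    have h1 : ¬ 1 < |z (j + i) x| := fun h => hx ⟨i, h⟩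
    rw [not_lt, hz, abs_mul, abs_of_pos (by positivity)] at h1
    rw [Real.dist_eq, div_self two_ne_zero, le_div_iff₀ (by positivity), mul_comm, ← add_assoc]
    refine le_trans ?_ h1
    gcongr
    · norm_num
    · omega
  have hgt : ∀ x ∈ (F j)ᶜ, Tendsto (fun i => v (j + i) x) atTop (𝓝 (g x)) := by
    intro x hx
    have hc : CauchySeq (fun i => v (j + i) x) := cauchySeq_of_le_geometric_two (hdist x hx)
    obtain ⟨l, hl⟩ := cauchySeq_tendsto_of_complete hc
    have hl' : Tendsto (fun k => v k x) atTop (𝓝 l) := by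
      rw [← tendsto_add_atTop_iff_nat j]
      simpa [add_comm] using hl
    have h3 : g x = l := hl'.limUnder_eq
    rwa [h3]
  -- Off `F j` the increments are summable uniformly in `x`, so `g` is continuous there as a uniform
  -- limit.
  have hunif : TendstoUniformlyOn (fun i => v (j + i)) g atTop (F j)ᶜ := by
    rw [Metric.tendstoUniformlyOn_iff]
    intro δ hδ
    have h0 : Tendsto (fun i : ℕ => 2 / (2 : ℝ) ^ i) atTop (𝓝 0) := by
      have := (tendsto_pow_atTop_nhds_zero_of_lt_one (r := (2 : ℝ)⁻¹) (by norm_num)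
        (by norm_num)).const_mul 2
      simpa [div_eq_mul_inv] using this
    filter_upwards [(tendsto_order.1 h0).2 δ hδ] with i hi x hx
    rw [dist_comm]
    exact (dist_le_of_le_geometric_two_of_tendsto (hdist x hx) (hgt x hx) i).trans_lt hi
  exact hunif.continuousOn (Frequently.of_forall fun i => (hv _).continuousOn)

end Representative

/-! ### Medians. -/

section Median

variable {X : Type*} [MetricSpace X] [MeasurableSpace X] {μ : Measure X}
  {𝓑 : X → Set (Set X)}

omit [MetricSpace X] in
lemma median_congr_ae {f g : X → EReal} (h : f =ᵐ[μ] g) (γ : ℝ) (B : Set X) :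
    median μ γ f B = median μ γ g B := by
  have e : ∀ a : ℝ, μ {x ∈ B | (a : EReal) < f x} = μ {x ∈ B | (a : EReal) < g x} := fun a =>
    measure_congr (by
      filter_upwards [h] with x hx
      have : (x ∈ {x ∈ B | (a : EReal) < f x}) = (x ∈ {x ∈ B | (a : EReal) < g x}) := by
        simp [hx]
      exact this)
  simp only [median, e]

lemma limsupMedian_congr_ae {f g : X → EReal} (h : f =ᵐ[μ] g) (γ : ℝ) (x : X) :
    limsupMedian μ 𝓑 γ f x = limsupMedian μ 𝓑 γ g x := by
  simp only [limsupMedian, median_congr_ae h]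

omit [MetricSpace X] in
lemma median_le {f : X → EReal} {γ a : ℝ} {B : Set X}
    (h : μ {x ∈ B | (a : EReal) < f x} < ENNReal.ofReal γ * μ B) : median μ γ f B ≤ a :=
  iInf₂_le a h

omit [MetricSpace X] in
lemma measure_lt_of_median_lt {f : X → EReal} {γ t : ℝ} {B : Set X}
    (h : median μ γ f B < t) : μ {x ∈ B | (t : EReal) < f x} < ENNReal.ofReal γ * μ B := by
  simp only [median, iInf_lt_iff] at h
  obtain ⟨a, h1, h2⟩ := h
  refine (measure_mono ?_).trans_lt h1
  exact fun x hx => ⟨hx.1, h2.trans hx.2⟩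

omit [MetricSpace X] in
-- If a level `c < a` were admissible in the infimum, the sets where `f > c` and where `f < a` would
-- cover `B` with total measure below (γ + (1 - γ)) μ(B).
lemma le_median {f : X → EReal} {γ a : ℝ} {B : Set X} (hγ : 0 ≤ γ) (hγ1 : γ ≤ 1) 
    (h : μ {x ∈ B | f x < a} < ENNReal.ofReal (1 - γ) * μ B) : (a : EReal) ≤ median μ γ f B := by
  refine le_iInf₂ fun c hc => ?_
  by_contra! hlt
  have hsub : B ⊆ {x ∈ B | (c : EReal) < f x} ∪ {x ∈ B | f x < a} := fun x hx => by
    rcases lt_or_ge (c : EReal) (f x) with h1 | h1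
    · exact Or.inl ⟨hx, h1⟩
    · exact Or.inr ⟨hx, h1.trans_lt hlt⟩
  have h1 : μ B < ENNReal.ofReal γ * μ B + ENNReal.ofReal (1 - γ) * μ B :=
    ((measure_mono hsub).trans (measure_union_le _ _)).trans_lt (ENNReal.add_lt_add hc h)
  rw [← add_mul, ← ENNReal.ofReal_add hγ (by linarith), add_sub_cancel, ENNReal.ofReal_one,
    one_mul] at h1
  exact lt_irrefl _ h1

lemma liminfMedian_le_limsupMedian (h𝓑 : IsDifferentiationBasis μ 𝓑) (γ : ℝ) (f : X → EReal)
    (x : X) : liminfMedian μ 𝓑 γ f x ≤ limsupMedian μ 𝓑 γ f x := by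
  refine iSup₂_le fun ε hε => le_iInf₂ fun δ hδ => ?_
  obtain ⟨B, hB, hd⟩ := h𝓑.exists_small x (min ε δ) (lt_min hε hδ)
  exact (iInf₂_le B ⟨hB, hd.trans_le (min_le_left _ _)⟩).trans
    (le_iSup₂ (f := fun B (_ : B ∈ 𝓑 x ∧ Metric.diam B < δ) => median μ γ f B) B
      ⟨hB, hd.trans_le (min_le_right _ _)⟩)

lemma coe_lt_abs_of_lt_sub {y : EReal} {v a c : ℝ} (hv : |v - a| < c)
    (h : ((a + 3 * c : ℝ) : EReal) < y ∨ y < ((a - 3 * c : ℝ) : EReal)) :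
    ((2 * c : ℝ) : EReal) < (((y - (v : EReal)).abs : ℝ≥0∞) : EReal) := by
  induction y with
  | bot => exact EReal.coe_lt_top _
  | top => exact EReal.coe_lt_top _
  | coe y =>
    rw [← EReal.coe_sub, EReal.coe_abs, EReal.coe_lt_coe_iff]
    rw [EReal.coe_lt_coe_iff, EReal.coe_lt_coe_iff] at h
    rw [abs_lt] at hv
    rw [lt_abs]
    rcases h with h | h
    · left; linarith
    · right; linarith

/-- If the medians of `|u - v|` are asymptotically small at `x` and `v` is continuous, then the
medians of `u` at `x` are asymptotically close to `v x`. -/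
lemma medians_near (h𝓑 : IsDifferentiationBasis μ 𝓑)
    {u : X → EReal} {v : X → ℝ}
    (hv : Continuous v) {x : X} {δ γ t : ℝ} (ht : 0 < t) (hδ : 0 ≤ δ) (h1 : δ ≤ γ)
    (h2 : δ ≤ 1 - γ)
    (h : limsupMedian μ 𝓑 δ (absFun fun y => u y - (v y : EReal)) x ≤ t) :
    limsupMedian μ 𝓑 γ u x ≤ ((v x + 3 * t : ℝ) : EReal) ∧
      ((v x - 3 * t : ℝ) : EReal) ≤ liminfMedian μ 𝓑 γ u x := by
  -- Relaxing `t` to `2 * t` makes the inequality strict, so it holds on all sufficiently small sets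
  -- of the basis. The remaining `t` in the bound `3 * t` is the oscillation of `v` on such sets.
  have h' : limsupMedian μ 𝓑 δ (absFun fun y => u y - (v y : EReal)) x < ((2 * t : ℝ) : EReal) :=
    h.trans_lt (by rw [EReal.coe_lt_coe_iff]; linarith)
  rw [limsupMedian] at h'
  simp only [iInf_lt_iff] at h'
  obtain ⟨ε, hε, hlt⟩ := h'
  obtain ⟨η, hη, hvη⟩ := Metric.continuous_iff.1 hv x t ht
  have key : ∀ B, B ∈ 𝓑 x ∧ Metric.diam B < min ε η →
      (∀ y ∈ B, |v y - v x| < t) ∧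
      μ {y ∈ B | ((2 * t : ℝ) : EReal) < absFun (fun y => u y - (v y : EReal)) y} <
        ENNReal.ofReal δ * μ B := by
    rintro B ⟨hB, hd⟩
    refine ⟨fun y hy => ?_, ?_⟩
    · rw [← Real.dist_eq]
      exact hvη y ((Metric.dist_le_diam_of_mem (h𝓑.bounded x B hB) hy (h𝓑.mem x B hB)).trans_lt
        (hd.trans_le (min_le_right _ _)))
    · refine measure_lt_of_median_lt (lt_of_le_of_lt ?_ hlt)
      exact le_iSup₂ (f := fun B (_ : B ∈ 𝓑 x ∧ Metric.diam B < ε) =>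
        median μ δ (absFun fun y => u y - (v y : EReal)) B) B
        ⟨hB, hd.trans_le (min_le_left _ _)⟩
  have hε' : 0 < min ε η := lt_min hε hη
  constructor
  · refine (iInf₂_le (min ε η) hε').trans (iSup₂_le fun B hB => median_le ?_)
    obtain ⟨k1, k2⟩ := key B hB
    refine (measure_mono ?_).trans_lt (k2.trans_le (mul_le_mul_left (ENNReal.ofReal_le_ofReal h1) _))
    intro y hy
    exact ⟨hy.1, coe_lt_abs_of_lt_sub (k1 y hy.1) (Or.inl hy.2)⟩
  -- The lower bound needs {u < v x - 3 t} to occupy less than the fraction 1 - γ of `B`; this is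
  -- the role of `δ ≤ 1 - γ`.
  · refine le_trans (le_iInf₂ fun B hB => ?_)
      (le_iSup₂ (f := fun ε (_ : 0 < ε) =>
        ⨅ (B : Set X) (_ : B ∈ 𝓑 x ∧ Metric.diam B < ε), median μ γ u B) (min ε η) hε')
    obtain ⟨k1, k2⟩ := key B hB
    refine le_median (by linarith) (by linarith) ?_
    refine (measure_mono ?_).trans_lt (k2.trans_le (mul_le_mul_left (ENNReal.ofReal_le_ofReal h2) _))
    intro y hy
    exact ⟨hy.1, coe_lt_abs_of_lt_sub (k1 y hy.1) (Or.inr hy.2)⟩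

end Median

/-! ### The three implications for a good norm. -/

section Equivalence

variable {X : Type*} [MetricSpace X] [MeasurableSpace X] [BorelSpace X] {μ : Measure X}
  {𝓑 : X → Set (Set X)} {p K : ℝ≥0∞} {N : (X → EReal) → ℝ≥0∞}

/-- Convergence of medians quasieverywhere implies the capacitary weak type estimate. -/
lemma IsGoodNorm.weakType_of_hasMedianLimit (hN : IsGoodNorm μ p N K)
    (h : ∀ u : X → EReal, MemSpace μ N u → Quasicontinuous μ p N u →
      ∃ E : Set X, capacity μ p N E = 0 ∧
        ∀ γ : ℝ, 0 < γ → γ < 1 → ∀ x ∉ E, HasMedianLimit μ 𝓑 γ u x (u x))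
    {γ : ℝ} (h0 : 0 < γ) (h1 : γ < 1) {t : ℝ} (ht : 0 < t) {u : X → EReal}
    (hu : MemSpace μ N u) :
    capacity μ p N {x | (t : EReal) < limsupMedian μ 𝓑 γ (absFun u) x} ≤
      K ^ p.toReal * ENNReal.ofReal (t ^ (-p.toReal)) * N u ^ p.toReal := by
  obtain ⟨w, huw, hw, hwq⟩ := hN.exists_quasicontinuous hu
  obtain ⟨E, hE, hlim⟩ := h (absFun w) (hN.memSpace_absFun hw) hwq.absFun
  have habs : absFun u =ᵐ[μ] absFun w := huw.mono fun x hx => by simp only [absFun, hx]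
  have hsub : {x | (t : EReal) < limsupMedian μ 𝓑 γ (absFun u) x} ⊆
      {x | ENNReal.ofReal t < (w x).abs} ∪ E := by
    intro x hx
    by_cases hxE : x ∈ E
    · exact Or.inr hxE
    · left
      have hx' : (t : EReal) < limsupMedian μ 𝓑 γ (absFun u) x := hx
      rw [limsupMedian_congr_ae habs, (hlim γ h0 h1 x hxE).1] at hx'
      have : ((ENNReal.ofReal t : ℝ≥0∞) : EReal) = t := by
        rw [EReal.coe_ennreal_ofReal, max_eq_left ht.le]
      rw [← this] at hx'
      exact EReal.coe_ennreal_lt_coe_ennreal_iff.1 hx'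
  refine (capacity_mono hsub).trans
    ((hN.capacity_quasicontinuous_le hw hwq hE ht).trans (le_of_eq ?_))
  rw [ENNReal.mul_rpow_of_nonneg _ _ hN.exp_pos.le, ENNReal.mul_rpow_of_nonneg _ _ hN.exp_pos.le,
    ENNReal.ofReal_rpow_of_nonneg (by positivity) hN.exp_pos.le, Real.rpow_neg ht.le,
    Real.inv_rpow ht.le, ← hN.congr u w hu.1 huw, mul_assoc]

omit [BorelSpace X] in
/-- The capacitary weak type estimate implies continuity at zero. -/
lemma IsGoodNorm.tendsto_of_weakType (hN : IsGoodNorm μ p N K) {γ t : ℝ} {C : ℝ≥0}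
    (h : ∀ u : X → EReal, MemSpace μ N u →
      capacity μ p N {x | (t : EReal) < limsupMedian μ 𝓑 γ (absFun u) x} ≤
        C * ENNReal.ofReal (t ^ (-p.toReal)) * N u ^ p.toReal)
    {u : ℕ → X → EReal} (hu : ∀ k, MemSpace μ N (u k))
    (hlim : Tendsto (fun k => N (u k)) atTop (𝓝 0)) :
    Tendsto (fun k => capacity μ p N {x | (t : EReal) < limsupMedian μ 𝓑 γ (absFun (u k)) x})
      atTop (𝓝 0) := by
  refine tendsto_of_tendsto_of_tendsto_of_le_of_le tendsto_const_nhds ?_ (fun _ => zero_le)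
    fun k => h (u k) (hu k)
  have h1 := (ENNReal.continuous_rpow_const (y := p.toReal)).tendsto 0 |>.comp hlim
  rw [ENNReal.zero_rpow_of_pos hN.exp_pos] at h1
  have := ENNReal.Tendsto.const_mul (a := C * ENNReal.ofReal (t ^ (-p.toReal))) h1
    (Or.inr (ENNReal.mul_ne_top (by simp) (by simp)))
  simpa using this

omit [MetricSpace X] [BorelSpace X] [MeasurableSpace X] in
-- Addition on `EReal` is continuous at pairs whose second entry is finite, and here the second
-- entry is `-v x`.
lemma continuousOn_sub_coe [TopologicalSpace X] {u : X → EReal} {v : X → ℝ} {s : Set X}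
    (hu : ContinuousOn u s) (hv : Continuous v) :
    ContinuousOn (fun x => u x - (v x : EReal)) s := by
  intro x hx
  have h1 : ContinuousAt (fun q : EReal × EReal => q.1 + q.2) (u x, ((-v x : ℝ) : EReal)) :=
    EReal.continuousAt_add (Or.inr (EReal.coe_ne_bot _)) (Or.inr (EReal.coe_ne_top _))
  have h2 : ContinuousWithinAt (fun y => (u y, ((-v y : ℝ) : EReal))) s x :=
    (hu x hx).prodMk (continuous_coe_real_ereal.comp hv.neg).continuousWithinAt
  have := h1.comp_continuousWithinAt (f := fun y => (u y, ((-v y : ℝ) : EReal))) h2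
  simpa [Function.comp_def, sub_eq_add_neg] using this

/-- Continuity at zero implies convergence of medians quasieverywhere. -/
lemma IsGoodNorm.hasMedianLimit_of_tendsto (hN : IsGoodNorm μ p N K)
    (h𝓑 : IsDifferentiationBasis μ 𝓑)
    (h : ∀ γ : ℝ, 0 < γ → γ < 1 → ∀ t : ℝ, 0 < t → ∀ u : ℕ → X → EReal,
      (∀ k, MemSpace μ N (u k)) → Tendsto (fun k => N (u k)) atTop (𝓝 0) →
      Tendsto (fun k => capacity μ p N
        {x | (t : EReal) < limsupMedian μ 𝓑 γ (absFun (u k)) x}) atTop (𝓝 0))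
    {u : X → EReal} (hu : MemSpace μ N u) (hq : Quasicontinuous μ p N u) :
    ∃ E : Set X, capacity μ p N E = 0 ∧
      ∀ γ : ℝ, 0 < γ → γ < 1 → ∀ x ∉ E, HasMedianLimit μ 𝓑 γ u x (u x) := by
  have hf : AEMeasurable (fun x => (u x).toReal) μ := hu.1.aemeasurable_toReal
  have hfu := hu.1.ae_eq_toReal
  have hNf : N (fun x => ((u x).toReal : EReal)) < ∞ := (MemSpace.congr hN hu hfu).2
  choose v hv hvN using fun k : ℕ =>
    hN.dense (fun x => (u x).toReal) ((k : ℝ≥0∞) + 1)⁻¹ hf hNf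
      (ENNReal.inv_pos.2 (by simp))
  set w : ℕ → X → EReal := fun k x => u x - (v k x : EReal) with hw
  have hwae : ∀ k, w k =ᵐ[μ] fun x => (((u x).toReal - v k x : ℝ) : EReal) := fun k => by
    filter_upwards [hfu] with x hx
    rw [EReal.coe_sub, ← hx]
  have hw0 : ∀ k, MemL0 μ (w k) := fun k =>
    (memL0_coe (hf.sub (hv k).measurable.aemeasurable)).congr (hwae k).symm
  have hwN : ∀ k, N (w k) ≤ ((k : ℝ≥0∞) + 1)⁻¹ := fun k => by
    rw [hN.congr _ _ (hw0 k) (hwae k)]; exact hvN k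
  have hwm : ∀ k, MemSpace μ N (w k) := fun k =>
    ⟨hw0 k, (hwN k).trans_lt (by simp)⟩
  have hwlim : Tendsto (fun k => N (w k)) atTop (𝓝 0) := by
    refine tendsto_of_tendsto_of_tendsto_of_le_of_le tendsto_const_nhds
      ((tendsto_add_atTop_iff_nat 1).2 ENNReal.tendsto_inv_nat_nhds_zero) (fun _ => zero_le) ?_
    intro k
    simpa using hwN k
  have hwq : ∀ k, Quasicontinuous μ p N (w k) := fun k ε hε => by
    obtain ⟨E, hE, hc⟩ := hq ε hε
    exact ⟨E, hE, continuousOn_sub_coe hc (hv k)⟩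
  -- Each `τ j` is both the height and the median parameter. The given `γ` enters only through τ j ≤
  -- min(γ, 1 - γ), so one exceptional set serves all `γ`.
  set τ : ℕ → ℝ := fun j => 1 / ((j : ℝ) + 2) with hτ
  have hτ0 : ∀ j, 0 < τ j := fun j => by positivity
  have hτ1 : ∀ j, τ j < 1 := fun j => by
    rw [hτ, div_lt_one (by positivity)]
    have : (0 : ℝ) ≤ j := j.cast_nonneg
    linarith
  have hτlim : Tendsto τ atTop (𝓝 0) := by
    have := (tendsto_add_atTop_iff_nat 2).2 (tendsto_one_div_atTop_nhds_zero_nat (𝕜 := ℝ))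
    simpa [hτ] using this
  set A : ℕ → ℕ → Set X := fun j n => {x | ENNReal.ofReal (τ j) < (w n x).abs} ∪ ∅ with hA
  set B : ℕ → ℕ → Set X := fun j n =>
    {x | (τ j : EReal) < limsupMedian μ 𝓑 (τ j) (absFun (w n)) x} with hB
  have hAlim : ∀ j, Tendsto (fun n => capacity μ p N (A j n)) atTop (𝓝 0) := by
    intro j
    have hempty : capacity μ p N ∅ = 0 := by
      have h0 : N 0 = 0 := hN.zero
      refine le_antisymm ((iInf₂_le 0 ⟨⟨memL0_zero, by rw [h0]; exact ENNReal.zero_lt_top⟩, ∅,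
        isOpen_empty, le_rfl, fun x hx => hx.elim⟩).trans ?_) zero_le
      rw [h0, ENNReal.zero_rpow_of_pos hN.exp_pos]
    refine tendsto_of_tendsto_of_tendsto_of_le_of_le tendsto_const_nhds ?_ (fun _ => zero_le)
      fun n => hN.capacity_quasicontinuous_le (hwm n) (hwq n) hempty (hτ0 j)
    have h1 := ENNReal.Tendsto.const_mul (a := K) (ENNReal.Tendsto.const_mul
      (a := ENNReal.ofReal (τ j)⁻¹) hwlim (Or.inr (by simp))) (Or.inr hN.ne_top)
    have h2 := (ENNReal.continuous_rpow_const (y := p.toReal)).tendsto _ |>.comp h1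
    simpa [ENNReal.zero_rpow_of_pos hN.exp_pos, Function.comp_def] using h2
  have hBlim : ∀ j, Tendsto (fun n => capacity μ p N (B j n)) atTop (𝓝 0) := fun j =>
    h (τ j) (hτ0 j) (hτ1 j) (τ j) (hτ0 j) w hwm hwlim
  -- For fixed `j` a point needs only one good `n`; hence an intersection over `n`, contained in
  -- sets of arbitrarily small capacity.
  have hcap : ∀ j, capacity μ p N (⋂ n, (A j n ∪ B j n)) = 0 := by
    intro j
    refine eq_zero_of_forall_le_rpow hN.exp_pos fun C hC hC' => ?_
    have hpos : 0 < (C / K ^ 2) ^ p.toReal := ENNReal.rpow_pos_of_nonneg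
      (ENNReal.div_pos hC.ne' (ENNReal.pow_ne_top hN.ne_top)) hN.exp_pos.le
    obtain ⟨n, h1, h2⟩ := (((tendsto_order.1 (hAlim j)).2 _ hpos).and
      ((tendsto_order.1 (hBlim j)).2 _ hpos)).exists
    exact (capacity_mono (Set.iInter_subset _ n)).trans (hN.capacity_union_le hC' h1 h2)
  refine ⟨⋃ j, ⋂ n, (A j n ∪ B j n), hN.capacity_iUnion_eq_zero hcap, ?_⟩
  intro γ hγ0 hγ1 x hx
  simp only [Set.mem_iUnion, Set.mem_iInter, not_exists, not_forall] at hx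
  have hx' : ∀ j, ∃ n, (w n x).abs ≤ ENNReal.ofReal (τ j) ∧
      limsupMedian μ 𝓑 (τ j) (absFun (w n)) x ≤ τ j := fun j => by
    obtain ⟨n, hn⟩ := hx j
    simp only [hA, hB, Set.union_empty, Set.mem_union, Set.mem_ofPred_eq, not_or, not_lt] at hn
    exact ⟨n, hn⟩
  obtain ⟨r, hr⟩ : ∃ r : ℝ, u x = r := by
    obtain ⟨n, hn, -⟩ := hx' 0
    have hlt := hn.trans_lt ENNReal.ofReal_lt_top
    simp only [hw] at hlt
    generalize u x = y at hlt
    induction y with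
    | bot => simp at hlt
    | top => simp at hlt
    | coe y => exact ⟨y, rfl⟩
  -- Of the `4 * τ j`, three come from `medians_near` and one from |u x - v n x| ≤ τ j.
  have hbound : ∀ j, τ j ≤ min γ (1 - γ) →
      limsupMedian μ 𝓑 γ u x ≤ ((r + 4 * τ j : ℝ) : EReal) ∧
        ((r - 4 * τ j : ℝ) : EReal) ≤ liminfMedian μ 𝓑 γ u x := by
    intro j hj
    obtain ⟨n, hn1, hn2⟩ := hx' j
    have hrv : |r - v n x| ≤ τ j := by
      simp only [hw, hr] at hn1
      rw [← EReal.coe_sub, EReal.abs_def] at hn1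
      exact (ENNReal.ofReal_le_ofReal_iff (hτ0 j).le).1 hn1
    rw [abs_le] at hrv
    obtain ⟨k1, k2⟩ := medians_near h𝓑 (hv n) (hτ0 j) (hτ0 j).le
      (hj.trans (min_le_left _ _)) (hj.trans (min_le_right _ _)) hn2
    exact ⟨k1.trans (EReal.coe_le_coe_iff.2 (by linarith)),
      (EReal.coe_le_coe_iff.2 (by linarith)).trans k2⟩
  have hsmall : ∀ c : ℝ, 0 < c → ∃ j, τ j ≤ min γ (1 - γ) ∧ 4 * τ j ≤ c := by
    intro c hc
    have hpos : 0 < min (min γ (1 - γ)) (c / 4) :=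
      lt_min (lt_min hγ0 (by linarith)) (by positivity)
    obtain ⟨j, hj⟩ := ((tendsto_order.1 hτlim).2 _ hpos).exists
    refine ⟨j, hj.le.trans (min_le_left _ _), ?_⟩
    have := hj.le.trans (min_le_right _ _)
    linarith
  have hup : limsupMedian μ 𝓑 γ u x ≤ (r : EReal) := by
    refine EReal.le_of_forall_lt_iff_le.1 fun c hc => ?_
    obtain ⟨j, hj1, hj2⟩ := hsmall (c - r) (sub_pos.2 (EReal.coe_lt_coe_iff.1 hc))
    exact (hbound j hj1).1.trans (EReal.coe_le_coe_iff.2 (by linarith))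
  have hlow : (r : EReal) ≤ liminfMedian μ 𝓑 γ u x := by
    refine EReal.ge_of_forall_gt_iff_ge.1 fun c hc => ?_
    obtain ⟨j, hj1, hj2⟩ := hsmall (r - c) (sub_pos.2 (EReal.coe_lt_coe_iff.1 hc))
    exact (EReal.coe_le_coe_iff.2 (by linarith)).trans (hbound j hj1).2
  have hle := liminfMedian_le_limsupMedian h𝓑 γ u x
  rw [hr]
  exact ⟨le_antisymm hup (hlow.trans hle), le_antisymm (hle.trans hup) hlow⟩

end Equivalence

/-! ### Nets of bounded overlap in doubling spaces. -/

section Net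

variable {X : Type*} [MetricSpace X] [MeasurableSpace X] [BorelSpace X] {μ : Measure X}

omit [BorelSpace X] in
lemma measure_ball_two_pow_le {Cd : ℝ≥0} (h : ∀ (x : X) (r : ℝ), 0 < r →
    μ (Metric.ball x (2 * r)) ≤ Cd * μ (Metric.ball x r)) (k : ℕ) (x : X) {r : ℝ} (hr : 0 < r) :
    μ (Metric.ball x (2 ^ k * r)) ≤ (Cd : ℝ≥0∞) ^ k * μ (Metric.ball x r) := by
  induction k with
  | zero => simp
  | succ k ih =>
    calc μ (Metric.ball x (2 ^ (k + 1) * r)) = μ (Metric.ball x (2 * (2 ^ k * r))) := by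
          congr 2; ring
      _ ≤ Cd * μ (Metric.ball x (2 ^ k * r)) := h x _ (by positivity)
      _ ≤ Cd * ((Cd : ℝ≥0∞) ^ k * μ (Metric.ball x r)) := by gcongr
      _ = _ := by ring

/-- Volume comparison: the balls of radius r/2 about the points are disjoint inside one large ball,
and doubling makes each of them a fixed fraction of it. -/
lemma card_le_of_separated (hμ : IsDoublingSpace μ) {Cd : ℝ≥0}
    (h : ∀ (x : X) (r : ℝ), 0 < r → μ (Metric.ball x (2 * r)) ≤ Cd * μ (Metric.ball x r))
    {r R : ℝ} (hr : 0 < r) (hR : 0 < R) {k : ℕ} (hk : 2 * R + r ≤ 2 ^ k * (r / 2)) (y : X)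
    (F : Finset X) (hF : ∀ z ∈ F, dist z y < R)
    (hsep : ∀ z ∈ F, ∀ z' ∈ F, z ≠ z' → r ≤ dist z z') : (F.card : ℝ≥0∞) ≤ (Cd : ℝ≥0∞) ^ k := by
  have hdisj : Set.PairwiseDisjoint (F : Set X) (fun z => Metric.ball z (r / 2)) := by
    intro z hz z' hz' hne
    refine Metric.ball_disjoint_ball ?_
    have := hsep z hz z' hz' hne
    linarith
  have h1 : ∑ z ∈ F, μ (Metric.ball z (r / 2)) ≤ μ (Metric.ball y (R + r / 2)) := by
    rw [← measure_biUnion_finset hdisj fun z _ => Metric.isOpen_ball.measurableSet]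
    refine measure_mono (Set.iUnion₂_subset fun z hz => Metric.ball_subset_ball' ?_)
    have := hF z hz
    linarith
  have h2 : ∀ z ∈ F, μ (Metric.ball y (R + r / 2)) ≤
      (Cd : ℝ≥0∞) ^ k * μ (Metric.ball z (r / 2)) := fun z hz =>
    (measure_mono (Metric.ball_subset_ball' (by
      have := hF z hz
      rw [dist_comm] at this
      linarith))).trans (measure_ball_two_pow_le h k z (half_pos hr))
  have hpos : μ (Metric.ball y (R + r / 2)) ≠ 0 := (hμ.ball_pos y _ (by positivity)).ne'
  have hfin : μ (Metric.ball y (R + r / 2)) ≠ ∞ := (hμ.ball_lt_top y _ (by positivity)).ne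
  refine (ENNReal.mul_le_mul_iff_left hpos hfin).1 ?_
  calc (F.card : ℝ≥0∞) * μ (Metric.ball y (R + r / 2))
      = ∑ z ∈ F, μ (Metric.ball y (R + r / 2)) := by simp
    _ ≤ ∑ z ∈ F, (Cd : ℝ≥0∞) ^ k * μ (Metric.ball z (r / 2)) := Finset.sum_le_sum h2
    _ = (Cd : ℝ≥0∞) ^ k * ∑ z ∈ F, μ (Metric.ball z (r / 2)) := by rw [Finset.mul_sum]
    _ ≤ _ := by gcongr

lemma exists_maximal_separated (X : Type*) [MetricSpace X] {r : ℝ} (hr : 0 < r) :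
    ∃ Z : Set X, (∀ z ∈ Z, ∀ z' ∈ Z, z ≠ z' → r ≤ dist z z') ∧ ∀ y, ∃ z ∈ Z, dist y z < r := by
  obtain ⟨Z, hZ⟩ := zorn_subset {Z : Set X | ∀ z ∈ Z, ∀ z' ∈ Z, z ≠ z' → r ≤ dist z z'} (by
    intro c hc hchain
    refine ⟨⋃₀ c, ?_, fun s hs => Set.subset_sUnion_of_mem hs⟩
    rintro z ⟨s, hs, hzs⟩ z' ⟨s', hs', hzs'⟩ hne
    rcases hchain.total hs hs' with hle | hle
    · exact hc hs' z (hle hzs) z' hzs' hne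
    · exact hc hs z hzs z' (hle hzs') hne)
  refine ⟨Z, hZ.prop, fun y => ?_⟩
  by_contra! hcon
  have hy : y ∉ Z := fun hy => by
    have := hcon y hy
    rw [dist_self] at this
    linarith
  have hins : insert y Z ∈ {Z : Set X | ∀ z ∈ Z, ∀ z' ∈ Z, z ≠ z' → r ≤ dist z z'} := by
    rintro z (rfl | hz) z' (rfl | hz') hne
    · exact absurd rfl hne
    · exact hcon z' hz'
    · rw [dist_comm]; exact hcon z hz
    · exact hZ.prop z hz z' hz' hne
  exact hy (hZ.le_of_ge hins (Set.subset_insert y Z) (Set.mem_insert y Z))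

lemma finite_ncard_le {α : Type*} {S : Set α} {M : ℕ}
    (h : ∀ F : Finset α, (F : Set α) ⊆ S → F.card ≤ M) : S.Finite ∧ S.ncard ≤ M := by
  have hfin : S.Finite := by
    by_contra hinf
    obtain ⟨F, hF, hcard⟩ := Set.Infinite.exists_subset_card_eq hinf (M + 1)
    have := h F hF
    omega
  refine ⟨hfin, ?_⟩
  rw [Set.ncard_eq_toFinset_card S hfin]
  exact h _ (by simp)

/-- In a doubling space there are nets of bounded overlap. -/
lemma exists_net (hμ : IsDoublingSpace μ) : ∃ M : ℕ, ∀ r : ℝ, 0 < r →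
    ∃ Z : Set X, Z.Countable ∧ (∀ y, ∃ z ∈ Z, dist y z < r) ∧
      ∀ y : X, {z : Z | dist y z < 3 * r}.Finite ∧ {z : Z | dist y z < 3 * r}.ncard ≤ M := by
  obtain ⟨Cd, hCd⟩ := hμ.doubling
  -- Four doublings suffice at radius `3 * r`: 2 · 3r + r = 7r ≤ 2^4 · r/2.
  refine ⟨⌊Cd ^ 4⌋₊, fun r hr => ?_⟩
  obtain ⟨Z, hsep, hcov⟩ := exists_maximal_separated X hr
  have hcount : ∀ (k : ℕ) (R : ℝ), 0 < R → 2 * R + r ≤ 2 ^ k * (r / 2) → ∀ y : X,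
      {z : Z | dist y z < R}.Finite ∧ {z : Z | dist y z < R}.ncard ≤ ⌊Cd ^ k⌋₊ := by
    intro k R hR hk y
    refine finite_ncard_le fun F hF => ?_
    have := card_le_of_separated hμ hCd hr hR hk y (F.map (Function.Embedding.subtype _))
      (by
        intro z hz
        obtain ⟨z', hz', rfl⟩ := Finset.mem_map.1 hz
        rw [dist_comm]
        exact hF hz')
      (by
        intro z hz z' hz' hne
        obtain ⟨w, hw, rfl⟩ := Finset.mem_map.1 hz
        obtain ⟨w', hw', rfl⟩ := Finset.mem_map.1 hz'
        exact hsep _ w.2 _ w'.2 hne)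
    rw [Finset.card_map] at this
    exact Nat.le_floor (by exact_mod_cast this)
  refine ⟨Z, ?_, hcov, fun y => hcount 4 (3 * r) (by positivity) (by linarith) y⟩
  rcases isEmpty_or_nonempty X with hX | ⟨⟨y₀⟩⟩
  · exact Set.to_countable _
  -- Countability of the net: it meets each ball about a fixed point in a finite set.
  · have huniv : (Set.univ : Set Z) = ⋃ n : ℕ, {z : Z | dist y₀ z < n + 1} := by
      refine (Set.eq_univ_of_forall fun z => ?_).symm
      obtain ⟨n, hn⟩ := exists_nat_gt (dist y₀ z)
      exact Set.mem_iUnion.2 ⟨n, by simp only [Set.mem_ofPred_eq]; linarith⟩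
    rw [← Set.countable_coe_iff, ← Set.countable_univ_iff, huniv]
    refine Set.countable_iUnion fun n => Set.Finite.countable ?_
    obtain ⟨k, hk⟩ := pow_unbounded_of_one_lt ((2 * ((n : ℝ) + 1) + r) / (r / 2)) one_lt_two
    refine (hcount k (n + 1) (by positivity) ?_ y₀).1
    rw [div_lt_iff₀ (by positivity)] at hk
    exact hk.le

end Net

/-! ### Stability of weighted averages. -/

section WeightedAverage

variable {ι : Type*} {F : Finset ι} {ψ φ a : ι → ℝ} {t D b : ℝ}

lemma abs_weighted_sum_le (hψ : ∀ i ∈ F, 0 ≤ ψ i) (h : ∀ i ∈ F, ψ i ≠ 0 → |a i - b| ≤ D) :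
    |∑ i ∈ F, ψ i * (a i - b)| ≤ D * ∑ i ∈ F, ψ i := by
  refine (Finset.abs_sum_le_sum_abs _ _).trans ?_
  rw [Finset.mul_sum]
  refine Finset.sum_le_sum fun i hi => ?_
  rw [abs_mul, abs_of_nonneg (hψ i hi), mul_comm]
  by_cases h0 : ψ i = 0
  · simp [h0]
  · exact mul_le_mul_of_nonneg_right (h i hi h0) (hψ i hi)

lemma weighted_average_sub (h1 : 1 ≤ ∑ i ∈ F, ψ i) :
    (∑ i ∈ F, ψ i * a i) / (∑ i ∈ F, ψ i) - b =
      (∑ i ∈ F, ψ i * (a i - b)) / ∑ i ∈ F, ψ i := by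
  have : (∑ i ∈ F, ψ i) ≠ 0 := by linarith
  simp only [mul_sub, Finset.sum_sub_distrib, ← Finset.sum_mul]
  field_simp

lemma weighted_average_close (hψ : ∀ i ∈ F, 0 ≤ ψ i) (h1 : 1 ≤ ∑ i ∈ F, ψ i)
    (h : ∀ i ∈ F, ψ i ≠ 0 → |a i - b| ≤ D) :
    |(∑ i ∈ F, ψ i * a i) / (∑ i ∈ F, ψ i) - b| ≤ D := by
  rw [weighted_average_sub h1, abs_div, abs_of_pos (a := ∑ i ∈ F, ψ i) (by linarith),
    div_le_iff₀ (by linarith)]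
  exact abs_weighted_sum_le hψ h

/-- Subtract a fixed value `a j`. The difference of the averages splits into the change of the
weights against values of size `D`, plus an average of size `D` times the change of the total
weight. Each is at most M t D, and the division is by a total weight at least one. -/
lemma weighted_average_lipschitz {M : ℕ} (hM : F.card ≤ M) (hφ : ∀ i ∈ F, 0 ≤ φ i)
    (h1 : 1 ≤ ∑ i ∈ F, ψ i) (h2 : 1 ≤ ∑ i ∈ F, φ i) (ht : ∀ i ∈ F, |ψ i - φ i| ≤ t)
    (ht0 : 0 ≤ t) (hD : ∀ i ∈ F, ∀ j ∈ F, |a i - a j| ≤ D) :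
    |(∑ i ∈ F, ψ i * a i) / (∑ i ∈ F, ψ i) - (∑ i ∈ F, φ i * a i) / (∑ i ∈ F, φ i)| ≤
      2 * M * t * D := by
  obtain ⟨j, hj⟩ : F.Nonempty := by
    by_contra hne
    rw [Finset.not_nonempty_iff_eq_empty.1 hne, Finset.sum_empty] at h1
    linarith
  have hD0 : 0 ≤ D := (abs_nonneg _).trans (hD j hj j hj)
  set A := ∑ i ∈ F, ψ i with hA
  set B := ∑ i ∈ F, φ i with hB
  have hA0 : 0 < A := by linarith
  have hB0 : 0 < B := by linarith
  have hcard : ∀ g : ι → ℝ, ∀ c : ℝ, 0 ≤ c → (∀ i ∈ F, |g i| ≤ c) → |∑ i ∈ F, g i| ≤ M * c := by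
    intro g c hc hg
    refine (Finset.abs_sum_le_sum_abs _ _).trans ((Finset.sum_le_card_nsmul _ _ _ hg).trans ?_)
    rw [nsmul_eq_mul]
    gcongr
  have e1 : |A - B| ≤ M * t := by
    rw [hA, hB, ← Finset.sum_sub_distrib]
    exact hcard _ t ht0 ht
  have e2 : |∑ i ∈ F, (ψ i - φ i) * (a i - a j)| ≤ M * (t * D) := by
    refine hcard _ _ (by positivity) fun i hi => ?_
    rw [abs_mul]
    exact mul_le_mul (ht i hi) (hD i hi j hj) (abs_nonneg _) ht0
  have e3 : |∑ i ∈ F, φ i * (a i - a j)| ≤ D * B :=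
    abs_weighted_sum_le hφ fun i hi _ => hD i hi j hj
  have e4 : (∑ i ∈ F, ψ i * a i) / A - (∑ i ∈ F, φ i * a i) / B =
      ((∑ i ∈ F, (ψ i - φ i) * (a i - a j)) + (∑ i ∈ F, φ i * (a i - a j)) / B * (B - A)) / A := by
    have k1 := weighted_average_sub (a := a) (b := a j) h1
    have k2 := weighted_average_sub (a := a) (b := a j) h2
    rw [← hA] at k1
    rw [← hB] at k2
    have k3 : ∑ i ∈ F, (ψ i - φ i) * (a i - a j) =
        ∑ i ∈ F, ψ i * (a i - a j) - ∑ i ∈ F, φ i * (a i - a j) := by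
      simp only [sub_mul, Finset.sum_sub_distrib]
    rw [k3, ← sub_sub_sub_cancel_right _ _ (a j), k1, k2]
    field_simp
    ring
  rw [e4, abs_div, abs_of_pos hA0, div_le_iff₀ hA0]
  have e5 : |(∑ i ∈ F, φ i * (a i - a j)) / B * (B - A)| ≤ D * (M * t) := by
    rw [abs_mul, abs_div, abs_of_pos hB0, abs_sub_comm B A]
    exact mul_le_mul ((div_le_iff₀ hB0).2 e3) e1 (abs_nonneg _) hD0
  calc _ ≤ M * (t * D) + D * (M * t) := (abs_add_le _ _).trans (add_le_add e2 e5)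
    _ = 2 * M * t * D * 1 := by ring
    _ ≤ 2 * M * t * D * A := by gcongr

end WeightedAverage

/-! ### Averages of net values with Lipschitz bumps. -/

section NetFunction

variable {X : Type*} [MetricSpace X]

/-- The piecewise linear bump of radius `2 r` around `z`. -/
def tent (r : ℝ) (z y : X) : ℝ := max 0 (2 - dist y z / r)

lemma tent_nonneg (r : ℝ) (z y : X) : 0 ≤ tent r z y := le_max_left _ _

lemma tent_eq_zero {r : ℝ} (hr : 0 < r) {z y : X} (h : 2 * r ≤ dist y z) : tent r z y = 0 := by
  refine max_eq_left ?_
  rw [sub_nonpos, le_div_iff₀ hr]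
  exact h

lemma one_le_tent {r : ℝ} (hr : 0 < r) {z y : X} (h : dist y z < r) : 1 ≤ tent r z y := by
  refine le_max_of_le_right ?_
  have : dist y z / r ≤ 1 := (div_le_one hr).2 h.le
  linarith

lemma abs_tent_sub_le {r : ℝ} (hr : 0 < r) (z x y : X) :
    |tent r z x - tent r z y| ≤ dist x y / r := by
  rw [tent, tent, max_comm, max_comm 0 (2 - dist y z / r)]
  refine (abs_max_sub_max_le_abs _ _ _).trans ?_
  rw [show (2 - dist x z / r) - (2 - dist y z / r) = (dist y z - dist x z) / r by ring, abs_div,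
    abs_of_pos hr, abs_sub_comm]
  gcongr
  exact abs_dist_sub_le _ _ _

/-- The average of the values `a z`, `z ∈ Z`, weighted with bumps of radius `2 r`. -/
def netAverage (Z : Set X) (r : ℝ) (a : Z → ℝ) (y : X) : ℝ :=
  (∑ᶠ z : Z, tent r (z : X) y * a z) / ∑ᶠ z : Z, tent r (z : X) y

variable {Z : Set X} {r : ℝ} {a : Z → ℝ}

/-- Any finite set containing the active nodes will do, so two nearby points can share one index
set. -/
lemma netAverage_eq (hr : 0 < r) {y : X} {F : Finset Z}
    (hF : ∀ z : Z, dist y z < 2 * r → z ∈ F) :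
    netAverage Z r a y = (∑ z ∈ F, tent r (z : X) y * a z) / ∑ z ∈ F, tent r (z : X) y := by
  have h0 : ∀ z : Z, z ∉ F → tent r (z : X) y = 0 := fun z hz =>
    tent_eq_zero hr (not_lt.1 fun h => hz (hF z h))
  rw [netAverage, finsum_eq_sum_of_support_subset (s := F) _ ?_,
    finsum_eq_sum_of_support_subset (s := F) _ ?_]
  · intro z hz
    by_contra hzF
    exact hz (h0 z hzF)
  · intro z hz
    by_contra hzF
    exact hz (by simp only [h0 z hzF, zero_mul])

lemma one_le_sum_tent (hr : 0 < r) {y : X} {F : Finset Z}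
    (hF : ∀ z : Z, dist y z < 2 * r → z ∈ F) (hcov : ∃ z ∈ Z, dist y z < r) :
    1 ≤ ∑ z ∈ F, tent r (z : X) y := by
  obtain ⟨z, hz, hd⟩ := hcov
  exact (one_le_tent hr hd).trans (Finset.single_le_sum (f := fun z : Z => tent r (z : X) y)
    (fun z _ => tent_nonneg _ _ _) (hF ⟨z, hz⟩ (hd.trans (by linarith))))

lemma abs_netAverage_sub_le (hr : 0 < r) {y : X} {b D : ℝ}
    (hfin : {z : Z | dist y z < 3 * r}.Finite) (hcov : ∃ z ∈ Z, dist y z < r)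
    (hD : ∀ z : Z, dist y z < 2 * r → |a z - b| ≤ D) : |netAverage Z r a y - b| ≤ D := by
  have hF : ∀ z : Z, dist y z < 2 * r → z ∈ hfin.toFinset := fun z hz => by
    rw [Set.Finite.mem_toFinset]
    exact lt_of_lt_of_le hz (by linarith)
  rw [netAverage_eq hr hF]
  refine weighted_average_close (fun z _ => tent_nonneg _ _ _) (one_le_sum_tent hr hF hcov) ?_
  intro z _ hz
  exact hD z (not_le.1 fun h => hz (tent_eq_zero hr h))

/-- The nodes within `3 * r` of `x` include those active at `x` and, as d(x, y) < r, those active at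
`y`. -/
lemma abs_netAverage_sub_netAverage_le (hr : 0 < r) {x y : X} (hxy : dist x y < r) {D : ℝ}
    {M : ℕ} (hfin : {z : Z | dist x z < 3 * r}.Finite)
    (hM : {z : Z | dist x z < 3 * r}.ncard ≤ M) (hcov : ∀ y, ∃ z ∈ Z, dist y z < r)
    (hD : ∀ z : Z, dist x z < 3 * r → ∀ z' : Z, dist x z' < 3 * r → |a z - a z'| ≤ D) :
    |netAverage Z r a x - netAverage Z r a y| ≤ 2 * M * (dist x y / r) * D := by
  have hF : ∀ z : Z, dist x z < 2 * r → z ∈ hfin.toFinset := fun z hz => by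
    rw [Set.Finite.mem_toFinset]
    exact lt_of_lt_of_le hz (by linarith)
  have hF' : ∀ z : Z, dist y z < 2 * r → z ∈ hfin.toFinset := fun z hz => by
    rw [Set.Finite.mem_toFinset]
    have := dist_triangle x y z
    exact lt_of_le_of_lt this (by linarith)
  rw [netAverage_eq hr hF, netAverage_eq hr hF']
  refine weighted_average_lipschitz ?_ (fun z _ => tent_nonneg _ _ _)
    (one_le_sum_tent hr hF (hcov x)) (one_le_sum_tent hr hF' (hcov y))
    (fun z _ => abs_tent_sub_le hr _ _ _) (by positivity) ?_
  · rwa [← Set.ncard_eq_toFinset_card _ hfin]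
  · intro z hz z' hz'
    rw [Set.Finite.mem_toFinset] at hz hz'
    exact hD z hz z' hz'

lemma continuous_netAverage (hr : 0 < r) {M : ℕ}
    (hfin : ∀ x : X, {z : Z | dist x z < 3 * r}.Finite ∧ {z : Z | dist x z < 3 * r}.ncard ≤ M)
    (hcov : ∀ y, ∃ z ∈ Z, dist y z < r) : Continuous (netAverage Z r a) := by
  rw [continuous_iff_continuousAt]
  intro x
  set F := (hfin x).1.toFinset with hF
  set D := ∑ z ∈ F, ∑ z' ∈ F, |a z - a z'| with hD
  have hDle : ∀ z : Z, dist x z < 3 * r → ∀ z' : Z, dist x z' < 3 * r → |a z - a z'| ≤ D := by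
    intro z hz z' hz'
    have h1 : z ∈ F := (Set.Finite.mem_toFinset _).2 hz
    have h2 : z' ∈ F := (Set.Finite.mem_toFinset _).2 hz'
    exact (Finset.single_le_sum (f := fun z' => |a z - a z'|) (fun _ _ => abs_nonneg _) h2).trans
      (Finset.single_le_sum (f := fun z => ∑ z' ∈ F, |a z - a z'|)
        (fun _ _ => Finset.sum_nonneg fun _ _ => abs_nonneg _) h1)
  refine continuousAt_of_locally_lipschitz hr (2 * M / r * D) fun y hy => ?_
  rw [dist_comm] at hy
  rw [dist_comm, Real.dist_eq, dist_comm y x]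
  refine (abs_netAverage_sub_netAverage_le hr hy (hfin x).1 (hfin x).2 hcov hDle).trans
    (le_of_eq (by ring))

end NetFunction

/-! ### Continuous approximation at a fixed scale. -/

section Approximation

variable {X : Type*} [MetricSpace X] [MeasurableSpace X] [BorelSpace X] {μ : Measure X}

omit [BorelSpace X] in
-- The points of the ball where `F` is at most its average form a set of positive measure, which
-- cannot lie in `E`.
lemma exists_mem_ball_le_setLAverage (hμ : IsDoublingSpace μ) {r : ℝ} (hr : 0 < r)
    {F : X → ℝ≥0∞} (hF : AEMeasurable F μ) {E : Set X} (hE : μ E = 0) (z : X) :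
    ∃ x, dist x z < r ∧ x ∉ E ∧ F x ≤ ⨍⁻ y in Metric.ball z r, F y ∂μ := by
  have hpos := measure_le_setLAverage_pos (hμ.ball_pos z r hr).ne' (hμ.ball_lt_top z r hr).ne
    hF.restrict
  by_contra! hcon
  refine hpos.ne' (measure_mono_null ?_ hE)
  rintro x ⟨hx, hle⟩
  by_contra hxE
  exact absurd hle (not_le.2 (hcon x hx hxE))

/-- Summing the averages over the balls of a net of bounded overlap. -/
lemma lintegral_net_le {c : ℝ≥0∞} (hμ : IsDoublingSpace μ)
    (hc : ∀ (x : X) (r : ℝ), 0 < r → μ (Metric.ball x (3 * r)) ≤ c * μ (Metric.ball x r))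
    {r : ℝ} (hr : 0 < r) {Z : Set X} (hZ : Z.Countable) {M : ℕ}
    (hfin : ∀ y : X, {z : Z | dist y z < 3 * r}.Finite ∧ {z : Z | dist y z < 3 * r}.ncard ≤ M)
    {F : X → ℝ≥0∞} (hF : AEMeasurable F μ) :
    ∫⁻ y, ∑' z : Z, (Metric.ball (z : X) (3 * r)).indicator
      (fun _ => ⨍⁻ w in Metric.ball (z : X) r, F w ∂μ) y ∂μ ≤ c * M * ∫⁻ y, F y ∂μ := by
  have := hZ.to_subtype
  have hmeas : ∀ (z : X) (ρ : ℝ), MeasurableSet (Metric.ball z ρ) := fun z ρ =>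
    Metric.isOpen_ball.measurableSet
  calc ∫⁻ y, ∑' z : Z, (Metric.ball (z : X) (3 * r)).indicator
        (fun _ => ⨍⁻ w in Metric.ball (z : X) r, F w ∂μ) y ∂μ
      = ∑' z : Z, (⨍⁻ w in Metric.ball (z : X) r, F w ∂μ) * μ (Metric.ball (z : X) (3 * r)) := by
        rw [lintegral_tsum fun z => (measurable_const.indicator (hmeas _ _)).aemeasurable]
        simp only [lintegral_indicator_const (hmeas _ _)]
    _ ≤ ∑' z : Z, c * ∫⁻ w in Metric.ball (z : X) r, F w ∂μ := by
        refine ENNReal.tsum_le_tsum fun z => ?_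
        rw [← measure_mul_setLAverage F (hμ.ball_lt_top z r hr).ne, mul_left_comm, ← mul_assoc,
          mul_comm]
        gcongr
        exact (hc z r hr).trans (le_of_eq (by ring))
    _ = c * ∫⁻ y, ∑' z : Z, (Metric.ball (z : X) r).indicator F y ∂μ := by
        rw [ENNReal.tsum_mul_left, lintegral_tsum fun z => hF.indicator (hmeas _ _)]
        simp only [lintegral_indicator (hmeas _ _)]
    -- Bounded overlap: `y` lies in at most `M` of the balls.
    _ ≤ c * ∫⁻ y, M * F y ∂μ := by
        gcongr with y
        have h0 : ∀ z : Z, z ∉ (hfin y).1.toFinset →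
              (Metric.ball (z : X) r).indicator F y = 0 := fun z hz => by
          refine Set.indicator_of_notMem (fun hy => hz ?_) _
          rw [Set.Finite.mem_toFinset]
          exact (Metric.mem_ball.1 hy).trans (by linarith)
        rw [tsum_eq_sum fun z hz => h0 z hz]
        calc ∑ z ∈ (hfin y).1.toFinset, (Metric.ball (z : X) r).indicator F y
            ≤ ∑ z ∈ (hfin y).1.toFinset, F y :=
              Finset.sum_le_sum fun z _ => Set.indicator_le_self _ _ _
          _ = (hfin y).1.toFinset.card * F y := by simp
          _ ≤ M * F y := by
              gcongr
              rw [← Set.ncard_eq_toFinset_card _ (hfin y).1]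
              exact_mod_cast (hfin y).2
    _ = c * M * ∫⁻ y, F y ∂μ := by
        rw [lintegral_const_mul' _ _ (by simp), mul_assoc]

/-- Approximation at scale `r` of a function whose oscillation at this scale is controlled by `H`. -/
theorem exists_scale_approx (hμ : IsDoublingSpace μ) {p : ℝ} (hp : 0 < p) :
    ∃ C : ℝ≥0∞, C ≠ ∞ ∧ ∀ (r : ℝ), 0 < r → ∀ (f : X → ℝ) (H : X → ℝ≥0∞) (E : Set X),
      AEMeasurable H μ → μ E = 0 →
      (∀ x ∉ E, ∀ y ∉ E, dist x y < 8 * r → ‖f x - f y‖ₑ ≤ H x + H y) →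
      ∃ (v : X → ℝ) (R : X → ℝ≥0∞), Continuous v ∧ AEMeasurable R μ ∧
        rNorm μ p R ≤ C * rNorm μ p H ∧ (∀ x ∉ E, ‖f x - v x‖ₑ ≤ R x) ∧
        ∀ x y, dist x y < r → ‖v x - v y‖ₑ ≤ ENNReal.ofReal (dist x y / r) * R x := by
  obtain ⟨M, hM⟩ := exists_net hμ
  obtain ⟨Cd, hCd⟩ := hμ.doubling
  obtain ⟨K, hK1, hKt, hK⟩ := exists_rpow_ge_two p hp
  set c : ℝ≥0∞ := (Cd : ℝ≥0∞) ^ 2 with hc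
  have hct : c ≠ ∞ := ENNReal.pow_ne_top ENNReal.coe_ne_top
  have hc3 : ∀ (x : X) (r : ℝ), 0 < r → μ (Metric.ball x (3 * r)) ≤ c * μ (Metric.ball x r) :=
    fun x r hr => (measure_mono (Metric.ball_subset_ball (by linarith))).trans
      (measure_ball_two_pow_le hCd 2 x hr)
  -- The `4 * M` is the Lipschitz factor `2 * M` times an oscillation `S + S`; the added 1 ensures
  -- `S ≤ L * S` and `L ≠ 0`.
  set L : ℝ≥0∞ := 4 * M + 1 with hL
  have hLt : L ≠ ∞ := by simp [hL, ENNReal.mul_eq_top]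
  set A : ℝ≥0∞ := (c * M) ^ (1 / p) with hA
  have hAt : A ≠ ∞ :=
    ENNReal.rpow_ne_top_of_nonneg (by positivity) (ENNReal.mul_ne_top hct (by simp))
  refine ⟨2 * (K ^ 2 * (1 + L * A)), ENNReal.mul_ne_top (by simp) (ENNReal.mul_ne_top
    (ENNReal.pow_ne_top hKt) (ENNReal.add_ne_top.2 ⟨by simp, ENNReal.mul_ne_top hLt hAt⟩)), ?_⟩
  intro r hr f H E hH hE hosc
  obtain ⟨Z, hZ, hcov, hfin⟩ := hM r hr
  have := hZ.to_subtype
  have hHp : AEMeasurable (fun x => H x ^ p) μ := hH.pow_const p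
  set α : X → ℝ≥0∞ := fun z => ⨍⁻ w in Metric.ball z r, H w ^ p ∂μ with hα
  -- Point samples replace averages of `f`, which need not be integrable; `ξ z` is chosen where `H ^
  -- p` is at most its average.
  choose ξ hξr hξE hξα using fun z : X => exists_mem_ball_le_setLAverage hμ hr hHp hE z
  set a : Z → ℝ := fun z => f (ξ z) with ha
  set T : X → ℝ≥0∞ := fun y =>
    ∑' z : Z, (Metric.ball (z : X) (3 * r)).indicator (fun _ => α z) y with hT
  have hTm : Measurable T := Measurable.tsum fun z =>
    measurable_const.indicator Metric.isOpen_ball.measurableSet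
  set S : X → ℝ≥0∞ := fun y => T y ^ (1 / p) with hS
  have hSm : Measurable S := hTm.pow_const _
  have hHS : ∀ (y : X) (z : Z), dist y z < 3 * r → H (ξ z) ≤ S y := by
    intro y z hyz
    rw [hS, one_div]
    refine (ENNReal.le_rpow_inv_iff hp).2 ((hξα z).trans ?_)
    have h1 : (Metric.ball (z : X) (3 * r)).indicator (fun _ => α z) y = α z :=
      Set.indicator_of_mem (Metric.mem_ball.2 hyz) _
    calc α z = (Metric.ball (z : X) (3 * r)).indicator (fun _ => α z) y := h1.symm
      _ ≤ T y := ENNReal.le_tsum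
        (f := fun z : Z => (Metric.ball (z : X) (3 * r)).indicator (fun _ => α z) y) z
  have hSnorm : rNorm μ p S ≤ A * rNorm μ p H := by
    rw [rNorm_le_iff hp, ENNReal.mul_rpow_of_nonneg _ _ hp.le, rNorm_rpow hp, hA,
      ← ENNReal.rpow_mul, one_div, inv_mul_cancel₀ hp.ne', ENNReal.rpow_one]
    simp only [hS, ← ENNReal.rpow_mul, one_div, inv_mul_cancel₀ hp.ne', ENNReal.rpow_one]
    exact lintegral_net_le hμ hc3 hr hZ hfin hHp
  refine ⟨netAverage Z r a, fun y => H y + L * S y, continuous_netAverage hr hfin hcov,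
    hH.add (hSm.aemeasurable.const_mul _), ?_, ?_, ?_⟩
  · refine (rNorm_add_le (C := (1 + L * A) * rNorm μ p H) hp hK1 hK hH
      (hSm.aemeasurable.const_mul _) ?_ ?_).trans (le_of_eq (by ring))
    · exact le_mul_of_one_le_left' le_self_add
    · rw [rNorm_const_mul hp hLt]
      calc L * rNorm μ p S ≤ L * (A * rNorm μ p H) := by gcongr
        _ = L * A * rNorm μ p H := by ring
        _ ≤ _ := by gcongr; exact le_add_self
  · intro x hx
    have hLS : S x ≤ L * S x := le_mul_of_one_le_left' le_add_self
    refine le_trans ?_ (add_le_add_right hLS _)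
    by_cases htop : H x + S x = ∞
    · rw [htop]; exact le_top
    have hD : ∀ z : Z, dist x z < 2 * r → |a z - f x| ≤ (H x + S x).toReal := by
      intro z hz
      have h1 : dist x (ξ z) < 8 * r := by
        have := dist_triangle_right x (ξ z) z
        have := hξr z
        linarith
      have h2 := (hosc x hx (ξ z) (hξE z) h1).trans
        (add_le_add_right (hHS x z (hz.trans (by linarith))) (H x))
      rw [abs_sub_comm, ← Real.norm_eq_abs, ← toReal_enorm]
      exact ENNReal.toReal_mono htop h2
    have h3 := abs_netAverage_sub_le hr (hfin x).1 (hcov x) hD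
    rw [abs_sub_comm] at h3
    rw [← ofReal_norm, Real.norm_eq_abs]
    exact ENNReal.ofReal_le_of_le_toReal h3
  · intro x y hxy
    refine le_trans ?_ (mul_le_mul_right (le_add_self) _)
    rcases eq_or_ne x y with rfl | hne
    · simp
    have hd : 0 < dist x y / r := div_pos (dist_pos.2 hne) hr
    by_cases htop : S x = ∞
    · rw [htop, ENNReal.mul_top (by simp [hL]), ENNReal.mul_top (by simpa using hd)]
      exact le_top
    have hD : ∀ z : Z, dist x z < 3 * r → ∀ z' : Z, dist x z' < 3 * r →
        |a z - a z'| ≤ (S x + S x).toReal := by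
      intro z hz z' hz'
      -- Source of the 8: the nodes are within `6 * r` of each other, and each sample is within `r`
      -- of its node.
      have h1 : dist (ξ z) (ξ z') < 8 * r := by
        have h2 := dist_triangle4 (ξ z) z z' (ξ z')
        have h3 := dist_triangle_left (z : X) z' x
        have h4 := hξr z
        have h5 := hξr z'
        rw [dist_comm] at h5
        linarith
      have h2 := (hosc _ (hξE z) _ (hξE z') h1).trans (add_le_add (hHS x z hz) (hHS x z' hz'))
      rw [← Real.norm_eq_abs, ← toReal_enorm]
      exact ENNReal.toReal_mono (ENNReal.add_ne_top.2 ⟨htop, htop⟩) h2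
    have h3 := abs_netAverage_sub_netAverage_le hr hxy (hfin x).1 (hfin x).2 hcov hD
    rw [← ofReal_norm, Real.norm_eq_abs]
    refine (ENNReal.ofReal_le_ofReal h3).trans ?_
    rw [ENNReal.toReal_add htop htop, show 2 * (M : ℝ) * (dist x y / r) *
      ((S x).toReal + (S x).toReal) = (dist x y / r) * ((4 * M : ℝ) * (S x).toReal) by ring,
      ENNReal.ofReal_mul hd.le, ENNReal.ofReal_mul (by positivity), ENNReal.ofReal_toReal htop]
    gcongr
    rw [ENNReal.ofReal_mul (by norm_num), ENNReal.ofReal_natCast, hL]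
    simp

end Approximation

/-! ### Functionals with vanishing tails -/

/-- The part of a sequence at the scales `2 ^ (-k)` with `n ≤ k`. -/
def tailSeq {X : Type*} (n : ℤ) (g : ℤ → X → ℝ≥0∞) : ℤ → X → ℝ≥0∞ :=
  fun k x => if n ≤ k then g k x else 0

lemma tailSeq_of_le {X : Type*} {n k : ℤ} (h : n ≤ k) (g : ℤ → X → ℝ≥0∞) :
    tailSeq n g k = g k := funext fun _ => if_pos h

lemma tailSeq_of_lt {X : Type*} {n k : ℤ} (h : k < n) (g : ℤ → X → ℝ≥0∞) :
    tailSeq n g k = fun _ => 0 := funext fun _ => if_neg (not_le.2 h)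

lemma aemeasurable_tailSeq {X : Type*} [MeasurableSpace X] {μ : Measure X} {g : ℤ → X → ℝ≥0∞}
    (hg : ∀ k, AEMeasurable (g k) μ) (n k : ℤ) : AEMeasurable (tailSeq n g k) μ := by
  rcases le_or_gt n k with h | h
  · rw [tailSeq_of_le h]; exact hg k
  · rw [tailSeq_of_lt h]; exact aemeasurable_const

/-- The properties of the functionals with exponent `q < ∞` that give the density of continuous
functions. -/
structure IsTailFunctional {X : Type*} [MeasurableSpace X] (μ : Measure X) (p : ℝ)
    (Φ : (ℤ → X → ℝ≥0∞) → ℝ≥0∞) : Prop where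
  rNorm_le : ∀ (g : ℤ → X → ℝ≥0∞) (k : ℤ), rNorm μ p (g k) ≤ Φ g
  tail : ∀ g : ℤ → X → ℝ≥0∞, (∀ k, AEMeasurable (g k) μ) → Φ g ≠ ∞ →
    Tendsto (fun n : ℕ => Φ (tailSeq n g)) atTop (𝓝 0)
  geometric : ∀ b : ℝ≥0∞, b < 1 → ∃ C : ℝ≥0∞, C ≠ ∞ ∧ ∀ (n : ℤ) (R : X → ℝ≥0∞),
    Φ (fun k x => b ^ (k - n).natAbs * R x) ≤ C * rNorm μ p R

lemma tendsto_rNorm_zero {α : Type*} [MeasurableSpace α] {μ : Measure α} {p : ℝ} (hp : 0 < p)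
    {f : ℕ → α → ℝ≥0∞} {g : α → ℝ≥0∞} (hf : ∀ n, AEMeasurable (f n) μ) (hle : ∀ n x, f n x ≤ g x)
    (hg : rNorm μ p g ≠ ∞) (hlim : ∀ᵐ x ∂μ, Tendsto (fun n => f n x) atTop (𝓝 0)) :
    Tendsto (fun n => rNorm μ p (f n)) atTop (𝓝 0) := by
  have hg' : ∫⁻ x, g x ^ p ∂μ ≠ ∞ := by
    rw [← rNorm_rpow hp]; exact ENNReal.rpow_ne_top_of_nonneg hp.le hg
  have h1 := tendsto_lintegral_of_dominated_convergence' (μ := μ) (F := fun n x => f n x ^ p)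
    (f := fun _ => 0) (fun x => g x ^ p) (fun n => (hf n).pow_const p)
    (fun n => Eventually.of_forall fun x => ENNReal.rpow_le_rpow (hle n x) hp.le) hg' (by
      filter_upwards [hlim] with x hx
      have := (ENNReal.continuous_rpow_const (y := p)).tendsto 0 |>.comp hx
      rwa [ENNReal.zero_rpow_of_pos hp] at this)
  have h2 := (ENNReal.continuous_rpow_const (y := 1 / p)).tendsto _ |>.comp h1
  rw [lintegral_zero, ENNReal.zero_rpow_of_pos (by positivity)] at h2
  exact h2

lemma eventually_lt_natCast (k : ℤ) : ∀ᶠ n : ℕ in atTop, k < (n : ℤ) :=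
  tendsto_natCast_atTop_atTop.eventually_gt_atTop k

/-- Dominated convergence for counting measure; a constant sequence shows that q = ∞ must be
excluded. -/
lemma tendsto_lqNorm_tail {q : ℝ≥0∞} (hq : 0 < q) (hq' : q ≠ ∞) {a : ℤ → ℝ≥0∞}
    (ha : lqNorm q a ≠ ∞) :
    Tendsto (fun n : ℕ => lqNorm q (fun k => if (n : ℤ) ≤ k then a k else 0)) atTop (𝓝 0) := by
  simp only [lqNorm_eq_rNorm hq'] at ha ⊢
  refine tendsto_rNorm_zero (ENNReal.toReal_pos hq.ne' hq')
    (fun n => (measurable_of_countable _).aemeasurable) (fun n k => ?_) ha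
    (Eventually.of_forall fun k => ?_)
  · split_ifs
    exacts [le_rfl, zero_le]
  · refine tendsto_const_nhds.congr' ?_
    filter_upwards [eventually_lt_natCast k] with n hn
    rw [if_neg (not_le.2 hn)]

lemma tsum_pow_natAbs_ne_top {c : ℝ≥0∞} (hc : c < 1) : ∑' k : ℤ, c ^ k.natAbs ≠ ∞ := by
  rw [tsum_of_nat_of_neg_add_one ENNReal.summable ENNReal.summable]
  have h1 : ∑' n : ℕ, c ^ n ≠ ∞ := by
    rw [ENNReal.tsum_geometric]
    exact ENNReal.inv_ne_top.2 (tsub_pos_of_lt hc).ne'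
  refine ENNReal.add_ne_top.2 ⟨by simpa using h1, ne_top_of_le_ne_top h1 ?_⟩
  refine ENNReal.tsum_le_tsum fun n => ?_
  have : (-((n : ℤ) + 1)).natAbs = n + 1 := by omega
  rw [this]
  exact pow_le_pow_of_le_one zero_le hc.le (Nat.le_succ n)

lemma lqNorm_geometric {q : ℝ≥0∞} (hq : 0 < q) (hq' : q ≠ ∞) (b : ℝ≥0∞) (n : ℤ) (c : ℝ≥0∞) :
    lqNorm q (fun k => b ^ (k - n).natAbs * c) =
      (∑' k : ℤ, (b ^ q.toReal) ^ k.natAbs) ^ (1 / q.toReal) * c := by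
  have hqr := ENNReal.toReal_pos hq.ne' hq'
  rw [lqNorm, if_neg hq']
  simp only [ENNReal.mul_rpow_of_nonneg _ _ hqr.le]
  rw [ENNReal.tsum_mul_right, ENNReal.mul_rpow_of_nonneg _ _ (by positivity), ← ENNReal.rpow_mul,
    mul_one_div, div_self hqr.ne', ENNReal.rpow_one]
  congr 2
  rw [← (Equiv.addRight n).tsum_eq]
  refine tsum_congr fun k => ?_
  rw [Equiv.coe_addRight, add_sub_cancel_right, ← ENNReal.rpow_natCast, ← ENNReal.rpow_natCast, ← ENNReal.rpow_mul,
    ← ENNReal.rpow_mul, mul_comm]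

section functionals

variable {X : Type*} [MeasurableSpace X] {μ : Measure X} {p q : ℝ≥0∞}

lemma geometric_const_ne_top (hq : 0 < q) (hq' : q ≠ ∞) {b : ℝ≥0∞} (hb : b < 1) :
    (∑' k : ℤ, (b ^ q.toReal) ^ k.natAbs) ^ (1 / q.toReal) ≠ ∞ :=
  ENNReal.rpow_ne_top_of_nonneg (by positivity)
    (tsum_pow_natAbs_ne_top (ENNReal.rpow_lt_one hb (ENNReal.toReal_pos hq.ne' hq')))

lemma isTailFunctional_tl (hp : 0 < p) (hp' : p ≠ ∞) (hq : 0 < q) (hq' : q ≠ ∞) :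
    IsTailFunctional μ p.toReal (tlFunctional μ p q) := by
  have hpr := ENNReal.toReal_pos hp.ne' hp'
  refine ⟨fun g k => ?_, fun g hg hfin => ?_, fun b hb => ?_⟩
  · rw [tlFunctional, eLpNorm_eq_rNorm hp.ne' hp']
    exact rNorm_mono hpr (Eventually.of_forall fun x => le_lqNorm hq (fun k => g k x) k)
  · simp only [tlFunctional, eLpNorm_eq_rNorm hp.ne' hp'] at hfin ⊢
    refine tendsto_rNorm_zero hpr (fun n => aemeasurable_lqNorm fun k => ?_)
      (fun n x => lqNorm_mono hq fun k => ?_) hfin ?_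
    · exact aemeasurable_tailSeq hg n k
    · simp only [tailSeq]
      split_ifs
      exacts [le_rfl, zero_le]
    · filter_upwards [ae_lt_top_of_rNorm hpr (aemeasurable_lqNorm hg) hfin] with x hx
      exact tendsto_lqNorm_tail hq hq' hx.ne
  · refine ⟨_, geometric_const_ne_top hq hq' hb, fun n R => ?_⟩
    simp only [tlFunctional, eLpNorm_eq_rNorm hp.ne' hp', lqNorm_geometric hq hq',
      rNorm_const_mul hpr (geometric_const_ne_top hq hq' hb), le_refl]

lemma isTailFunctional_besov (hp : 0 < p) (hp' : p ≠ ∞) (hq : 0 < q) (hq' : q ≠ ∞) :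
    IsTailFunctional μ p.toReal (besovFunctional μ p q) := by
  have hpr := ENNReal.toReal_pos hp.ne' hp'
  refine ⟨fun g k => ?_, fun g hg hfin => ?_, fun b hb => ?_⟩
  · rw [← eLpNorm_eq_rNorm hp.ne' hp']
    exact le_lqNorm hq (fun k => eLpNorm (g k) p μ) k
  · refine (tendsto_lqNorm_tail hq hq' hfin).congr fun n => ?_
    simp only [besovFunctional, eLpNorm_eq_rNorm hp.ne' hp']
    congr 1
    funext k
    rcases le_or_gt (n : ℤ) k with h | h
    · rw [tailSeq_of_le h, if_pos h]
    · rw [tailSeq_of_lt h, if_neg (not_le.2 h), rNorm_zero hpr]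
  · refine ⟨_, geometric_const_ne_top hq hq' hb, fun n R => ?_⟩
    have h1 : ∀ k : ℤ, b ^ (k - n).natAbs ≠ ∞ := fun k => ENNReal.pow_ne_top hb.ne_top
    simp only [besovFunctional, eLpNorm_eq_rNorm hp.ne' hp', rNorm_const_mul hpr (h1 _),
      lqNorm_geometric hq hq', le_refl]

end functionals

/-- Again a supremum of `p`-th powers is bounded by their sum, now a geometric series in `β ^ p`. -/
lemma rNorm_iSup_geometric_le {α : Type*} [MeasurableSpace α] {μ : Measure α} {p : ℝ} (hp : 0 < p)
    {β : ℝ≥0∞} {h : ℕ → α → ℝ≥0∞} (hh : ∀ i, AEMeasurable (h i) μ) {τ : ℝ≥0∞}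
    (hτ : ∀ i, rNorm μ p (h i) ≤ τ) :
    rNorm μ p (fun x => ⨆ i, β ^ i * h i x) ≤ (∑' i : ℕ, (β ^ p) ^ i) ^ (1 / p) * τ := by
  rw [rNorm_le_iff hp, ENNReal.mul_rpow_of_nonneg _ _ hp.le, ← ENNReal.rpow_mul, one_div,
    inv_mul_cancel₀ hp.ne', ENNReal.rpow_one, ← ENNReal.tsum_mul_right]
  calc ∫⁻ x, (⨆ i, β ^ i * h i x) ^ p ∂μ ≤ ∫⁻ x, ∑' i, (β ^ p) ^ i * h i x ^ p ∂μ := by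
        refine lintegral_mono fun x => ?_
        rw [rpow_iSup hp]
        refine iSup_le fun i => ?_
        have : (β ^ i * h i x) ^ p = (β ^ p) ^ i * h i x ^ p := by
          rw [ENNReal.mul_rpow_of_nonneg _ _ hp.le, ← ENNReal.rpow_natCast, ← ENNReal.rpow_natCast,
            ← ENNReal.rpow_mul, ← ENNReal.rpow_mul, mul_comm p]
        rw [this]
        exact ENNReal.le_tsum (f := fun i => (β ^ p) ^ i * h i x ^ p) i
    _ = ∑' i, (β ^ p) ^ i * ∫⁻ x, h i x ^ p ∂μ := by
        rw [lintegral_tsum fun i => ((hh i).pow_const p).const_mul _]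
        exact tsum_congr fun i => lintegral_const_mul'' _ ((hh i).pow_const p)
    _ ≤ ∑' i, (β ^ p) ^ i * τ ^ p := by
        refine ENNReal.tsum_le_tsum fun i => ?_
        gcongr
        exact (rNorm_le_iff hp).1 (hτ i)

/-! ### Powers of two -/

lemma two_zpow_eq_rpow (k : ℤ) : (2 : ℝ) ^ k = (2 : ℝ) ^ (k : ℝ) := (Real.rpow_intCast 2 k).symm

lemma rpow_le_of_lt_two_zpow {s d : ℝ} (hs : 0 < s) (hd : 0 ≤ d) {m : ℕ}
    (h : d < (2 : ℝ) ^ (-(m : ℤ))) : d ^ s ≤ ((2 : ℝ) ^ (-s)) ^ m := by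
  refine (Real.rpow_le_rpow hd h.le hs.le).trans (le_of_eq ?_)
  rw [two_zpow_eq_rpow, ← Real.rpow_natCast, ← Real.rpow_mul (by norm_num),
    ← Real.rpow_mul (by norm_num)]
  congr 1
  push_cast
  ring

/-- Equality holds at the endpoint d = 2^(-k-1), which accounts for the exponent `n + 1`. -/
lemma one_le_rpow_mul_of_coarse {s d : ℝ} (hs : 0 < s) {n : ℕ} {k : ℤ} (hk : k < n)
    (h : (2 : ℝ) ^ (-k - 1) ≤ d) :
    1 ≤ d ^ s * (((2 : ℝ) ^ (-s)) ^ (k - n).natAbs * ((2 : ℝ) ^ s) ^ (n + 1)) := by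
  have h1 : ((2 : ℝ) ^ (-k - 1)) ^ s ≤ d ^ s := Real.rpow_le_rpow (by positivity) h hs.le
  refine le_trans (le_of_eq ?_) (mul_le_mul_of_nonneg_right h1 (by positivity))
  have h2 : (((k - n).natAbs : ℕ) : ℝ) = n - k := by
    rw [Nat.cast_natAbs, abs_of_nonpos (by omega)]
    push_cast
    ring
  rw [two_zpow_eq_rpow, ← Real.rpow_natCast (2 ^ (-s)), ← Real.rpow_natCast (2 ^ s),
    ← Real.rpow_mul (by norm_num), ← Real.rpow_mul (by norm_num), ← Real.rpow_mul (by norm_num),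
    ← Real.rpow_add (by norm_num), ← Real.rpow_add (by norm_num), h2]
  rw [eq_comm, ← Real.rpow_zero 2]
  congr 1
  push_cast
  ring

/-- Write d = d^s d^(1-s): a Lipschitz bound gains the factor d^(1-s) over a Hölder one, which
decays at fine scales because s < 1. -/
lemma div_le_rpow_mul_of_fine {s d : ℝ} (hs1 : s < 1) (hd : 0 < d) {n : ℕ} {k : ℤ} (hk : n ≤ k)
    (h : d < (2 : ℝ) ^ (-k)) :
    d / (2 : ℝ) ^ (-(n : ℤ)) ≤
      d ^ s * (((2 : ℝ) ^ (-(1 - s))) ^ (k - n).natAbs * ((2 : ℝ) ^ s) ^ n) := by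
  have h1 : d ^ (1 - s) ≤ ((2 : ℝ) ^ (-k)) ^ (1 - s) :=
    Real.rpow_le_rpow hd.le h.le (by linarith)
  have h2 : (((k - n).natAbs : ℕ) : ℝ) = k - n := by
    rw [Nat.cast_natAbs, abs_of_nonneg (by omega)]
    push_cast
    ring
  have h3 : d = d ^ s * d ^ (1 - s) := by
    rw [← Real.rpow_add hd, add_sub_cancel, Real.rpow_one]
  have h4 : ((2 : ℝ) ^ (-k)) ^ (1 - s) * ((2 : ℝ) ^ (-(n : ℤ)))⁻¹ =
      ((2 : ℝ) ^ (-(1 - s))) ^ (k - n).natAbs * ((2 : ℝ) ^ s) ^ n := by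
    rw [two_zpow_eq_rpow, two_zpow_eq_rpow, ← Real.rpow_natCast (2 ^ (-(1 - s))),
      ← Real.rpow_natCast (2 ^ s), ← Real.rpow_neg (by norm_num),
      ← Real.rpow_mul (by norm_num), ← Real.rpow_mul (by norm_num), ← Real.rpow_mul (by norm_num),
      ← Real.rpow_add (by norm_num), ← Real.rpow_add (by norm_num), h2]
    congr 1
    push_cast
    ring
  rw [← h4, div_eq_mul_inv, ← mul_assoc]
  gcongr
  calc d = d ^ s * d ^ (1 - s) := h3
    _ ≤ _ := by gcongr

lemma exists_dyadic_scale {d : ℝ} (hd : 0 < d) :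
    ∃ k : ℤ, (2 : ℝ) ^ (-k - 1) ≤ d ∧ d < (2 : ℝ) ^ (-k) := by
  obtain ⟨n, h1, h2⟩ := exists_mem_Ico_zpow hd (one_lt_two (α := ℝ))
  refine ⟨-(n + 1), ?_, ?_⟩
  · simpa using h1
  · simpa using h2

/-! ### Density of continuous functions for s < 1 and q < ∞. -/

section Density

variable {X : Type*} [MetricSpace X] [MeasurableSpace X] [BorelSpace X] {μ : Measure X}

omit [MeasurableSpace X] [BorelSpace X] in
/-- The oscillation of a function at scale `2 ^ (-n)` in terms of a fractional gradient. -/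
lemma enorm_sub_le_of_fracGradient {s : ℝ} (hs : 0 < s) {f : X → ℝ} {g : ℤ → X → ℝ≥0∞} {E : Set X}
    (hE : ∀ k : ℤ, ∀ x ∉ E, ∀ y ∉ E, (2 : ℝ) ^ (-k - 1) ≤ dist x y →
      dist x y < (2 : ℝ) ^ (-k) →
        ‖f x - f y‖ₑ ≤ ENNReal.ofReal (dist x y ^ s) * (g k x + g k y))
    (n : ℕ) {x y : X} (hx : x ∉ E) (hy : y ∉ E) (hxy : dist x y < (2 : ℝ) ^ (-(n : ℤ))) :
    ‖f x - f y‖ₑ ≤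
      ENNReal.ofReal (2 ^ (-s)) ^ n * (⨆ i : ℕ, ENNReal.ofReal (2 ^ (-s)) ^ i * g (n + i) x) +
      ENNReal.ofReal (2 ^ (-s)) ^ n * (⨆ i : ℕ, ENNReal.ofReal (2 ^ (-s)) ^ i * g (n + i) y) := by
  rcases eq_or_ne x y with rfl | hne
  · simp
  obtain ⟨k, hk1, hk2⟩ := exists_dyadic_scale (dist_pos.2 hne)
  have hk : (n : ℤ) ≤ k := by
    have h := hk1.trans_lt hxy
    rw [zpow_lt_zpow_iff_right₀ one_lt_two] at h
    omega
  obtain ⟨i, rfl⟩ := Int.le.dest hk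
  have hd : dist x y ^ s ≤ ((2 : ℝ) ^ (-s)) ^ (n + i) :=
    rpow_le_of_lt_two_zpow hs dist_nonneg (by push_cast; exact hk2)
  have hd' : ENNReal.ofReal (dist x y ^ s) ≤
      ENNReal.ofReal (2 ^ (-s)) ^ n * ENNReal.ofReal (2 ^ (-s)) ^ i := by
    rw [← pow_add, ← ENNReal.ofReal_pow (by positivity)]
    exact ENNReal.ofReal_le_ofReal hd
  refine (hE _ x hx y hy hk1 hk2).trans ?_
  calc _ ≤ ENNReal.ofReal (2 ^ (-s)) ^ n * ENNReal.ofReal (2 ^ (-s)) ^ i *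
        (g (n + i) x + g (n + i) y) := by gcongr
    _ = ENNReal.ofReal (2 ^ (-s)) ^ n * (ENNReal.ofReal (2 ^ (-s)) ^ i * g (n + i) x) +
        ENNReal.ofReal (2 ^ (-s)) ^ n * (ENNReal.ofReal (2 ^ (-s)) ^ i * g (n + i) y) := by ring
    _ ≤ _ := by
      gcongr
      · exact le_iSup (fun i : ℕ => ENNReal.ofReal (2 ^ (-s)) ^ i * g (n + i) x) i
      · exact le_iSup (fun i : ℕ => ENNReal.ofReal (2 ^ (-s)) ^ i * g (n + i) y) i

omit [BorelSpace X] in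
/-- A fractional gradient of the error of the approximation at scale `2 ^ (-m)`. -/
lemma isFracGradient_sub_scale_approx {s : ℝ} (hs : 0 < s) (hs1 : s < 1) {f v : X → ℝ}
    {g : ℤ → X → ℝ≥0∞} {R : X → ℝ≥0∞} {E : Set X} (hg : ∀ k, AEMeasurable (g k) μ)
    (hR : AEMeasurable R μ) (hμE : μ E = 0)
    (hE : ∀ k : ℤ, ∀ x ∉ E, ∀ y ∉ E, (2 : ℝ) ^ (-k - 1) ≤ dist x y →
      dist x y < (2 : ℝ) ^ (-k) →
        ‖f x - f y‖ₑ ≤ ENNReal.ofReal (dist x y ^ s) * (g k x + g k y))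
    (m : ℕ) (hfv : ∀ x ∉ E, ‖f x - v x‖ₑ ≤ R x)
    (hv : ∀ x y, dist x y < (2 : ℝ) ^ (-(m : ℤ)) →
      ‖v x - v y‖ₑ ≤ ENNReal.ofReal (dist x y / (2 : ℝ) ^ (-(m : ℤ))) * R x) :
    IsFracGradient μ s (fun x => ((f x - v x : ℝ) : EReal))
      (fun k x => tailSeq m g k x +
        ENNReal.ofReal (max (2 ^ (-s)) (2 ^ (-(1 - s)))) ^ (k - m).natAbs *
          (ENNReal.ofReal (2 ^ s) ^ (m + 1) * R x)) := by
  set b : ℝ := max (2 ^ (-s)) (2 ^ (-(1 - s))) with hb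
  have hb0 : 0 ≤ b := le_max_of_le_left (by positivity)
  have h2s : 1 ≤ (2 : ℝ) ^ s := Real.one_le_rpow (by norm_num) hs.le
  have hcoef : ∀ j : ℕ, ENNReal.ofReal b ^ j * ENNReal.ofReal (2 ^ s) ^ (m + 1) =
      ENNReal.ofReal (b ^ j * (2 ^ s) ^ (m + 1)) := fun j => by
    rw [ENNReal.ofReal_mul (by positivity), ENNReal.ofReal_pow hb0,
      ENNReal.ofReal_pow (by positivity)]
  refine ⟨fun k => (aemeasurable_tailSeq hg _ _).add ((hR.const_mul _).const_mul _), E, hμE, ?_⟩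
  intro k x hx y hy hk1 hk2
  rw [abs_coe_sub]
  simp only [← mul_assoc, hcoef]
  set j := (k - m).natAbs with hj
  set c : ℝ := b ^ j * (2 ^ s) ^ (m + 1) with hc
  -- At scales coarser than 2^(-m) only the size of `f - v` is used; at finer ones, the gradient of
  -- `f` and the Lipschitz bound for `v`.
  rcases lt_or_ge k (m : ℤ) with hkm | hkm
  · have h1 : 1 ≤ dist x y ^ s * c := by
      refine (one_le_rpow_mul_of_coarse hs hkm hk1).trans ?_
      rw [hc]
      gcongr
      exact le_max_left _ _
    have h2 : 1 ≤ ENNReal.ofReal (dist x y ^ s) * ENNReal.ofReal c := by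
      rw [← ENNReal.ofReal_mul (by positivity), ← ENNReal.ofReal_one]
      exact ENNReal.ofReal_le_ofReal h1
    calc ‖f x - v x - (f y - v y)‖ₑ ≤ ‖f x - v x‖ₑ + ‖f y - v y‖ₑ := enorm_sub_le
      _ ≤ R x + R y := add_le_add (hfv x hx) (hfv y hy)
      _ ≤ (ENNReal.ofReal (dist x y ^ s) * ENNReal.ofReal c) * (R x + R y) :=
          le_mul_of_one_le_left' h2
      _ = ENNReal.ofReal (dist x y ^ s) * (ENNReal.ofReal c * R x + ENNReal.ofReal c * R y) := by
          ring
      _ ≤ _ := by gcongr <;> exact le_add_self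
  · have hxy : 0 < dist x y := (by positivity : (0 : ℝ) < 2 ^ (-k - 1)).trans_le hk1
    have hfine : dist x y < (2 : ℝ) ^ (-(m : ℤ)) :=
      hk2.trans_le (zpow_le_zpow_right₀ one_le_two (by omega))
    have h1 : dist x y / (2 : ℝ) ^ (-(m : ℤ)) ≤ dist x y ^ s * c := by
      refine (div_le_rpow_mul_of_fine hs1 hxy hkm hk2).trans ?_
      rw [hc]
      gcongr
      · exact le_max_right _ _
      · omega
    have h2 : ‖v x - v y‖ₑ ≤ ENNReal.ofReal (dist x y ^ s) * (ENNReal.ofReal c * R x) := by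
      refine (hv x y hfine).trans ?_
      rw [← mul_assoc, ← ENNReal.ofReal_mul (by positivity)]
      gcongr
    rw [tailSeq_of_le hkm]
    calc ‖f x - v x - (f y - v y)‖ₑ = ‖(f x - f y) - (v x - v y)‖ₑ := by congr 1; ring
      _ ≤ ‖f x - f y‖ₑ + ‖v x - v y‖ₑ := enorm_sub_le
      _ ≤ ENNReal.ofReal (dist x y ^ s) * (g k x + g k y) +
          ENNReal.ofReal (dist x y ^ s) * (ENNReal.ofReal c * R x) :=
        add_le_add (hE k x hx y hy hk1 hk2) h2
      _ = ENNReal.ofReal (dist x y ^ s) * ((g k x + ENNReal.ofReal c * R x) + g k y) := by ring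
      _ ≤ _ := by gcongr; exact le_self_add

/-- Continuous functions are dense in the spaces with smoothness `s < 1` and exponent `q < ∞`. -/
theorem dense_of_isTailFunctional (hμ : IsDoublingSpace μ) {s : ℝ} (hs : 0 < s) (hs1 : s < 1)
    {p K : ℝ≥0∞} (hp : 0 < p) (hp' : p ≠ ∞) (hK1 : 1 ≤ K) (hK' : K ≠ ∞)
    {Φ : (ℤ → X → ℝ≥0∞) → ℝ≥0∞} (hΦ : IsGradFunctional μ Φ K)
    (hΦt : IsTailFunctional μ p.toReal Φ) (f : X → ℝ) (ε : ℝ≥0∞)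
    (hfin : gradNorm μ s p Φ (fun x => (f x : EReal)) < ∞) (hε : 0 < ε) :
    ∃ v : X → ℝ, Continuous v ∧ gradNorm μ s p Φ (fun x => ((f x - v x : ℝ) : EReal)) ≤ ε := by
  have hpr := ENNReal.toReal_pos hp.ne' hp'
  obtain ⟨g, ⟨hg, E, hμE, hE⟩, hlt⟩ := gradNorm_lt_iff.1 hfin
  simp only [abs_coe_sub] at hE
  have hΦg : Φ g ≠ ∞ := (le_add_self.trans_lt hlt).ne
  set τ : ℕ → ℝ≥0∞ := fun n => Φ (tailSeq n g) with hτ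
  have hτlim : Tendsto τ atTop (𝓝 0) := hΦt.tail g hg hΦg
  obtain ⟨C, hC, happ⟩ := exists_scale_approx hμ hpr
  set β : ℝ≥0∞ := ENNReal.ofReal (2 ^ (-s)) with hβ
  have hβ1 : β < 1 := by
    rw [hβ, ENNReal.ofReal_lt_one]
    exact Real.rpow_lt_one_of_one_lt_of_neg one_lt_two (by linarith)
  set b : ℝ≥0∞ := ENNReal.ofReal (max (2 ^ (-s)) (2 ^ (-(1 - s)))) with hb
  have hb1 : b < 1 := by
    rw [hb, ENNReal.ofReal_lt_one]
    exact max_lt (Real.rpow_lt_one_of_one_lt_of_neg one_lt_two (by linarith))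
      (Real.rpow_lt_one_of_one_lt_of_neg one_lt_two (by linarith))
  obtain ⟨C', hC', hgeo⟩ := hΦt.geometric b hb1
  set G : ℝ≥0∞ := (∑' i : ℕ, (β ^ p.toReal) ^ i) ^ (1 / p.toReal) with hG
  have hGt : G ≠ ∞ := by
    refine ENNReal.rpow_ne_top_of_nonneg (by positivity) ?_
    rw [ENNReal.tsum_geometric]
    exact ENNReal.inv_ne_top.2 (tsub_pos_of_lt (ENNReal.rpow_lt_one hβ1 hpr)).ne'
  set W : ℝ≥0∞ := ENNReal.ofReal (2 ^ s) with hW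
  have hW1 : 1 ≤ W := by
    rw [hW, ← ENNReal.ofReal_one]
    exact ENNReal.ofReal_le_ofReal (Real.one_le_rpow (by norm_num) hs.le)
  have hWt : W ≠ ∞ := ENNReal.ofReal_ne_top
  have hWβ : W * β = 1 := by
    rw [hW, hβ, ← ENNReal.ofReal_mul (by positivity), ← Real.rpow_add (by norm_num)]
    simp
  -- The error carries W^(n+4) and the oscillation β^n; since W β = 1, only W^4 survives, uniformly
  -- in `n`.
  set L : ℝ≥0∞ := W ^ 4 * C * G with hL
  have hLt : L ≠ ∞ := ENNReal.mul_ne_top (ENNReal.mul_ne_top (ENNReal.pow_ne_top hWt) hC) hGt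
  have key : ∀ n : ℕ, ∃ v : X → ℝ, Continuous v ∧
      gradNorm μ s p Φ (fun x => ((f x - v x : ℝ) : EReal)) ≤
        L * τ n + 2 * (K ^ 2 * (τ (n + 3) + C' * (L * τ n))) := by
    intro n
    set H : X → ℝ≥0∞ := fun x => β ^ n * ⨆ i : ℕ, β ^ i * g (n + i) x with hH
    have hHm : AEMeasurable H μ :=
      (AEMeasurable.iSup fun i => (hg _).const_mul _).const_mul _
    have hHn : rNorm μ p.toReal H ≤ β ^ n * (G * τ n) := by
      rw [hH, rNorm_const_mul hpr (ENNReal.pow_ne_top hβ1.ne_top)]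
      gcongr
      refine rNorm_iSup_geometric_le hpr (fun i => hg _) fun i => ?_
      have := hΦt.rNorm_le (tailSeq n g) (n + i)
      rwa [tailSeq_of_le (by omega)] at this
    -- Averaging at scale 2^(-n-3) involves distances below 2^(-n), where only the tail of `g` from
    -- index `n` matters.
    have h8 : 8 * (2 : ℝ) ^ (-((n + 3 : ℕ) : ℤ)) = 2 ^ (-(n : ℤ)) := by
      have : (8 : ℝ) = 2 ^ (3 : ℤ) := by norm_num
      rw [this, ← zpow_add₀ two_ne_zero]
      congr 1
      push_cast
      ring
    obtain ⟨v, R, hvc, hR, hRn, hfv, hv⟩ := happ ((2 : ℝ) ^ (-((n + 3 : ℕ) : ℤ))) (by positivity)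
      f H E hHm hμE (by
        intro x hx y hy hxy
        rw [h8] at hxy
        exact enorm_sub_le_of_fracGradient hs hE n hx hy hxy)
    refine ⟨v, hvc, ?_⟩
    have hgrad := isFracGradient_sub_scale_approx hs hs1 hg hR hμE hE (n + 3) hfv hv
    set R' : X → ℝ≥0∞ := fun x => W ^ (n + 3 + 1) * R x with hR'
    have hR'n : rNorm μ p.toReal R' ≤ L * τ n := by
      rw [hR', rNorm_const_mul hpr (ENNReal.pow_ne_top hWt)]
      calc W ^ (n + 3 + 1) * rNorm μ p.toReal R
          ≤ W ^ (n + 3 + 1) * (C * (β ^ n * (G * τ n))) := by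
            gcongr
            exact hRn.trans (by gcongr)
        _ = (W * β) ^ n * (L * τ n) := by rw [hL]; ring
        _ = L * τ n := by rw [hWβ, one_pow, one_mul]
    refine (gradNorm_le hgrad).trans (add_le_add ?_ ?_)
    · rw [lpNormX_coe hp hp']
      refine (rNorm_mono hpr ?_).trans hR'n
      filter_upwards [measure_eq_zero_iff_ae_notMem.1 hμE] with x hx
      exact (hfv x hx).trans (le_mul_of_one_le_left' (one_le_pow₀ hW1))
    · refine hΦ.add_le hK1 (f := tailSeq ((n + 3 : ℕ) : ℤ) g)
        (g := fun k x => b ^ (k - ((n + 3 : ℕ) : ℤ)).natAbs * R' x)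
        (aemeasurable_tailSeq hg _) (fun k => (hR.const_mul _).const_mul _) le_self_add ?_
      refine (hgeo _ R').trans (le_add_left ?_)
      gcongr
  have hlim : Tendsto (fun n => L * τ n + 2 * (K ^ 2 * (τ (n + 3) + C' * (L * τ n)))) atTop
      (𝓝 0) := by
    have h1 : Tendsto (fun n => L * τ n) atTop (𝓝 (L * 0)) :=
      ENNReal.Tendsto.const_mul hτlim (Or.inr hLt)
    have h2 : Tendsto (fun n => C' * (L * τ n)) atTop (𝓝 (C' * (L * 0))) :=
      ENNReal.Tendsto.const_mul h1 (Or.inr hC')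
    have h3 := (((tendsto_add_atTop_iff_nat 3).2 hτlim).add h2)
    have h4 := h1.add (ENNReal.Tendsto.const_mul (a := 2) (ENNReal.Tendsto.const_mul h3
      (Or.inr (ENNReal.pow_ne_top (n := 2) hK'))) (Or.inr (by simp)))
    simpa using h4
  obtain ⟨n, hn⟩ := ((tendsto_order.1 hlim).2 ε hε).exists
  obtain ⟨v, hv, hvn⟩ := key n
  exact ⟨v, hv, hvn.trans hn.le⟩

end Density

/-! ### Extension of Hölder functions. -/

section Hoelder

variable {X : Type*} [MetricSpace X]

/-- The McShane extension of a bounded Hölder continuous function. -/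
lemma exists_hoelder_extension {s : ℝ} (hs : 0 < s) (hs1 : s ≤ 1) {A : Set X} {f : X → ℝ}
    {L t : ℝ} (hL : 0 ≤ L) (ht : 0 ≤ t) (hf : ∀ x ∈ A, ∀ y ∈ A, |f x - f y| ≤ L * dist x y ^ s)
    (hft : ∀ x ∈ A, |f x| ≤ t) :
    ∃ v : X → ℝ, (∀ x y, |v x - v y| ≤ L * dist x y ^ s) ∧ (∀ x ∈ A, v x = f x) ∧
      ∀ x, |v x| ≤ t := by
  rcases A.eq_empty_or_nonempty with rfl | hA
  · refine ⟨fun _ => 0, fun x y => ?_, fun x hx => hx.elim, fun x => by simpa using ht⟩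
    simp only [sub_zero, abs_zero]
    positivity
  have := hA.to_subtype
  set u : X → ℝ := fun y => ⨅ z : A, (f z + L * dist y z ^ s) with hu
  have hbdd : ∀ y : X, BddBelow (Set.range fun z : A => f z + L * dist y z ^ s) := by
    intro y
    refine ⟨-t, ?_⟩
    rintro _ ⟨z, rfl⟩
    have h1 := (abs_le.1 (hft z z.2)).1
    have h2 : 0 ≤ L * dist y z ^ s := by positivity
    show -t ≤ f z + L * dist y z ^ s
    linarith
  have hule : ∀ x y, u x ≤ u y + L * dist x y ^ s := by
    intro x y
    rw [← sub_le_iff_le_add]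
    refine le_ciInf fun z => ?_
    rw [sub_le_iff_le_add]
    refine (ciInf_le (hbdd x) z).trans ?_
    -- For s ≤ 1 the power `dist ^ s` still satisfies the triangle inequality, so McShane's argument
    -- applies.
    have h1 : dist x z ^ s ≤ dist x y ^ s + dist y z ^ s :=
      (Real.rpow_le_rpow dist_nonneg (dist_triangle x y z) hs.le).trans
        (Real.rpow_add_le_add_rpow dist_nonneg dist_nonneg hs.le hs1)
    have h2 := mul_le_mul_of_nonneg_left h1 hL
    linarith
  have hudist : ∀ x y, |u x - u y| ≤ L * dist x y ^ s := by
    intro x y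
    rw [abs_le]
    have h1 := hule x y
    have h2 := hule y x
    rw [dist_comm y x] at h2
    constructor <;> linarith
  have huA : ∀ x ∈ A, u x = f x := by
    intro x hx
    refine le_antisymm ((ciInf_le (hbdd x) ⟨x, hx⟩).trans (le_of_eq ?_)) (le_ciInf fun z => ?_)
    · simp [Real.zero_rpow hs.ne']
    · have := (abs_le.1 (hf x hx z z.2)).2
      linarith
  refine ⟨fun x => max (-t) (min t (u x)), fun x y => ?_, fun x hx => ?_, fun x => ?_⟩
  · refine le_trans ?_ (hudist x y)
    simp only
    rw [max_comm, max_comm (-t) (min t (u y)), min_comm, min_comm t (u y)]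
    exact (abs_max_sub_max_le_abs _ _ _).trans (by
      simpa using abs_min_sub_min_le_max (u x) t (u y) t)
  · have h := abs_le.1 (hft x hx)
    simp only [huA x hx]
    rw [min_eq_right h.2, max_eq_right h.1]
  · rw [abs_le]
    exact ⟨le_max_left _ _, max_le (by linarith) (min_le_left _ _)⟩

lemma continuous_of_hoelder {s L : ℝ} (hs : 0 < s) {v : X → ℝ}
    (hv : ∀ x y, |v x - v y| ≤ L * dist x y ^ s) : Continuous v := by
  rw [continuous_iff_continuousAt]
  intro x
  rw [ContinuousAt, tendsto_iff_dist_tendsto_zero]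
  have h1 : Tendsto (fun y => L * dist y x ^ s) (𝓝 x) (𝓝 0) := by
    have h2 : Tendsto (fun y => dist y x) (𝓝 x) (𝓝 0) := tendsto_iff_dist_tendsto_zero.1 tendsto_id
    have h3 := (h2.rpow_const (p := s) (Or.inr hs.le)).const_mul L
    simpa [Real.zero_rpow hs.ne'] using h3
  exact squeeze_zero (fun _ => dist_nonneg) (fun y => by rw [Real.dist_eq]; exact hv y x) h1

end Hoelder

/-! ### Density for q = ∞, and the verification of the axioms for all admissible norms. -/

section HajlaszDensity

variable {X : Type*} [MetricSpace X] [MeasurableSpace X] {μ : Measure X} {s : ℝ} {p : ℝ≥0∞}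

omit [MeasurableSpace X] in
/-- Truncation of a function with an `s`-gradient `G` at height `t`. -/
lemma exists_truncation (hs : 0 < s) (hs1 : s ≤ 1) {f : X → ℝ} {G : X → ℝ≥0∞} {E : Set X}
    (hG : ∀ x ∉ E, ∀ y ∉ E, ‖f x - f y‖ₑ ≤ ENNReal.ofReal (dist x y ^ s) * (G x + G y)) (n : ℕ) :
    ∃ v : X → ℝ, Continuous v ∧
      (∀ x ∉ E, ‖f x - v x‖ₑ ≤
        {x | (n : ℝ≥0∞) < G x + ‖f x‖ₑ}.indicator (fun x => 4 * (G x + ‖f x‖ₑ)) x) ∧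
      ∀ x ∉ E, ∀ y ∉ E, ‖(f x - v x) - (f y - v y)‖ₑ ≤ ENNReal.ofReal (dist x y ^ s) *
        ({x | (n : ℝ≥0∞) < G x + ‖f x‖ₑ}.indicator (fun x => 4 * (G x + ‖f x‖ₑ)) x +
          {x | (n : ℝ≥0∞) < G x + ‖f x‖ₑ}.indicator (fun x => 4 * (G x + ‖f x‖ₑ)) y) := by
  set B : Set X := {x | (n : ℝ≥0∞) < G x + ‖f x‖ₑ} with hB
  set h : X → ℝ≥0∞ := B.indicator (fun x => 4 * (G x + ‖f x‖ₑ)) with hh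
  have hnB : ∀ x, x ∉ B → G x ≤ n ∧ ‖f x‖ₑ ≤ n := fun x hx => by
    have hx' : G x + ‖f x‖ₑ ≤ n := not_lt.1 hx
    exact ⟨le_self_add.trans hx', le_add_self.trans hx'⟩
  have hlip : ∀ x ∈ (E ∪ B)ᶜ, ∀ y ∈ (E ∪ B)ᶜ, |f x - f y| ≤ 2 * n * dist x y ^ s := by
    intro x hx y hy
    simp only [Set.mem_compl_iff, Set.mem_union, not_or] at hx hy
    have h1 : ‖f x - f y‖ₑ ≤ ENNReal.ofReal (2 * n * dist x y ^ s) := by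
      refine (hG x hx.1 y hy.1).trans ?_
      rw [mul_comm, ENNReal.ofReal_mul (by positivity)]
      gcongr
      refine (add_le_add (hnB x hx.2).1 (hnB y hy.2).1).trans (le_of_eq ?_)
      rw [ENNReal.ofReal_mul (by norm_num), ENNReal.ofReal_natCast, ← two_mul]
      simp
    rw [← ofReal_norm, ENNReal.ofReal_le_ofReal_iff (by positivity)] at h1
    exact h1
  have hbd : ∀ x ∈ (E ∪ B)ᶜ, |f x| ≤ n := by
    intro x hx
    simp only [Set.mem_compl_iff, Set.mem_union, not_or] at hx
    have h1 := (hnB x hx.2).2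
    rw [← ofReal_norm, ← ENNReal.ofReal_natCast, ENNReal.ofReal_le_ofReal_iff (by positivity)] at h1
    exact h1
  obtain ⟨v, hv1, hv2, hv3⟩ :=
    exists_hoelder_extension hs hs1 (by positivity) (Nat.cast_nonneg n) hlip hbd
  have hmem : ∀ x, x ∉ E → x ∉ B → f x - v x = 0 := fun x hxE hxB => by
    rw [hv2 x (by simp [hxE, hxB]), sub_self]
  have hhB : ∀ x ∈ B, h x = 4 * (G x + ‖f x‖ₑ) := fun x hx => Set.indicator_of_mem hx _
  -- A single point of `B` must pay for three things: its own `G`, the `2 * n` of the extension, and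
  -- `G ≤ n` at a partner outside `B`.
  have hhn : ∀ x ∈ B, G x + 3 * n ≤ h x := fun x hx => by
    rw [hhB x hx]
    calc G x + 3 * n ≤ (G x + ‖f x‖ₑ) + 3 * (G x + ‖f x‖ₑ) := by
          gcongr
          · exact le_self_add
          · exact hx.le
      _ = _ := by ring
  refine ⟨v, continuous_of_hoelder hs hv1, fun x hx => ?_, fun x hx y hy => ?_⟩
  · by_cases hxB : x ∈ B
    · rw [hhB x hxB]
      have h1 : ‖v x‖ₑ ≤ n := by
        rw [← ofReal_norm, ← ENNReal.ofReal_natCast]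
        exact ENNReal.ofReal_le_ofReal (hv3 x)
      calc ‖f x - v x‖ₑ ≤ ‖f x‖ₑ + ‖v x‖ₑ := enorm_sub_le
        _ ≤ (G x + ‖f x‖ₑ) + (G x + ‖f x‖ₑ) := add_le_add le_add_self (h1.trans hxB.le)
        _ = 2 * (G x + ‖f x‖ₑ) := by ring
        _ ≤ 4 * (G x + ‖f x‖ₑ) := by gcongr; norm_num
    · rw [hmem x hx hxB]
      simp
  · by_cases hboth : x ∈ B ∨ y ∈ B
    · have h1 : ‖v x - v y‖ₑ ≤ ENNReal.ofReal (dist x y ^ s) * (2 * n) := by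
        have e : (2 * n : ℝ≥0∞) = ENNReal.ofReal (2 * n) := by
          rw [ENNReal.ofReal_mul (by norm_num), ENNReal.ofReal_natCast]; simp
        rw [e, ← ENNReal.ofReal_mul (by positivity), ← ofReal_norm, mul_comm]
        exact ENNReal.ofReal_le_ofReal (hv1 x y)
      have h2 : G x + G y + 2 * n ≤ h x + h y := by
        by_cases hxB : x ∈ B
        · by_cases hyB : y ∈ B
          · calc G x + G y + 2 * n ≤ (G x + 3 * n) + (G y + 3 * n) := by
                  calc G x + G y + 2 * n ≤ G x + G y + 6 * n := by gcongr; norm_num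
                    _ = _ := by ring
              _ ≤ _ := add_le_add (hhn x hxB) (hhn y hyB)
          · calc G x + G y + 2 * n ≤ G x + n + 2 * n := by gcongr; exact (hnB y hyB).1
              _ = G x + 3 * n := by ring
              _ ≤ h x := hhn x hxB
              _ ≤ _ := le_self_add
        · have hyB := hboth.resolve_left hxB
          calc G x + G y + 2 * n ≤ n + G y + 2 * n := by gcongr; exact (hnB x hxB).1
            _ = G y + 3 * n := by ring
            _ ≤ h y := hhn y hyB
            _ ≤ _ := le_add_self
      calc ‖f x - v x - (f y - v y)‖ₑ = ‖(f x - f y) - (v x - v y)‖ₑ := by congr 1; ring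
        _ ≤ ‖f x - f y‖ₑ + ‖v x - v y‖ₑ := enorm_sub_le
        _ ≤ ENNReal.ofReal (dist x y ^ s) * (G x + G y) +
            ENNReal.ofReal (dist x y ^ s) * (2 * n) := add_le_add (hG x hx y hy) h1
        _ = ENNReal.ofReal (dist x y ^ s) * (G x + G y + 2 * n) := by ring
        _ ≤ _ := by gcongr
    · rw [not_or] at hboth
      rw [hmem x hx hboth.1, hmem y hy hboth.2]
      simp

omit [MetricSpace X] in
lemma tlFunctional_top (g : ℤ → X → ℝ≥0∞) :
    tlFunctional μ p ∞ g = eLpNorm (fun x => ⨆ k, g k x) p μ := by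
  simp only [tlFunctional, lqNorm, if_true]

/-- The supremum of a fractional gradient is a gradient. -/
lemma IsFracGradient.isGradient_iSup {u : X → EReal} (hu : ∀ᵐ x ∂μ, u x ≠ ⊤ ∧ u x ≠ ⊥)
    {g : ℤ → X → ℝ≥0∞} (hg : IsFracGradient μ s u g) :
    IsGradient μ s u (fun x => ⨆ k, g k x) := by
  obtain ⟨h1, E, hE, h2⟩ := hg
  refine ⟨AEMeasurable.iSup h1, E ∪ {x | ¬ (u x ≠ ⊤ ∧ u x ≠ ⊥)}, measure_union_null hE hu,
    fun x hx y hy => ?_⟩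
  simp only [Set.mem_union, Set.mem_ofPred_eq, not_or, not_not] at hx hy
  -- No dyadic scale covers `x = y`; there the difference vanishes because `u x` is finite.
  rcases eq_or_ne x y with rfl | hne
  · rw [EReal.sub_self hx.2.1 hx.2.2, EReal.abs_zero]
    exact zero_le
  · obtain ⟨k, hk1, hk2⟩ := exists_dyadic_scale (dist_pos.2 hne)
    refine (h2 k x hx.1 y hy.1 hk1 hk2).trans ?_
    gcongr
    · exact le_iSup (fun k => g k x) k
    · exact le_iSup (fun k => g k y) k

/-- The spaces `M^{s,p}` and `M^s_{p,∞}` coincide. -/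
lemma hajlaszNorm_eq {u : X → EReal} (hu : MemL0 μ u) :
    hajlaszNorm μ s p u = gradNorm μ s p (tlFunctional μ p ∞) u := by
  rw [hajlaszNorm, gradNorm]
  congr 1
  refine le_antisymm (le_iInf₂ fun g hg => ?_) (le_iInf₂ fun g hg => ?_)
  · rw [tlFunctional_top]
    exact iInf₂_le _ (hg.isGradient_iSup hu.2)
  · obtain ⟨E, hE, h⟩ := hg.2
    have hg' : IsFracGradient μ s u (fun _ => g) :=
      ⟨fun _ => hg.1, E, hE, fun _ x hx y hy _ _ => h x hx y hy⟩
    refine (iInf₂_le _ hg').trans (le_of_eq ?_)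
    rw [tlFunctional_top]
    simp only [ciSup_const]

/-- Hölder continuous functions are dense in `M^s_{p,∞}`. -/
theorem dense_tlFunctional_top [BorelSpace X] (hs : 0 < s) (hs1 : s ≤ 1) (hp : 0 < p) (hp' : p ≠ ∞)
    (f : X → ℝ) (ε : ℝ≥0∞) (hf : AEMeasurable f μ)
    (hfin : gradNorm μ s p (tlFunctional μ p ∞) (fun x => (f x : EReal)) < ∞) (hε : 0 < ε) :
    ∃ v : X → ℝ, Continuous v ∧
      gradNorm μ s p (tlFunctional μ p ∞) (fun x => ((f x - v x : ℝ) : EReal)) ≤ ε := by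
  have hpr := ENNReal.toReal_pos hp.ne' hp'
  obtain ⟨K, hK1, hKt, hK⟩ := exists_rpow_ge_two p.toReal hpr
  obtain ⟨g, hg, hlt⟩ := gradNorm_lt_iff.1 hfin
  obtain ⟨hGm, E, hμE, hG⟩ := hg.isGradient_iSup (memL0_coe hf).2
  set G : X → ℝ≥0∞ := fun x => ⨆ k, g k x with hGdef
  simp only [abs_coe_sub] at hG
  rw [lpNormX_coe hp hp', tlFunctional_top, eLpNorm_eq_rNorm hp.ne' hp'] at hlt
  set m : X → ℝ≥0∞ := fun x => G x + ‖f x‖ₑ with hm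
  have hmm : AEMeasurable m μ := hGm.add hf.enorm
  have hmn : rNorm μ p.toReal m ≠ ∞ := by
    refine ne_top_of_le_ne_top ?_ (rNorm_add_le hpr hK1 hK hGm hf.enorm
      (C := rNorm μ p.toReal (fun x => ‖f x‖ₑ) + rNorm μ p.toReal G) le_add_self le_self_add)
    exact ENNReal.mul_ne_top (by simp) (ENNReal.mul_ne_top (ENNReal.pow_ne_top hKt) hlt.ne)
  set h : ℕ → X → ℝ≥0∞ := fun n => {x | (n : ℝ≥0∞) < m x}.indicator (fun x => 4 * m x) with hh
  have hhm : ∀ n, AEMeasurable (h n) μ := fun n =>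
    (hmm.const_mul 4).indicator₀ (nullMeasurableSet_lt aemeasurable_const hmm)
  -- Dominated convergence with majorant `4 * m`: at almost every point `m` is finite and `h n` is
  -- eventually zero.
  have hlim : Tendsto (fun n => rNorm μ p.toReal (h n)) atTop (𝓝 0) := by
    refine tendsto_rNorm_zero hpr hhm (g := fun x => 4 * m x)
      (fun n x => Set.indicator_le_self _ _ _) ?_ ?_
    · rw [rNorm_const_mul hpr (by simp)]
      exact ENNReal.mul_ne_top (by simp) hmn
    · filter_upwards [ae_lt_top_of_rNorm hpr hmm hmn] with x hx
      obtain ⟨N, hN⟩ := ENNReal.exists_nat_gt hx.ne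
      refine tendsto_const_nhds.congr' ?_
      filter_upwards [eventually_ge_atTop N] with n hn
      refine (Set.indicator_of_notMem (fun hmem => ?_) _).symm
      have h1 : (n : ℝ≥0∞) < m x := hmem
      have h2 : (N : ℝ≥0∞) ≤ n := by exact_mod_cast hn
      exact absurd (h1.trans hN) (not_lt.2 h2)
  have hlim2 : Tendsto (fun n => rNorm μ p.toReal (h n) + rNorm μ p.toReal (h n)) atTop (𝓝 0) := by
    simpa using hlim.add hlim
  obtain ⟨n, hn⟩ := ((tendsto_order.1 hlim2).2 ε hε).exists
  obtain ⟨v, hv, hv1, hv2⟩ := exists_truncation hs hs1 hG n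
  refine ⟨v, hv, le_trans ?_ hn.le⟩
  have hgrad : IsFracGradient μ s (fun x => ((f x - v x : ℝ) : EReal)) (fun _ => h n) := by
    refine ⟨fun _ => hhm n, E, hμE, fun _ x hx y hy _ _ => ?_⟩
    rw [abs_coe_sub]
    exact hv2 x hx y hy
  refine (gradNorm_le hgrad).trans (add_le_add ?_ ?_)
  · rw [lpNormX_coe hp hp']
    refine rNorm_mono hpr ?_
    filter_upwards [measure_eq_zero_iff_ae_notMem.1 hμE] with x hx
    exact hv1 x hx
  · rw [tlFunctional_top, eLpNorm_eq_rNorm hp.ne' hp']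
    simp only [ciSup_const, le_refl]

/-- Every admissible norm is a good norm. -/
theorem IsAdmissibleNorm.exists_isGoodNorm [BorelSpace X] (hμ : IsDoublingSpace μ)
    {N : (X → EReal) → ℝ≥0∞} (hN : IsAdmissibleNorm μ p N) :
    ∃ K : ℝ≥0∞, IsGoodNorm μ p N K := by
  obtain ⟨hp, hp', s, hs, h⟩ := hN
  have htop : s ≤ 1 → ∃ K : ℝ≥0∞, IsGoodNorm μ p (gradNorm μ s p (tlFunctional μ p ∞)) K := by
    intro hs1
    obtain ⟨K, hK1, hKt, hK, hΦ⟩ :=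
      isGradFunctional_tl (μ := μ) (q := ∞) hp hp'.ne ENNReal.zero_lt_top
    exact ⟨_, isGoodNorm_gradNorm hp hp'.ne hK1 hKt hK hΦ fun f ε hf hfin hε =>
      dense_tlFunctional_top hs hs1 hp hp'.ne f ε hf hfin hε⟩
  rcases h with ⟨hs1, q, hq, hq', rfl | rfl⟩ | ⟨hs1, rfl | rfl⟩
  · obtain ⟨K, hK1, hKt, hK, hΦ⟩ := isGradFunctional_besov (μ := μ) hp hp'.ne hq
    exact ⟨_, isGoodNorm_gradNorm (s := s) hp hp'.ne hK1 hKt hK hΦ fun f ε _ hfin hε =>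
      dense_of_isTailFunctional hμ hs hs1 hp hp'.ne hK1 hKt hΦ
        (isTailFunctional_besov hp hp'.ne hq hq'.ne) f ε hfin hε⟩
  · obtain ⟨K, hK1, hKt, hK, hΦ⟩ := isGradFunctional_tl (μ := μ) hp hp'.ne hq
    exact ⟨_, isGoodNorm_gradNorm (s := s) hp hp'.ne hK1 hKt hK hΦ fun f ε _ hfin hε =>
      dense_of_isTailFunctional hμ hs hs1 hp hp'.ne hK1 hKt hΦ
        (isTailFunctional_tl hp hp'.ne hq hq'.ne) f ε hfin hε⟩
  · exact htop hs1
  · obtain ⟨K, hK⟩ := htop hs1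
    exact ⟨K, hK.of_eq fun u hu => hajlaszNorm_eq hu⟩

end HajlaszDensity

end MedianDiff

end

/-! ### The equivalence for the concrete spaces. -/

theorem mainTheorem2 {X : Type*} [MetricSpace X] [MeasurableSpace X] [BorelSpace X]
    (μ : MeasureTheory.Measure X) (hμ : MedianDiff.IsDoublingSpace μ)
    (𝓑 : X → Set (Set X)) (h𝓑 : MedianDiff.IsDifferentiationBasis μ 𝓑)
    (p : ℝ≥0∞) (N : (X → EReal) → ℝ≥0∞) (hN : MedianDiff.IsAdmissibleNorm μ p N) :
    List.TFAE [
      -- (1) quasicontinuous functions of the space are limits of medians quasieverywhere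
      ∀ u : X → EReal, MedianDiff.MemSpace μ N u → MedianDiff.Quasicontinuous μ p N u →
        ∃ E : Set X, MedianDiff.capacity μ p N E = 0 ∧
          ∀ γ : ℝ, 0 < γ → γ < 1 → ∀ x ∉ E, MedianDiff.HasMedianLimit μ 𝓑 γ u x (u x),
      -- (2) capacitary weak type estimate
      ∀ γ : ℝ, 0 < γ → γ < 1 → ∃ C : ℝ≥0, ∀ t : ℝ, 0 < t →
        ∀ u : X → EReal, MedianDiff.MemSpace μ N u →
          MedianDiff.capacity μ p N
              {x | (t : EReal) < MedianDiff.limsupMedian μ 𝓑 γ (MedianDiff.absFun u) x}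
            ≤ C * ENNReal.ofReal (t ^ (-p.toReal)) * N u ^ p.toReal,
      -- (3) continuity at zero
      ∀ γ : ℝ, 0 < γ → γ < 1 → ∀ t : ℝ, 0 < t →
        ∀ u : ℕ → X → EReal, (∀ k, MedianDiff.MemSpace μ N (u k)) →
          Tendsto (fun k => N (u k)) atTop (𝓝 0) →
          Tendsto (fun k => MedianDiff.capacity μ p N
              {x | (t : EReal) < MedianDiff.limsupMedian μ 𝓑 γ (MedianDiff.absFun (u k)) x})
            atTop (𝓝 0)] := by
  obtain ⟨K, hK⟩ := hN.exists_isGoodNorm hμ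
  tfae_have 1 → 2 := by
    intro h γ hγ0 hγ1
    have hKp : K ^ p.toReal ≠ ∞ := ENNReal.rpow_ne_top_of_nonneg hK.exp_pos.le hK.ne_top
    refine ⟨(K ^ p.toReal).toNNReal, fun t ht u hu => ?_⟩
    rw [ENNReal.coe_toNNReal hKp]
    exact hK.weakType_of_hasMedianLimit h hγ0 hγ1 ht hu
  tfae_have 2 → 3 := by
    intro h γ hγ0 hγ1 t ht u hu hlim
    obtain ⟨C, hC⟩ := h γ hγ0 hγ1
    exact hK.tendsto_of_weakType (hC t ht) hu hlim
  tfae_have 3 → 1 := fun h u hu hq => hK.hasMedianLimit_of_tendsto h𝓑 h hu hq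
  tfae_finish
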